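/- All graphs and matroids are finite; graphs may have loops and parallel edges. Cycles are identified with their edge sets (a loop is a cycle of length one, two parallel edges form a cycle of length two). Let $G$ be a graph whose simplification $\mathrm{si}(G)$ (delete all loops and all but one edge from each class of parallel edges) is obtained from a complete graph by deleting the edges of a path with at most two (possibly zero) edges. **Definitions.** A *proper tripartition* of the cycles of $G$ is a partition $(\mathcal B,\mathcal L,\mathcal F)$ of the set of cycles of $G$ into three (possibly empty) classes such that no theta subgraph contains exactly two cycles in $\mathcal B$, and every cycle in $\mathcal L$ shares a vertex with every cycle in $\mathcal F$. $M(G,\mathcal B,\mathcal L,\mathcal F)$ is the matroid on $E(G)$ whose circuits are the cycles in $\mathcal B$, the theta subgraphs with no cycle in $\mathcal B$, the tight handcuffs (two edge-disjoint cycles with exactly one common vertex) with neither cycle in $\mathcal B$, the unions of two vertex-disjoint cycles in $\mathcal L$, and the loose handcuffs (two vertex-disjoint cycles with a minimal path connecting them) with both cycles in $\mathcal F$. A *framework* for a matroid $M$ is a graph $G$ with $E(G)=E(M)$ such that the edge set of each component of $G$ has rank at most the number of its vertices, for each vertex $v$ the closure of $E(G-v)$ in $M$ contains no edge joining $v$ to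 another vertex, and no circuit of $M$ induces a subgraph of $G$ with more than two components; in this case we take $\mathcal B$ to be the set of cycles of $G$ that are circuits of $M$. Cycles in $\mathcal B$ are *balanced*, all others *unbalanced*; a set $X\subseteq E(G)$ is a *balancing set* if $G$ has an unbalanced cycle but $G\setminus X$ does not. A matroid is *connected* if any two distinct elements lie in a common circuit, *$3$-connected* if it has no $1$- or $2$-separation, *simple* if it has no loops and no parallel pairs, and *unbreakable* if it is connected and $M/F$ is connected for every flat $F$. $G[W]$ is the subgraph induced by $W$ and $E[V_1,V_2]$ the set of edges with one end in $V_1$ and the other in $V_2$. Parts of vertex partitions are non-empty. **Theorem.** (a) Let $|V(G)|>6$, and let $M$ be either a matroid with framework $G$, or $M=M(G,\mathcal B,\mathcal L,\mathcal F)$ for a proper tripartition of the cycles of $G$. Then $M$ is $3$-connected if and only if $M$ is simple and $G$ has no balancing set $X$ with $r_M(X)\le 2$. (b) Let $|V(G)|>3$ and let $M=M(G,\mathcal B,\mathcal L,\mathcal F)$ be connected. Then $M$ is not unbreakable if and only if one of the following holds: - (i) $V(G)$ has a partition $(V_1,V_2,V_3)$ such that $G[V_i]$ is connected for $i=1,2,3$,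 there are no edges between $V_1$ and $V_2$, and either $G[V_i]$ contains a cycle in $\mathcal L$ for some $i\in\{1,2,3\}$, or every cycle of $G$ is balanced. - (ii) $V(G)$ has a partition $(V_1,V_2)$ such that $G[V_1]$ and $G[V_2]$ are connected and $E[V_1,V_2]$ has a partition into two balancing sets. - (iii) $V(G)$ has a partition $(V_1,V_2)$ and there is a balancing set $X\subseteq E(G[V_1])$ such that $G[V_1]\setminus X$ and $G[V_2]$ are connected. - (iii)$'$ $V(G)$ has a partition $(V_1,V_2,V_3)$ and there is a balancing set $X\subseteq E(G[V_1\cup V_3])$ such that $G[V_1]\setminus X$, $G[V_2]$ and $G[V_3]\setminus X$ are connected, $G[V_3]$ contains a cycle in $\mathcal F$, and there are no edges between $V_2$ and $V_3$. - (iv) $V(G)$ has a partition $(V_1,V_2)$ and there is a balancing set $X\subseteq E(G[V_1])\cup E(G[V_2])$ such that, for $i=1,2$, $G[V_i]\setminus X$ is connected and $G[V_i]$ contains a cycle in $\mathcal L$. - (v) $V(G)$ has a partition $(V_1,V_2,V_3)$ such that $G[V_i]$ is connected for $i=1,2,3$, there are no edges between $V_1$ and $V_2$, and $G[V_3]$ contains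 a cycle in $\mathcal F$. -/

import Mathlib

open scoped Graph Matroid

namespace QuasiGraphic

/-! Multigraphs are Mathlib's `Graph α β` (loops and parallel edges allowed). -/

section Graphs

variable {α β : Type*}

/-- A graph is connected if it is non-empty and any two of its vertices are joined by a walk;
loops and multiplicities play no role, so this is read off the simplification of `G`. -/
def IsConnected (G : Graph α β) : Prop := G.toSimpleGraph.Connected

/-- The vertices incident with an edge in `X`. -/
def ends (G : Graph α β) (X : Set β) : Set α := {x | ∃ e ∈ X, G.Inc e x}

/-- `G[X]` for a set `X` of edges: its edges are those in `X`, its vertices the ends of these. -/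
def edgeInduce (G : Graph α β) (X : Set β) : Graph α β := (G.restrict X).induce (ends G X)

/-- The edges with one end in `V₁` and one end in `V₂` (used for disjoint `V₁`, `V₂`). -/
def edgesBetween (G : Graph α β) (V₁ V₂ : Set α) : Set β :=
  {e | ∃ x ∈ V₁, ∃ y ∈ V₂, G.IsLink e x y}

/-- `C` is the edge set of a cycle of `G`, with distinct vertices `v 0, …, v n` and distinct edges
`e i` joining `v i` to `v (i + 1)`, indices modulo `n + 1`. Loops (`n = 0`) and pairs of parallel
edges (`n = 1`) are cycles. -/
def IsCycle (G : Graph α β) (C : Set β) : Prop :=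
  ∃ (n : ℕ) (v : Fin (n + 1) → α) (e : Fin (n + 1) → β),
    Function.Injective v ∧ Function.Injective e ∧
    (∀ i, G.IsLink (e i) (v i) (v (i + 1))) ∧ Set.range e = C

/-- There is a path of `G` from `x` to `y` with vertex set `U` and edge set `P`. -/
def IsPath (G : Graph α β) (x y : α) (U : Set α) (P : Set β) : Prop :=
  ∃ (n : ℕ) (v : Fin (n + 1) → α) (e : Fin n → β),
    Function.Injective v ∧ (∀ i : Fin n, G.IsLink (e i) (v i.castSucc) (v i.succ)) ∧
    v 0 = x ∧ v (Fin.last n) = y ∧ Set.range v = U ∧ Set.range e = P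

/-- `P₁`, `P₂`, `P₃` are the edge sets of three paths that join the same two distinct vertices and
are otherwise disjoint. Their union is a theta subgraph of `G`, and the three cycles of that
subgraph are `P₁ ∪ P₂`, `P₁ ∪ P₃` and `P₂ ∪ P₃`. -/
def IsTheta (G : Graph α β) (P₁ P₂ P₃ : Set β) : Prop :=
  ∃ (x y : α) (U₁ U₂ U₃ : Set α), x ≠ y ∧
    IsPath G x y U₁ P₁ ∧ IsPath G x y U₂ P₂ ∧ IsPath G x y U₃ P₃ ∧
    U₁ ∩ U₂ = {x, y} ∧ U₁ ∩ U₃ = {x, y} ∧ U₂ ∩ U₃ = {x, y} ∧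
    Disjoint P₁ P₂ ∧ Disjoint P₁ P₃ ∧ Disjoint P₂ P₃

/-- The simplification of `G` is obtained from the complete graph on the vertices of `G` by
deleting the edges of a path with at most two edges (possibly none). -/
def IsNearlyComplete (G : Graph α β) : Prop :=
  ∃ (u w : V(G)) (p : (⊤ : SimpleGraph V(G)).Walk u w), p.IsPath ∧ p.length ≤ 2 ∧
    G.toSimpleGraph = (⊤ : SimpleGraph V(G)).deleteEdges {e | e ∈ p.edges}

/-- With `𝓑` the set of balanced cycles of `G`, the set `X` of edges is a balancing set if `G` has
an unbalanced cycle but `G ∖ X` does not. -/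
def IsBalancingSet (G : Graph α β) (𝓑 : Set (Set β)) (X : Set β) : Prop :=
  X ⊆ E(G) ∧ (∃ C, IsCycle G C ∧ C ∉ 𝓑) ∧ ∀ C, IsCycle (G.deleteEdges X) C → C ∈ 𝓑

end Graphs

section Matroids

variable {α β : Type*}

/-- A matroid is connected if any two distinct elements lie in a common circuit. -/
def MatroidConnected (M : Matroid β) : Prop :=
  ∀ e ∈ M.E, ∀ f ∈ M.E, e ≠ f → ∃ C, M.IsCircuit C ∧ e ∈ C ∧ f ∈ C

/-- A matroid is unbreakable if it is connected and contracting any flat leaves it connected. -/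
def Unbreakable (M : Matroid β) : Prop :=
  MatroidConnected M ∧ ∀ F, M.IsFlat F → MatroidConnected (M ／ F)

/-- A matroid is simple if it has no loops and no parallel pairs. -/
def MatroidSimple (M : Matroid β) : Prop := ∀ C, M.IsCircuit C → 2 < C.encard

/-- `(X, Y)` is a `k`-separation of `M`: a partition of the ground set with `|X|, |Y| ≥ k` and
`r(X) + r(Y) - r(M) < k`. -/
def IsSeparation (M : Matroid β) (k : ℕ) (X Y : Set β) : Prop :=
  X ∪ Y = M.E ∧ Disjoint X Y ∧ (k : ℕ∞) ≤ X.encard ∧ (k : ℕ∞) ≤ Y.encard ∧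
    M.eRk X + M.eRk Y < M.eRank + k

/-- A matroid is 3-connected (in the sense of Tutte) if it has no `1`- and no `2`-separation. -/
def ThreeConnected (M : Matroid β) : Prop :=
  ∀ k : ℕ, 1 ≤ k → k < 3 → ∀ X Y, ¬ IsSeparation M k X Y

/-- `G` is a framework for `M`; a matroid is quasi-graphic if it has a framework. -/
structure IsFramework (M : Matroid β) (G : Graph α β) : Prop where
  ground_eq : M.E = E(G)
  /-- The edge set of a component of `G` has rank at most the number of vertices of it. -/
  rank_component_le : ∀ H : Graph α β, H ≤c G → IsConnected H → M.eRk E(H) ≤ V(H).encard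
  /-- The closure of `E(G - v)` contains no edge that joins `v` to another vertex. -/
  notMem_closure : ∀ v ∈ V(G), ∀ w, w ≠ v → ∀ e, G.IsLink e v w →
    e ∉ M.closure E(G.deleteVerts {v})
  /-- No circuit of `M` induces a subgraph of `G` with more than two components. -/
  components_circuit_le : ∀ C, M.IsCircuit C →
    ENat.card (edgeInduce G C).toSimpleGraph.ConnectedComponent ≤ 2

/-- The cycles of `G` that are circuits of `M`: the balanced cycles of a framework. -/
def circuitCycles (M : Matroid β) (G : Graph α β) : Set (Set β) :=
  {C | IsCycle G C ∧ M.IsCircuit C}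

/-- A proper tripartition of the cycles of `G` into balanced cycles (satisfying the theta
property), lift-type cycles and frame-type cycles. The classes may be empty. Together with `G`
this is a quasi-biased graph. -/
structure ProperTripartition (G : Graph α β) where
  /-- the balanced cycles -/
  balanced : Set (Set β)
  /-- the lift-type cycles -/
  lift : Set (Set β)
  /-- the frame-type cycles -/
  frame : Set (Set β)
  union_eq : balanced ∪ lift ∪ frame = {C | IsCycle G C}
  disjoint_balanced_lift : Disjoint balanced lift
  disjoint_balanced_frame : Disjoint balanced frame
  disjoint_lift_frame : Disjoint lift frame
  /-- No theta subgraph contains exactly two balanced cycles. -/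
  theta_property : ∀ P₁ P₂ P₃, IsTheta G P₁ P₂ P₃ →
    P₁ ∪ P₂ ∈ balanced → P₁ ∪ P₃ ∈ balanced → P₂ ∪ P₃ ∈ balanced
  /-- Every lift-type cycle shares a vertex with every frame-type cycle. -/
  lift_meets_frame : ∀ C ∈ lift, ∀ D ∈ frame, (ends G C ∩ ends G D).Nonempty

/-- The edge sets declared to be the circuits of the matroid `M(G, 𝓑, 𝓛, 𝓕)`. -/
inductive ProperTripartition.IsCircuitSet {G : Graph α β} (T : ProperTripartition G) :
    Set β → Prop
  | balanced_cycle (C : Set β) (hC : C ∈ T.balanced) : T.IsCircuitSet C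
  | theta (P₁ P₂ P₃ : Set β) (h : IsTheta G P₁ P₂ P₃) (h₁₂ : P₁ ∪ P₂ ∉ T.balanced)
      (h₁₃ : P₁ ∪ P₃ ∉ T.balanced) (h₂₃ : P₂ ∪ P₃ ∉ T.balanced) :
      T.IsCircuitSet (P₁ ∪ P₂ ∪ P₃)
  | tight_handcuff (C D : Set β) (hC : IsCycle G C) (hD : IsCycle G D) (hCb : C ∉ T.balanced)
      (hDb : D ∉ T.balanced) (hdisj : Disjoint C D) (x : α) (hx : ends G C ∩ ends G D = {x}) :
      T.IsCircuitSet (C ∪ D)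
  | lift_pair (C D : Set β) (hC : C ∈ T.lift) (hD : D ∈ T.lift)
      (hdisj : Disjoint (ends G C) (ends G D)) : T.IsCircuitSet (C ∪ D)
  | loose_handcuff (C D P : Set β) (U : Set α) (x y : α) (hC : C ∈ T.frame) (hD : D ∈ T.frame)
      (hdisj : Disjoint (ends G C) (ends G D)) (hP : IsPath G x y U P)
      (hx : U ∩ ends G C = {x}) (hy : U ∩ ends G D = {y}) : T.IsCircuitSet (C ∪ D ∪ P)

/-- `M = M(G, 𝓑, 𝓛, 𝓕)`: the matroid on `E(G)` with the circuits above. -/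
def ProperTripartition.IsMatroid {G : Graph α β} (T : ProperTripartition G) (M : Matroid β) :
    Prop :=
  M.E = E(G) ∧ ∀ C, M.IsCircuit C ↔ T.IsCircuitSet C

end Matroids

section Outcomes

variable {α β : Type*} {G : Graph α β}

/-- `(V₁, V₂)` is a partition of the vertex set (non-emptiness of the parts follows from the
connectivity of the graphs on them wherever this is used). -/
def IsBipartition (G : Graph α β) (V₁ V₂ : Set α) : Prop :=
  V₁ ∪ V₂ = V(G) ∧ Disjoint V₁ V₂

/-- `(V₁, V₂, V₃)` is a partition of the vertex set (non-emptiness as for two parts). -/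
def IsTripartition (G : Graph α β) (V₁ V₂ V₃ : Set α) : Prop :=
  V₁ ∪ V₂ ∪ V₃ = V(G) ∧ Disjoint V₁ V₂ ∧ Disjoint V₁ V₃ ∧ Disjoint V₂ V₃

/-- `G[W]` contains a cycle that belongs to `𝓒`. -/
def ContainsCycleIn (G : Graph α β) (W : Set α) (𝓒 : Set (Set β)) : Prop :=
  ∃ C ∈ 𝓒, C ⊆ E(G.induce W)

/-- There is a vertex partition `(V₁, V₂, V₃)` into connected parts with no `V₁`–`V₂` edges such that
some part contains a lift-type cycle or every cycle of `G` is balanced. -/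
def OutcomeOne (T : ProperTripartition G) : Prop :=
  ∃ V₁ V₂ V₃ : Set α, IsTripartition G V₁ V₂ V₃ ∧
    IsConnected (G.induce V₁) ∧ IsConnected (G.induce V₂) ∧ IsConnected (G.induce V₃) ∧
    edgesBetween G V₁ V₂ = ∅ ∧
    ((ContainsCycleIn G V₁ T.lift ∨ ContainsCycleIn G V₂ T.lift ∨ ContainsCycleIn G V₃ T.lift) ∨
      ∀ C, IsCycle G C → C ∈ T.balanced)

/-- There is a vertex partition `(V₁, V₂)` into connected parts such that `E[V₁, V₂]` is the disjoint
union of two balancing sets. -/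
def OutcomeTwo (T : ProperTripartition G) : Prop :=
  ∃ V₁ V₂ : Set α, IsBipartition G V₁ V₂ ∧
    IsConnected (G.induce V₁) ∧ IsConnected (G.induce V₂) ∧
    ∃ X Y : Set β, X ∪ Y = edgesBetween G V₁ V₂ ∧ Disjoint X Y ∧
      IsBalancingSet G T.balanced X ∧ IsBalancingSet G T.balanced Y

/-- There are a vertex partition `(V₁, V₂)` and a balancing set `X ⊆ E(G[V₁])` such that `G[V₁] ∖ X`
and `G[V₂]` are connected. -/
def OutcomeThree (T : ProperTripartition G) : Prop :=
  ∃ (V₁ V₂ : Set α) (X : Set β), IsBipartition G V₁ V₂ ∧ IsBalancingSet G T.balanced X ∧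
    X ⊆ E(G.induce V₁) ∧
    IsConnected ((G.induce V₁).deleteEdges X) ∧ IsConnected (G.induce V₂)

/-- There are a vertex partition `(V₁, V₂, V₃)` with no `V₂`–`V₃` edges and a balancing set
`X ⊆ E(G[V₁ ∪ V₃])` such that `G[V₁] ∖ X`, `G[V₂]`, `G[V₃] ∖ X` are connected and `G[V₃]` contains a
frame-type cycle. -/
def OutcomeThreePrime (T : ProperTripartition G) : Prop :=
  ∃ (V₁ V₂ V₃ : Set α) (X : Set β), IsTripartition G V₁ V₂ V₃ ∧
    IsBalancingSet G T.balanced X ∧ X ⊆ E(G.induce (V₁ ∪ V₃)) ∧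
    IsConnected ((G.induce V₁).deleteEdges X) ∧ IsConnected (G.induce V₂) ∧
    IsConnected ((G.induce V₃).deleteEdges X) ∧
    ContainsCycleIn G V₃ T.frame ∧ edgesBetween G V₂ V₃ = ∅

/-- There are a vertex partition `(V₁, V₂)` and a balancing set `X ⊆ E(G[V₁]) ∪ E(G[V₂])` such that
`G[V₁] ∖ X` and `G[V₂] ∖ X` are connected and each `G[Vᵢ]` contains a lift-type cycle. -/
def OutcomeFour (T : ProperTripartition G) : Prop :=
  ∃ (V₁ V₂ : Set α) (X : Set β), IsBipartition G V₁ V₂ ∧ IsBalancingSet G T.balanced X ∧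
    X ⊆ E(G.induce V₁) ∪ E(G.induce V₂) ∧
    IsConnected ((G.induce V₁).deleteEdges X) ∧ IsConnected ((G.induce V₂).deleteEdges X) ∧
    ContainsCycleIn G V₁ T.lift ∧ ContainsCycleIn G V₂ T.lift

/-- There is a vertex partition `(V₁, V₂, V₃)` into connected parts with no `V₁`–`V₂` edges such that
`G[V₃]` contains a frame-type cycle. -/
def OutcomeFive (T : ProperTripartition G) : Prop :=
  ∃ V₁ V₂ V₃ : Set α, IsTripartition G V₁ V₂ V₃ ∧
    IsConnected (G.induce V₁) ∧ IsConnected (G.induce V₂) ∧ IsConnected (G.induce V₃) ∧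
    edgesBetween G V₁ V₂ = ∅ ∧ ContainsCycleIn G V₃ T.frame

end Outcomes

end QuasiGraphic

open QuasiGraphic

/-!
Both parts rest on rank formulas. Let `M` be a matroid on `E(G)` such that the edges avoiding a
vertex `v` span no edge from `v` to another vertex (`IsPreFramework`). Growing a forest one vertex
at a time raises the rank by one in each step, so a set `S` of edges that reaches all vertices from
a set `W` satisfies `r(S) ≥ r(Q) + |V(G) ∖ W|` for each `Q ⊆ S` inside `W`
(`IsPreFramework.le_nrk`). When the forest and `Q` span `S`, this is an equality
(`IsPreFramework.nrk_eq`), in terms of the number of components of `(V(G), S)` that avoid `Q`. With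
`n = |V(G)|` and `G` connected, a spanning connected set has rank at least `n - 1`, and at least `n`
if it contains an unbalanced cycle, while a set with only balanced cycles has rank at most `n - 1`.

*3-connectivity.* A loop, a parallel pair, or a balancing set of rank at most two gives a separation
together with its complement. Conversely, let `(X, Y)` be a `k`-separation with `k ≤ 2` of a simple
matroid. If `Y` is connected and spanning, the rank bounds force all cycles in `Y` to be balanced
and `X` to be a balancing set of rank at most two. Otherwise, let `m` be a vertex that all
non-adjacent pairs of `G` share (`IsNearlyComplete.exists_center`). Then `m` is isolated in one of
the two sides, and the other side joins it to all but at most two vertices; for `n ≥ 7` the ranks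
add up to at least `n + 2` (`IsPreFramework.ncard_add_two_le`).

*Unbreakability.* A connected matroid is not unbreakable if and only if it has two hyperplanes
`H₁`, `H₂` that cover the ground set and meet in rank `r(M) - 2` (`exists_hyperplanePair`,
`not_unbreakable_of_cover`). For each of the outcomes such a pair can be written down. Conversely,
given the pair, the rank of `F = H₁ ∩ H₂` determines the number of components of `(V(G), F)`, and these
components are the parts of the required partition.

* If every cycle of `G` is balanced, there are three components. A hyperplane does not join all of
  them, so between two of them there is no edge (`IsTripartition.edgesBetween_eq_empty`).
* If `G` has an unbalanced cycle but `F` has none, there are two components. A hyperplane with an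
  edge between them contains only balanced cycles, so its complement is a balancing set
  (`HyperplanePair.outcome_of_balanced_inter`).
* If `F` has an unbalanced cycle `C`, there are three components, since two frame-type cycles of `F`
  lie in the same component (`HyperplanePair.exists_reach_of_frame`). Again some two of the three
  have no edge between them, and the outcome depends on the type of `C` and on which two these are
  (`HyperplanePair.outcome_of_unbalanced_inter`).
-/

namespace QuasiGraphic

/-! ### Ranks, hyperplane pairs and unbreakability -/

section Rank

variable {β : Type*} {M : Matroid β} {X Y : Set β} {e : β}

/-- The rank of `X` as a natural number (only meaningful for matroids of finite rank). -/
noncomputable def nrk (M : Matroid β) (X : Set β) : ℕ := (M.eRk X).toNat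

lemma coe_nrk (M : Matroid β) [M.RankFinite] (X : Set β) : (nrk M X : ℕ∞) = M.eRk X :=
  ENat.natCast_toNat (Matroid.eRk_ne_top_iff.2 (M.isRkFinite_set X))

lemma nrk_mono (M : Matroid β) [M.RankFinite] (h : X ⊆ Y) : nrk M X ≤ nrk M Y := by
  have := M.eRk_mono h
  rw [← coe_nrk, ← coe_nrk] at this
  exact_mod_cast this

lemma nrk_submod (M : Matroid β) [M.RankFinite] (X Y : Set β) :
    nrk M (X ∩ Y) + nrk M (X ∪ Y) ≤ nrk M X + nrk M Y := by
  have := M.eRk_inter_add_eRk_union_le X Y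
  simp only [← coe_nrk] at this
  exact_mod_cast this

lemma nrk_insert_of_notMem_closure [M.RankFinite] (he : e ∈ M.E) (h : e ∉ M.closure X) :
    nrk M (insert e X) = nrk M X + 1 := by
  have := M.eRk_insert_eq_add_one ⟨he, h⟩
  simp only [← coe_nrk] at this
  exact_mod_cast this

lemma nrk_closure (M : Matroid β) (X : Set β) : nrk M (M.closure X) = nrk M X := by
  simp [nrk, Matroid.eRk_closure_eq]

lemma nrk_le_of_subset_closure (M : Matroid β) [M.RankFinite] (h : X ⊆ M.closure Y) :
    nrk M X ≤ nrk M Y := by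
  rw [← nrk_closure M Y]; exact nrk_mono M h

lemma nrk_le_ncard (M : Matroid β) [M.RankFinite] (hX : X.Finite) : nrk M X ≤ X.ncard := by
  have := M.eRk_le_encard X
  rw [← coe_nrk, ← hX.cast_ncard_eq] at this
  exact_mod_cast this

lemma nrk_eq_ncard_of_indep [M.RankFinite] (hX : M.Indep X) : nrk M X = X.ncard := by
  simp [nrk, hX.eRk_eq_encard, Set.ncard]

lemma ncard_le_nrk_of_indep [M.RankFinite] (hX : M.Indep X) (h : X ⊆ Y) :
    X.ncard ≤ nrk M Y := by
  rw [← nrk_eq_ncard_of_indep hX]; exact nrk_mono M h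

lemma nrk_ground (M : Matroid β) [M.RankFinite] : (nrk M M.E : ℕ∞) = M.eRank := by
  rw [coe_nrk, Matroid.eRk_ground]

end Rank

section Unbreakable

variable {β : Type*} {M : Matroid β}

lemma isFlat_inter {F F' : Set β} (h : M.IsFlat F) (h' : M.IsFlat F') : M.IsFlat (F ∩ F') := by
  rw [Matroid.isFlat_iff_closure_eq]
  refine Set.Subset.antisymm (Set.subset_inter ?_ ?_)
    (M.subset_closure _ (Set.inter_subset_left.trans h.subset_ground))
  · exact (M.closure_subset_closure Set.inter_subset_left).trans h.closure.subset
  · exact (M.closure_subset_closure Set.inter_subset_right).trans h'.closure.subset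

/-- Two hyperplanes that cover the ground set and meet in a flat of rank `r(M) - 2`. Contracting
their intersection disconnects `M`. -/
structure HyperplanePair (M : Matroid β) (H₁ H₂ : Set β) : Prop where
  flat_left : M.IsFlat H₁
  flat_right : M.IsFlat H₂
  union_eq : H₁ ∪ H₂ = M.E
  nrk_left : nrk M H₁ + 1 = nrk M M.E
  nrk_right : nrk M H₂ + 1 = nrk M M.E
  nrk_inter : nrk M (H₁ ∩ H₂) + 2 = nrk M M.E

lemma HyperplanePair.symm {H₁ H₂ : Set β} (h : HyperplanePair M H₁ H₂) :
    HyperplanePair M H₂ H₁ :=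
  ⟨h.2, h.1, Set.union_comm H₁ H₂ ▸ h.3, h.5, h.4, Set.inter_comm H₁ H₂ ▸ h.6⟩

/-- A connected matroid that is not unbreakable has two hyperplanes that cover the ground set and
meet in rank `r(M) - 2`: take a flat `F` that is maximal with `M ／ F` disconnected, witnessed by
`e` and `f`; by maximality every element outside `F` is parallel to `e` or to `f` in `M ／ F`. -/
lemma exists_hyperplanePair [M.Finite] (hM : MatroidConnected M) (h : ¬ Unbreakable M) :
    ∃ H₁ H₂, HyperplanePair M H₁ H₂ := by
  let 𝓢 : Set (Set β) := {F | M.IsFlat F ∧ ∃ e ∈ M.E \ F, ∃ f ∈ M.E \ F, e ≠ f ∧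
    ¬ ∃ C, (M ／ F).IsCircuit C ∧ e ∈ C ∧ f ∈ C}
  have hfin : 𝓢.Finite := M.ground_finite.finite_subsets.subset fun F hF => hF.1.subset_ground
  have hne : 𝓢.Nonempty := by
    simp only [Unbreakable, not_and, not_forall] at h
    obtain ⟨F, hF, hc⟩ := h hM
    simp only [MatroidConnected, not_forall] at hc
    obtain ⟨e, he, f, hf, hne, hC⟩ := hc
    exact ⟨F, hF, e, he, f, hf, hne, hC⟩
  obtain ⟨F, ⟨hF, e, he, f, hf, hef, hno⟩, hmax⟩ := hfin.exists_maximal hne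
  have key : ∀ g ∈ M.E, g ∉ F → e ∈ M.closure (insert g F) ∨ f ∈ M.closure (insert g F) := by
    intro g hg hgF
    by_contra! hcon
    have hss : insert g F ⊆ M.closure (insert g F) :=
      M.subset_closure _ (Set.insert_subset hg hF.subset_ground)
    have : M.closure (insert g F) ∈ 𝓢 := by
      refine ⟨M.isFlat_closure _, e, ⟨he.1, hcon.1⟩, f, ⟨hf.1, hcon.2⟩, hef, ?_⟩
      rintro ⟨C, hC, heC, hfC⟩
      rw [Matroid.contract_closure_eq_contract_delete, Matroid.delete_isCircuit_iff] at hC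
      have hC1 := hC.1
      rw [← Set.union_singleton, ← Matroid.contract_contract] at hC1
      obtain ⟨C', hC', hCC', -⟩ := hC1.exists_subset_isCircuit_of_contract
      exact hno ⟨C', hC', hCC' heC, hCC' hfC⟩
    exact hgF (hmax this (fun x hx => hss (Set.mem_insert_of_mem _ hx)) (hss (Set.mem_insert _ _)))
  have hFcl : M.closure F = F := hF.closure
  have ecl : ∀ x ∈ M.E, x ∈ M.closure (insert x F) := fun x hx =>
    M.mem_closure_of_mem' (Set.mem_insert _ _) hx
  have sub : ∀ x ∈ M.E, F ⊆ M.closure (insert x F) := fun x hx => by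
    conv_lhs => rw [← hFcl]
    exact M.closure_subset_closure (Set.subset_insert _ _)
  have exch : ∀ x ∈ M.E \ F, ∀ g, x ∈ M.closure (insert g F) → g ∈ M.closure (insert x F) := by
    intro x hx g hxg
    exact (M.closure_exchange ⟨hxg, by rw [hFcl]; exact hx.2⟩).1
  have nef : ∀ x ∈ M.E \ F, ∀ y ∈ M.E \ F, x ≠ y →
      (¬ ∃ C, (M ／ F).IsCircuit C ∧ x ∈ C ∧ y ∈ C) → y ∉ M.closure (insert x F) := by
    intro x hx y hy hxy hno hmem
    have : y ∈ (M ／ F).closure {x} := by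
      rw [Matroid.contract_closure_eq, Set.singleton_union]
      exact ⟨hmem, hy.2⟩
    obtain ⟨C, hCs, hC, hyC⟩ := Matroid.exists_isCircuit_of_mem_closure this (by simpa using hxy.symm)
    by_cases hxC : x ∈ C
    · exact hno ⟨C, hC, hxC, hyC⟩
    · have hCy : C = {y} := by
        refine Set.Subset.antisymm (fun z hz => ?_) (by simpa using hyC)
        rcases hCs hz with h | h
        · exact h
        · exact absurd (h ▸ hz) hxC
      have hl : (M ／ F).IsLoop y := by
        rw [← Matroid.singleton_isCircuit]; exact hCy ▸ hC
      rw [Matroid.contract_isLoop_iff_mem_closure, hFcl] at hl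
      exact hl.2 hl.1
  have r1 : nrk M (insert e F) = nrk M F + 1 :=
    nrk_insert_of_notMem_closure he.1 (by rw [hFcl]; exact he.2)
  have r2 : nrk M (insert f F) = nrk M F + 1 :=
    nrk_insert_of_notMem_closure hf.1 (by rw [hFcl]; exact hf.2)
  have r3 : nrk M (insert f (insert e F)) = nrk M F + 2 := by
    rw [nrk_insert_of_notMem_closure hf.1 (nef e he f hf hef hno), r1]
  have hun : M.closure (insert e F) ∪ M.closure (insert f F) = M.E := by
    refine Set.Subset.antisymm (Set.union_subset (M.closure_subset_ground _)
      (M.closure_subset_ground _)) fun g hg => ?_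
    by_cases hgF : g ∈ F
    · exact .inl (sub e he.1 hgF)
    · exact (key g hg hgF).imp (exch e he g) (exch f hf g)
  have r4 : nrk M M.E = nrk M F + 2 := by
    rw [← r3]
    refine le_antisymm (nrk_le_of_subset_closure M ?_) (nrk_mono M ?_)
    · rw [← hun]
      exact Set.union_subset (M.closure_subset_closure (Set.subset_insert _ _))
        (M.closure_subset_closure (Set.insert_subset_insert (Set.subset_insert _ _)))
    · exact Set.insert_subset hf.1 (Set.insert_subset he.1 hF.subset_ground)
  refine ⟨_, _, M.isFlat_closure (insert e F), M.isFlat_closure (insert f F), hun, ?_, ?_, ?_⟩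
  · rw [nrk_closure]; omega
  · rw [nrk_closure]; omega
  · have h1 : nrk M F ≤ nrk M (M.closure (insert e F) ∩ M.closure (insert f F)) :=
      nrk_mono M (Set.subset_inter (sub e he.1) (sub f hf.1))
    have h2 := nrk_submod M (M.closure (insert e F)) (M.closure (insert f F))
    rw [hun, nrk_closure, nrk_closure] at h2
    omega

/-- Two non-spanning sets that cover the ground set and meet in rank at least `r(M) - 2` show that
a matroid is breakable: contract the intersection of their closures. -/
lemma not_unbreakable_of_cover [M.Finite] {H₁ H₂ : Set β} (hun : H₁ ∪ H₂ = M.E)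
    (h1 : nrk M H₁ < nrk M M.E) (h2 : nrk M H₂ < nrk M M.E)
    (h3 : nrk M M.E ≤ nrk M (H₁ ∩ H₂) + 2) : ¬ Unbreakable M := by
  rintro ⟨-, hU⟩
  have s1 : H₁ ⊆ M.E := hun ▸ Set.subset_union_left
  have s2 : H₂ ⊆ M.E := hun ▸ Set.subset_union_right
  set K₁ := M.closure H₁ with hK₁
  set K₂ := M.closure H₂ with hK₂
  have hk1 : nrk M K₁ = nrk M H₁ := nrk_closure _ _
  have hk2 : nrk M K₂ = nrk M H₂ := nrk_closure _ _
  have hfl : M.IsFlat (K₁ ∩ K₂) := isFlat_inter (M.isFlat_closure _) (M.isFlat_closure _)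
  have hFr : nrk M (H₁ ∩ H₂) ≤ nrk M (K₁ ∩ K₂) :=
    nrk_mono M (Set.inter_subset_inter (M.subset_closure _ s1) (M.subset_closure _ s2))
  have hE : M.E ⊆ K₁ ∪ K₂ := by
    rw [← hun]; exact Set.union_subset_union (M.subset_closure _ s1) (M.subset_closure _ s2)
  have ex : ∀ K : Set β, nrk M K < nrk M M.E → ∃ e ∈ M.E, e ∉ K := by
    intro K hK
    by_contra! hc
    exact absurd (nrk_mono M (show M.E ⊆ K from hc)) (by omega)
  obtain ⟨e, heE, heK⟩ := ex K₁ (by omega)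
  obtain ⟨f, hfE, hfK⟩ := ex K₂ (by omega)
  have heK2 : e ∈ K₂ := (hE heE).resolve_left heK
  have hfK1 : f ∈ K₁ := (hE hfE).resolve_right hfK
  have hef : e ≠ f := fun h => heK (h ▸ hfK1)
  obtain ⟨C, hC, heC, hfC⟩ := hU _ hfl e ⟨heE, fun h => heK h.1⟩ f ⟨hfE, fun h => hfK h.2⟩ hef
  obtain ⟨B, hB⟩ := M.exists_isBasis (K₁ ∩ K₂) hfl.subset_ground
  have small : ∀ K : Set β, K₁ ∩ K₂ ⊆ K → nrk M K < nrk M M.E → (∃ x ∈ C, x ∉ K) →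
      (C ∩ K).ncard ≤ 1 := by
    intro K hFK hK ⟨x, hxC, hxK⟩
    have hi : (M ／ (K₁ ∩ K₂)).Indep (C ∩ K) :=
      hC.ssubset_indep ⟨Set.inter_subset_left, fun h => hxK (h hxC).2⟩
    rw [hB.contract_indep_iff] at hi
    have hle := ncard_le_nrk_of_indep hi.1
      (Set.union_subset Set.inter_subset_right (hB.subset.trans hFK) : _ ⊆ K)
    rw [Set.ncard_union_eq (hi.2.symm.mono_right hB.subset)
      (hi.1.finite.subset Set.subset_union_left) hB.indep.finite] at hle
    have hBr : B.ncard = nrk M (K₁ ∩ K₂) := by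
      rw [← nrk_eq_ncard_of_indep hB.indep, nrk, nrk, hB.eRk_eq_eRk]
    omega
  have hCfin : C.Finite := M.ground_finite.subset (hC.subset_ground.trans Set.sdiff_subset)
  have c1 := small K₁ Set.inter_subset_left (by omega) ⟨e, heC, heK⟩
  have c2 := small K₂ Set.inter_subset_right (by omega) ⟨f, hfC, hfK⟩
  rw [Set.ncard_le_one (hCfin.subset Set.inter_subset_left)] at c1 c2
  have hCeq : C ⊆ insert e {f} := by
    intro x hx
    rcases hE (hC.subset_ground hx).1 with h | h
    · exact .inr (c1 x ⟨hx, h⟩ f ⟨hfC, hfK1⟩)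
    · exact .inl (c2 x ⟨hx, h⟩ e ⟨heC, heK2⟩)
  have hmem := hC.mem_closure_sdiff_singleton_of_mem heC
  have hsub : C \ {e} ⊆ {f} := fun x hx => (hCeq hx.1).resolve_left hx.2
  have hmem2 := (M ／ (K₁ ∩ K₂)).closure_subset_closure hsub hmem
  rw [Matroid.contract_closure_eq] at hmem2
  apply heK
  have : M.closure ({f} ∪ K₁ ∩ K₂) ⊆ M.closure K₁ :=
    M.closure_subset_closure (Set.union_subset (by simpa using hfK1) Set.inter_subset_left)
  rw [hK₁, Matroid.closure_closure] at this
  exact this hmem2.1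

end Unbreakable

/-! ### Paths, cycles and reachability -/

section Paths

variable {α β : Type*} {G : Graph α β}

/-- A path from `x` to `y` with vertex set `U` and edge set `P`, built one edge at a time.
This is an inductive form of `IsPath`. -/
inductive PathIn (G : Graph α β) : α → α → Set α → Set β → Prop
  | nil (x : α) : PathIn G x x {x} ∅
  | cons {e : β} {x y z : α} {U : Set α} {P : Set β} (h : G.IsLink e x y) (hp : PathIn G y z U P)
      (hx : x ∉ U) : PathIn G x z (insert x U) (insert e P)

namespace PathIn

variable {x y z w a b : α} {U U' Z : Set α} {P P' : Set β} {e : β}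

lemma left_mem (h : PathIn G x y U P) : x ∈ U := by cases h <;> simp

lemma right_mem (h : PathIn G x y U P) : y ∈ U := by
  induction h with
  | nil => simp
  | cons _ _ _ ih => exact .inr ih

lemma ends_mem (h : PathIn G x y U P) (he : e ∈ P) (hl : G.IsLink e a b) : a ∈ U ∧ b ∈ U := by
  induction h with
  | nil => simp at he
  | cons hl' hp hx ih =>
    rcases he with rfl | he
    · rcases hl.eq_and_eq_or_eq_and_eq hl' with ⟨rfl, rfl⟩ | ⟨rfl, rfl⟩
      · exact ⟨.inl rfl, .inr hp.left_mem⟩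
      · exact ⟨.inr hp.left_mem, .inl rfl⟩
    · exact ⟨.inr (ih he).1, .inr (ih he).2⟩

lemma ne_of_isLink (h : PathIn G x y U P) (he : e ∈ P) (hl : G.IsLink e a b) : a ≠ b := by
  induction h with
  | nil => simp at he
  | cons hl' hp hx ih =>
    rcases he with rfl | he
    · have := hp.left_mem
      rcases hl.eq_and_eq_or_eq_and_eq hl' with ⟨rfl, rfl⟩ | ⟨rfl, rfl⟩
      · rintro rfl; exact hx this
      · rintro rfl; exact hx this
    · exact ih he

lemma subset_edgeSet (h : PathIn G x y U P) : P ⊆ E(G) := by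
  induction h with
  | nil => simp
  | cons hl' hp hx ih => exact Set.insert_subset hl'.edge_mem ih

lemma subset_vertexSet (h : PathIn G x y U P) (hx : x ∈ V(G)) : U ⊆ V(G) := by
  induction h with
  | nil => simpa using hx
  | cons hl' hp _ ih => exact Set.insert_subset hx (ih hl'.right_mem)

lemma finite (h : PathIn G x y U P) : U.Finite := by
  induction h with
  | nil => simp
  | cons hl' hp hx ih => exact ih.insert _

lemma ncard (h : PathIn G x y U P) : P.Finite ∧ U.ncard = P.ncard + 1 := by
  induction h with
  | nil => simp
  | @cons e x y z U P hl' hp hx ih =>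
    refine ⟨ih.1.insert _, ?_⟩
    rw [Set.ncard_insert_of_notMem hx hp.finite, Set.ncard_insert_of_notMem (fun he => ?_) ih.1, ih.2]
    exact hx (hp.ends_mem he hl').1

/-- Each vertex of a path with distinct ends is an end of one of its edges. -/
lemma inc_of_ne (h : PathIn G x y U P) (hxy : x ≠ y) : ∀ w ∈ U, ∃ e ∈ P, G.Inc e w := by
  induction h with
  | nil => exact absurd rfl hxy
  | @cons e x y z U P hl' hp hx ih =>
    rintro w (rfl | hw)
    · exact ⟨e, .inl rfl, hl'.inc_left⟩
    · by_cases hyz : y = z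
      · subst hyz
        cases hp with
        | nil => exact ⟨e, .inl rfl, by rw [Set.mem_singleton_iff.1 hw]; exact hl'.inc_right⟩
        | cons _ hp' hx' => exact absurd hp'.right_mem hx'
      · obtain ⟨f, hf, hfw⟩ := ih hyz w hw
        exact ⟨f, .inr hf, hfw⟩

lemma append (h : PathIn G x y U P) (h' : PathIn G y z U' P') (hU : U ∩ U' ⊆ {y}) :
    PathIn G x z (U ∪ U') (P ∪ P') := by
  induction h with
  | nil x =>
    rw [Set.empty_union, Set.singleton_union, Set.insert_eq_of_mem h'.left_mem]; exact h'
  | @cons e x y z U P hl' hp hx ih =>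
    rw [Set.insert_union, Set.insert_union]
    refine .cons hl' (ih h' fun v hv => hU ⟨.inr hv.1, hv.2⟩) ?_
    rintro (h | h)
    · exact hx h
    · have : x = z := hU ⟨.inl rfl, h⟩
      exact hx (this ▸ hp.right_mem)

lemma reverse (h : PathIn G x y U P) : PathIn G y x U P := by
  induction h with
  | nil x => exact .nil x
  | @cons e x y z U P hl' hp hx ih =>
    have h1 : PathIn G y x (insert y {x}) (insert e ∅) := by
      refine .cons hl'.symm (.nil x) ?_
      rintro h
      exact hx (Set.mem_singleton_iff.1 h ▸ hp.left_mem)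
    have := ih.append h1 (by
      rintro v ⟨hv, rfl | rfl⟩
      · rfl
      · exact absurd hv hx)
    convert! this using 1
    · ext v
      simp only [Set.mem_insert_iff, Set.mem_union, Set.mem_singleton_iff]
      constructor
      · rintro (h | h) <;> simp [h]
      · rintro (h | rfl | h)
        · exact .inr h
        · exact .inr hp.left_mem
        · exact .inl h
    · ext v
      simp

lemma disjoint_of_inter_subset (h : PathIn G x y U P) (h' : PathIn G z w U' P')
    (hU : U ∩ U' ⊆ {a}) : Disjoint P P' := by
  rw [Set.disjoint_left]
  intro e he he'
  obtain ⟨b, c, hl⟩ := Graph.exists_isLink_of_mem_edgeSet (h.subset_edgeSet he)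
  have h1 := h.ends_mem he hl
  have h2 := h'.ends_mem he' hl
  exact h.ne_of_isLink he hl ((hU ⟨h1.1, h2.1⟩).trans (hU ⟨h1.2, h2.2⟩).symm)

/-- A path, cut at one of its vertices. -/
lemma split (h : PathIn G x y U P) (hw : w ∈ U) :
    ∃ U₁ P₁ U₂ P₂, PathIn G x w U₁ P₁ ∧ PathIn G w y U₂ P₂ ∧ U₁ ∪ U₂ = U ∧ U₁ ∩ U₂ = {w} ∧
      P₁ ∪ P₂ = P := by
  induction h with
  | nil x =>
    obtain rfl := Set.mem_singleton_iff.1 hw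
    exact ⟨{w}, ∅, {w}, ∅, .nil w, .nil w, by simp, by simp, by simp⟩
  | @cons e x y z U P hl' hp hx ih =>
    by_cases hwx : w = x
    · subst hwx
      exact ⟨{w}, ∅, insert w U, insert e P, .nil w, .cons hl' hp hx, by simp, by simp, by simp⟩
    · obtain ⟨U₁, P₁, U₂, P₂, h1, h2, hU, hi, hP⟩ := ih (hw.resolve_left hwx)
      refine ⟨insert x U₁, insert e P₁, U₂, P₂, .cons hl' h1 fun h => hx (hU ▸ .inl h), h2, ?_, ?_, ?_⟩
      · rw [Set.insert_union, hU]
      · rw [Set.insert_inter_of_notMem (fun h => hx (hU ▸ .inr h)), hi]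
      · rw [Set.insert_union, hP]

/-- A path that ends in `Z`, cut at its first vertex in `Z`. -/
lemma split_first (h : PathIn G x y U P) (hy : y ∈ Z) :
    ∃ w U₁ P₁ U₂ P₂, PathIn G x w U₁ P₁ ∧ PathIn G w y U₂ P₂ ∧ U₁ ∪ U₂ = U ∧ U₁ ∩ U₂ = {w} ∧
      P₁ ∪ P₂ = P ∧ U₁ ∩ Z = {w} := by
  induction h with
  | nil x => exact ⟨x, {x}, ∅, {x}, ∅, .nil x, .nil x, by simp, by simp, by simp, by simpa using hy⟩
  | @cons e x y z U P hl' hp hx ih =>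
    by_cases hwx : x ∈ Z
    · exact ⟨x, {x}, ∅, insert x U, insert e P, .nil x, .cons hl' hp hx, by simp, by simp, by simp,
        by simpa using hwx⟩
    · obtain ⟨w, U₁, P₁, U₂, P₂, h1, h2, hU, hi, hP, hZ⟩ := ih hy
      refine ⟨w, insert x U₁, insert e P₁, U₂, P₂, .cons hl' h1 fun h => hx (hU ▸ .inl h),
        h2, ?_, ?_, ?_, ?_⟩
      · rw [Set.insert_union, hU]
      · rw [Set.insert_inter_of_notMem (fun h => hx (hU ▸ .inr h)), hi]
      · rw [Set.insert_union, hP]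
      · rw [Set.insert_inter_of_notMem hwx, hZ]

lemma not_both_mem (h : PathIn G x w U P) (hZ : U ∩ Z ⊆ {w}) (he : e ∈ P) (hl : G.IsLink e a b) :
    ¬ (a ∈ Z ∧ b ∈ Z) := by
  rintro ⟨ha, hb⟩
  have := h.ends_mem he hl
  exact h.ne_of_isLink he hl ((hZ ⟨this.1, ha⟩).trans (hZ ⟨this.2, hb⟩).symm)

lemma isPath (h : PathIn G x y U P) : IsPath G x y U P := by
  induction h with
  | nil x => exact ⟨0, fun _ => x, Fin.elim0, fun i j _ => Fin.ext (by omega), fun i => i.elim0,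
      rfl, rfl, by simp, by simp⟩
  | @cons e x y z U P hl' hp hx ih =>
    obtain ⟨n, v, f, hv, hf, h0, hn, hU, hP⟩ := ih
    refine ⟨n + 1, Fin.cons x v, Fin.cons e f, ?_, ?_, rfl, ?_, ?_, ?_⟩
    · rw [Fin.cons_injective_iff]
      exact ⟨by rw [hU]; exact hx, hv⟩
    · intro i
      cases i using Fin.cases with
      | zero => simpa [h0] using hl'
      | succ i =>
        rw [Fin.castSucc_succ]
        simpa using hf i
    · rw [← Fin.succ_last, Fin.cons_succ, hn]
    · rw [Fin.range_cons, hU]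
    · rw [Fin.range_cons, hP]

end PathIn

lemma pathIn_of_fin : ∀ (n : ℕ) (v : Fin (n + 1) → α) (e : Fin n → β), Function.Injective v →
    (∀ i : Fin n, G.IsLink (e i) (v i.castSucc) (v i.succ)) →
    PathIn G (v 0) (v (Fin.last n)) (Set.range v) (Set.range e) := by
  intro n
  induction n with
  | zero =>
    intro v e _ _
    have h1 : Set.range v = {v 0} := Set.range_unique (ι := Fin 1)
    have h2 : Set.range e = ∅ := Set.range_eq_empty _
    rw [h1, h2]
    exact .nil _
  | succ n ih =>
    intro v e hv he
    have h1 : Set.range v = insert (v 0) (Set.range (Fin.tail v)) := by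
      conv_lhs => rw [← Fin.cons_self_tail v]
      rw [Fin.range_cons]
    have h2 : Set.range e = insert (e 0) (Set.range (Fin.tail e)) := by
      conv_lhs => rw [← Fin.cons_self_tail e]
      rw [Fin.range_cons]
    rw [h1, h2]
    refine .cons (he 0) (ih (Fin.tail v) (Fin.tail e) (hv.comp (Fin.succ_injective _)) ?_) ?_
    · intro i
      exact he i.succ
    · rintro ⟨i, hi⟩
      exact (Fin.succ_ne_zero i) (hv hi)

lemma isPath_iff {x y : α} {U : Set α} {P : Set β} : IsPath G x y U P ↔ PathIn G x y U P := by
  refine ⟨?_, PathIn.isPath⟩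
  rintro ⟨n, v, e, hv, he, rfl, rfl, rfl, rfl⟩
  exact pathIn_of_fin n v e hv he

end Paths

section Cycles

variable {α β : Type*} {G : Graph α β} {C D : Set β} {e f : β} {x y a b : α}

lemma ends_subset_vertexSet (X : Set β) : ends G X ⊆ V(G) := fun _ ⟨_, _, hx⟩ => hx.vertex_mem

/-- A cycle is given by an edge `e` from `a` to `x` and a path from `x` to `a`. -/
structure CycleRep (G : Graph α β) (C : Set β) (e : β) (a x : α) (U : Set α) (P : Set β) :
    Prop where
  link : G.IsLink e a x
  path : PathIn G x a U P
  notMem : e ∉ P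
  eq : C = insert e P
  ends_eq : ends G C = U

lemma cycleRep_of_path {U : Set α} {P : Set β} (hl : G.IsLink e a x) (hp : PathIn G x a U P)
    (he : e ∉ P) : CycleRep G (insert e P) e a x U P := by
  refine ⟨hl, hp, he, rfl, Set.Subset.antisymm ?_ ?_⟩
  · rintro w ⟨f, rfl | hf, z, hz⟩
    · rcases hz.left_eq_or_eq hl with rfl | rfl
      exacts [hp.right_mem, hp.left_mem]
    · exact (hp.ends_mem hf hz).1
  · intro w hw
    by_cases hxa : x = a
    · subst hxa
      cases hp with
      | nil => exact ⟨e, .inl rfl, by rw [Set.mem_singleton_iff.1 hw]; exact hl.inc_left⟩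
      | cons _ hp' hx' => exact absurd hp'.right_mem hx'
    · obtain ⟨f, hf, hfw⟩ := hp.inc_of_ne hxa w hw
      exact ⟨f, .inr hf, hfw⟩

lemma CycleRep.isCycle {U : Set α} {P : Set β} (h : CycleRep G C e a x U P) : IsCycle G C := by
  obtain ⟨hl, hp, he, rfl, -⟩ := h
  obtain ⟨n, v, f, hv, hf, rfl, rfl, rfl, rfl⟩ := hp.isPath
  refine ⟨n, v, Fin.snoc f e, hv, ?_, ?_, ?_⟩
  · rw [Fin.snoc_injective_iff]
    refine ⟨?_, he⟩
    intro i j hij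
    have h1 := hf i
    rw [hij] at h1
    rcases h1.eq_and_eq_or_eq_and_eq (hf j) with ⟨h2, -⟩ | ⟨h2, h3⟩
    · exact Fin.castSucc_injective _ (hv h2)
    · have h4 := congrArg Fin.val (hv h2)
      have h5 := congrArg Fin.val (hv h3)
      simp at h4 h5
      omega
  · intro i
    cases i using Fin.lastCases with
    | last => simpa using hl
    | cast i => simpa using hf i
  · rw [Fin.range_snoc]

lemma IsCycle.exists_rep_of_fin {n : ℕ} {v : Fin (n + 1) → α} {e : Fin (n + 1) → β}
    (hv : Function.Injective v) (he : Function.Injective e)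
    (hl : ∀ i, G.IsLink (e i) (v i) (v (i + 1))) (j : Fin (n + 1)) :
    ∃ U P, CycleRep G (Set.range e) (e (Fin.last n + j)) (v (Fin.last n + j)) (v j) U P := by
  have hp := pathIn_of_fin (G := G) n (fun i => v (i + j)) (fun i => e (i.castSucc + j))
    (fun a b h => add_right_cancel (hv h)) (fun i => by
      have := hl (i.castSucc + j)
      rwa [add_right_comm, Fin.coeSucc_eq_succ] at this)
  simp only [zero_add] at hp
  have hl' : G.IsLink (e (Fin.last n + j)) (v (Fin.last n + j)) (v j) := by
    have := hl (Fin.last n + j)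
    rwa [add_right_comm, Fin.last_add_one, zero_add] at this
  have hnot : e (Fin.last n + j) ∉ Set.range (fun i : Fin n => e (i.castSucc + j)) := by
    rintro ⟨i, hi⟩
    exact (Fin.castSucc_lt_last i).ne (add_right_cancel (he hi))
  have heq : Set.range e =
      insert (e (Fin.last n + j)) (Set.range fun i : Fin n => e (i.castSucc + j)) := by
    ext f
    simp only [Set.mem_range, Set.mem_insert_iff]
    constructor
    · rintro ⟨i, rfl⟩
      obtain ⟨k, rfl⟩ : ∃ k, i = k + j := ⟨i - j, by simp⟩
      cases k using Fin.lastCases with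
      | last => exact .inl rfl
      | cast k => exact .inr ⟨k, rfl⟩
    · rintro (rfl | ⟨i, rfl⟩)
      exacts [⟨_, rfl⟩, ⟨_, rfl⟩]
  rw [heq]
  exact ⟨_, _, cycleRep_of_path hl' hp hnot⟩

lemma IsCycle.exists_rep_edge (hC : IsCycle G C) (hf : f ∈ C) :
    ∃ a x U P, CycleRep G C f a x U P := by
  obtain ⟨n, v, e, hv, he, hl, rfl⟩ := hC
  obtain ⟨i, rfl⟩ := hf
  obtain ⟨U, P, h⟩ := IsCycle.exists_rep_of_fin hv he hl (i + 1)
  have : Fin.last n + (i + 1) = i := by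
    rw [add_comm i 1, ← add_assoc, Fin.last_add_one, zero_add]
  rw [this] at h
  exact ⟨_, _, _, _, h⟩

lemma IsCycle.exists_rep_vertex (hC : IsCycle G C) (hx : x ∈ ends G C) :
    ∃ e a U P, CycleRep G C e a x U P := by
  obtain ⟨n, v, e, hv, he, hl, rfl⟩ := hC
  obtain ⟨_, ⟨i, rfl⟩, y, hy⟩ := hx
  rcases hy.left_eq_or_eq (hl i) with rfl | rfl
  · obtain ⟨U, P, h⟩ := IsCycle.exists_rep_of_fin hv he hl i
    exact ⟨_, _, _, _, h⟩
  · obtain ⟨U, P, h⟩ := IsCycle.exists_rep_of_fin hv he hl (i + 1)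
    exact ⟨_, _, _, _, h⟩

lemma IsCycle.nonempty (hC : IsCycle G C) : C.Nonempty := by
  obtain ⟨n, v, e, hv, he, hl, rfl⟩ := hC
  exact ⟨e 0, 0, rfl⟩

lemma IsCycle.subset_edgeSet (hC : IsCycle G C) : C ⊆ E(G) := by
  obtain ⟨n, v, e, hv, he, hl, rfl⟩ := hC
  rintro _ ⟨i, rfl⟩
  exact (hl i).edge_mem

lemma IsCycle.ends_nonempty (hC : IsCycle G C) : (ends G C).Nonempty := by
  obtain ⟨n, v, e, hv, he, hl, rfl⟩ := hC
  exact ⟨v 0, e 0, ⟨0, rfl⟩, (hl 0).inc_left⟩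

lemma IsCycle.finite (hC : IsCycle G C) : C.Finite := by
  obtain ⟨n, v, e, hv, he, hl, rfl⟩ := hC
  exact Set.finite_range e

lemma IsCycle.ncard_ends (hC : IsCycle G C) : (ends G C).ncard = C.ncard := by
  obtain ⟨e, he⟩ := hC.nonempty
  obtain ⟨a, x, U, P, h⟩ := hC.exists_rep_edge he
  rw [h.ends_eq, h.path.ncard.2, h.eq, Set.ncard_insert_of_notMem h.notMem h.path.ncard.1]

/-- In a cycle no vertex meets just one edge of the cycle, unless that edge is a loop. -/
lemma IsCycle.exists_other (hC : IsCycle G C) (he : e ∈ C) (hl : G.IsLink e x y) (hxy : x ≠ y) :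
    ∃ f ∈ C, f ≠ e ∧ G.Inc f x := by
  obtain ⟨a, b, U, P, h⟩ := hC.exists_rep_edge he
  have hne : b ≠ a := by
    rintro rfl
    rcases hl.eq_and_eq_or_eq_and_eq h.link with ⟨rfl, rfl⟩ | ⟨rfl, rfl⟩ <;> exact hxy rfl
  have hxU : x ∈ U := by
    rw [← h.ends_eq]; exact ⟨e, he, hl.inc_left⟩
  obtain ⟨f, hf, hfx⟩ := h.path.inc_of_ne hne x hxU
  exact ⟨f, h.eq ▸ .inr hf, fun h' => h.notMem (h' ▸ hf), hfx⟩

/-- At most two edges of a cycle meet a given vertex. -/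
lemma IsCycle.not_three (hC : IsCycle G C) {e₁ e₂ e₃ : β} (h1 : e₁ ∈ C) (h2 : e₂ ∈ C)
    (h3 : e₃ ∈ C) (i1 : G.Inc e₁ x) (i2 : G.Inc e₂ x) (i3 : G.Inc e₃ x) (h12 : e₁ ≠ e₂)
    (h13 : e₁ ≠ e₃) (h23 : e₂ ≠ e₃) : False := by
  obtain ⟨n, v, e, hv, he, hl, rfl⟩ := hC
  obtain ⟨i, rfl⟩ := h1
  obtain ⟨j, rfl⟩ := h2
  obtain ⟨k, rfl⟩ := h3
  have key : ∀ i, G.Inc (e i) x → x = v i ∨ x = v (i + 1) :=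
    fun i h => h.eq_or_eq_of_isLink (hl i)
  have c1 : ∀ i j, x = v i → x = v j → i = j := fun i j h h' => hv (h.symm.trans h')
  have c2 : ∀ i j, x = v (i + 1) → x = v (j + 1) → i = j :=
    fun i j h h' => add_right_cancel (hv (h.symm.trans h'))
  rcases key i i1 with h | h <;> rcases key j i2 with h' | h' <;>
    rcases key k i3 with h'' | h''
  all_goals first
    | exact h12 (congrArg e (c1 _ _ h h'))
    | exact h13 (congrArg e (c1 _ _ h h''))
    | exact h23 (congrArg e (c1 _ _ h' h''))
    | exact h12 (congrArg e (c2 _ _ h h'))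
    | exact h13 (congrArg e (c2 _ _ h h''))
    | exact h23 (congrArg e (c2 _ _ h' h''))

/-- If a cycle `D` uses an edge of the cycle `C` and otherwise only edges that avoid the vertices
of `C`, then it contains `C`: it cannot leave `C` at any vertex. -/
lemma IsCycle.subset_of_inter (hC : IsCycle G C) (hD : IsCycle G D)
    (hDC : ∀ f ∈ D, f ∉ C → ∀ x ∈ ends G C, ¬ G.Inc f x) (hne : (D ∩ C).Nonempty) : C ⊆ D := by
  obtain ⟨n, v, e, hv, he, hl, rfl⟩ := id hC
  obtain ⟨_, hfD, ⟨i, rfl⟩⟩ := hne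
  have step : ∀ i, e i ∈ D → e (i + 1) ∈ D := by
    intro i hi
    by_cases hvi : v (i + 1) = v i
    · have : i + 1 = i := hv hvi
      rwa [this]
    · obtain ⟨f, hf, hfe, hfx⟩ := hD.exists_other hi (hl i).symm hvi
      have hfC : f ∈ Set.range e := by
        by_contra h
        exact hDC f hf h (v (i + 1)) ⟨e i, ⟨i, rfl⟩, (hl i).inc_right⟩ hfx
      have : e (i + 1) = f ∨ e (i + 1) = e i := by
        by_contra! hcon
        exact hC.not_three ⟨i + 1, rfl⟩ hfC ⟨i, rfl⟩ (hl (i + 1)).inc_left hfx (hl i).inc_right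
          hcon.1 hcon.2 hfe
      rcases this with h | h <;> rw [h] <;> assumption
  have all : ∀ k : ℕ, e (i + Fin.ofNat (n + 1) k) ∈ D := by
    intro k
    induction k with
    | zero => simpa using hfD
    | succ k ih =>
      have := step _ ih
      have h1 : Fin.ofNat (n + 1) k + 1 = Fin.ofNat (n + 1) (k + 1) := by
        ext; simp [Fin.val_add]
      rwa [add_assoc, h1] at this
  rintro _ ⟨j, rfl⟩
  have := all (j - i : Fin (n + 1)).val
  have h1 : Fin.ofNat (n + 1) (j - i : Fin (n + 1)).val = j - i := by
    ext; simp
  rwa [h1, add_sub_cancel] at this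

lemma IsCycle.eq_of_subset (hC : IsCycle G C) (hD : IsCycle G D) (h : D ⊆ C) : D = C :=
  h.antisymm (hC.subset_of_inter hD (fun _ hf hf' => absurd (h hf) hf')
    (by rw [Set.inter_eq_self_of_subset_left h]; exact hD.nonempty))

end Cycles

section Reach

variable {α β : Type*} {G H : Graph α β} {S T : Set β} {x y z a b : α}

/-- `y` can be reached from `x` along edges of `G` that belong to `S`. -/
def Reach (G : Graph α β) (S : Set β) : α → α → Prop :=
  Relation.ReflTransGen fun a b => ∃ e ∈ S, G.IsLink e a b

namespace Reach

lemma refl (x : α) : Reach G S x x := Relation.ReflTransGen.refl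

lemma trans (h : Reach G S x y) (h' : Reach G S y z) : Reach G S x z :=
  Relation.ReflTransGen.trans h h'

lemma of_link {e : β} (he : e ∈ S) (h : G.IsLink e x y) : Reach G S x y :=
  Relation.ReflTransGen.single ⟨e, he, h⟩

lemma symm (h : Reach G S x y) : Reach G S y x := by
  induction h with
  | refl => exact refl _
  | tail _ h ih =>
    obtain ⟨e, he, hl⟩ := h
    exact (of_link he hl.symm).trans ih

lemma mono (hST : S ⊆ T) (h : Reach G S x y) : Reach G T x y :=
  Relation.ReflTransGen.mono (fun _ _ ⟨e, he, hl⟩ => ⟨e, hST he, hl⟩) _ _ h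

lemma mem_vertexSet (h : Reach G S x y) (hx : x ∈ V(G)) : y ∈ V(G) := by
  induction h with
  | refl => exact hx
  | tail _ h ih => exact h.choose_spec.2.right_mem

lemma exists_path (h : Reach G S x y) : ∃ U P, PathIn G x y U P ∧ P ⊆ S := by
  induction h using Relation.ReflTransGen.head_induction_on with
  | refl => exact ⟨_, _, .nil y, by simp⟩
  | @head a c h _ ih =>
    obtain ⟨e, he, hl⟩ := h
    obtain ⟨U, P, hp, hPS⟩ := ih
    by_cases ha : a ∈ U
    · obtain ⟨U₁, P₁, U₂, P₂, -, h2, -, -, hP⟩ := hp.split ha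
      exact ⟨U₂, P₂, h2, (hP ▸ Set.subset_union_right).trans hPS⟩
    · exact ⟨_, _, .cons hl hp ha, Set.insert_subset he hPS⟩

/-- A set of vertices closed under the edges in `S` contains everything reachable from it. -/
lemma mem_of_closed {W : Set α} (h : Reach G S x y) (hx : x ∈ W)
    (hW : ∀ e ∈ S, ∀ a b, G.IsLink e a b → a ∈ W → b ∈ W) : y ∈ W := by
  induction h with
  | refl => exact hx
  | tail _ h ih =>
    obtain ⟨e, he, hl⟩ := h
    exact hW e he _ _ hl ih

end Reach

lemma PathIn.reach {U : Set α} {P : Set β} (h : PathIn G x y U P) : ∀ w ∈ U, Reach G P x w := by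
  induction h with
  | nil x => rintro w rfl; exact .refl _
  | cons hl hp hx ih =>
    rintro w (rfl | hw)
    · exact .refl _
    · exact (Reach.of_link (.inl rfl) hl).trans ((ih w hw).mono (Set.subset_insert _ _))

lemma IsCycle.reach {C : Set β} (hC : IsCycle G C) (hx : x ∈ ends G C) (hy : y ∈ ends G C) :
    Reach G C x y := by
  obtain ⟨e, a, U, P, h⟩ := hC.exists_rep_vertex hx
  exact (h.path.reach y (h.ends_eq ▸ hy)).mono (h.eq ▸ Set.subset_insert _ _)

lemma isConnected_iff :
    IsConnected G ↔ V(G).Nonempty ∧ ∀ x ∈ V(G), ∀ y ∈ V(G), Reach G E(G) x y := by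
  have key : ∀ u w : V(G), G.toSimpleGraph.Reachable u w ↔ Reach G E(G) u w := by
    intro u w
    constructor
    · rw [SimpleGraph.reachable_iff_reflTransGen]
      intro h
      induction h with
      | refl => exact .refl _
      | tail _ h ih =>
        obtain ⟨-, e, he⟩ := h
        exact ih.trans (.of_link he.edge_mem he)
    · obtain ⟨w, hw⟩ := w
      intro h
      have : ∀ z, Reach G E(G) u z → ∀ hz : z ∈ V(G), G.toSimpleGraph.Reachable u ⟨z, hz⟩ := by
        intro z h
        induction h with
        | refl => intro hz; exact .refl _
        | @tail b c _ h ih =>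
          intro hz
          obtain ⟨e, -, hl⟩ := h
          refine (ih hl.left_mem).trans ?_
          by_cases hbc : b = c
          · subst hbc; exact .refl _
          · exact SimpleGraph.Adj.reachable ⟨fun h => hbc (congrArg Subtype.val h), e, hl⟩
      exact this w h hw
  constructor
  · intro h
    have := h.nonempty
    exact ⟨Set.nonempty_coe_sort.1 this, fun x hx y hy => (key ⟨x, hx⟩ ⟨y, hy⟩).1 (h.preconnected _ _)⟩
  · rintro ⟨hne, h⟩
    have := Set.nonempty_coe_sort.2 hne
    exact SimpleGraph.Connected.mk fun u w => (key u w).2 (h u u.2 w w.2)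

lemma mem_edgeSet_induce {W : Set α} {e : β} (hl : G.IsLink e x y) :
    e ∈ E(G.induce W) ↔ x ∈ W ∧ y ∈ W := by
  rw [Graph.edgeSet_induce]
  constructor
  · rintro ⟨a, b, h, ha, hb⟩
    rcases hl.eq_and_eq_or_eq_and_eq h with ⟨rfl, rfl⟩ | ⟨rfl, rfl⟩
    exacts [⟨ha, hb⟩, ⟨hb, ha⟩]
  · rintro ⟨h, h'⟩
    exact ⟨_, _, hl, h, h'⟩

lemma edgeSet_induce_subset {W : Set α} : E(G.induce W) ⊆ E(G) := by
  rintro e ⟨a, b, h, -⟩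
  exact h.edge_mem

lemma isConnected_induce_deleteEdges_iff {W : Set α} {X : Set β} :
    IsConnected ((G.induce W).deleteEdges X) ↔
      W.Nonempty ∧ ∀ x ∈ W, ∀ y ∈ W, Reach G (E(G.induce W) \ X) x y := by
  rw [isConnected_iff]
  have : ∀ x y, Reach ((G.induce W).deleteEdges X) E((G.induce W).deleteEdges X) x y ↔
      Reach G (E(G.induce W) \ X) x y := by
    intro x y
    unfold Reach
    have hrel : (fun a b => ∃ e ∈ E((G.induce W).deleteEdges X),
        ((G.induce W).deleteEdges X).IsLink e a b) =
        (fun a b => ∃ e ∈ E(G.induce W) \ X, G.IsLink e a b) := by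
      funext a b
      refine propext ⟨?_, ?_⟩
      · rintro ⟨e, he, hl⟩
        exact ⟨e, he, hl.1.1⟩
      · rintro ⟨e, he, hl⟩
        exact ⟨e, he, ⟨hl, (mem_edgeSet_induce hl).1 he.1⟩, he.2⟩
    rw [hrel]
  simp only [this]
  rfl

lemma isConnected_induce_iff {W : Set α} :
    IsConnected (G.induce W) ↔
      W.Nonempty ∧ ∀ x ∈ W, ∀ y ∈ W, Reach G E(G.induce W) x y := by
  have := isConnected_induce_deleteEdges_iff (G := G) (W := W) (X := ∅)
  rwa [Graph.deleteEdges_empty, Set.sdiff_empty] at this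

end Reach

/-! ### Lower bounds for ranks, and the rank formula -/

section PreFramework

variable {α β : Type*} {G : Graph α β} {M : Matroid β} {S T Q R : Set β} {W Z : Set α}
  {x y : α} {e f : β}

/-- The part of the definition of a framework that bounds ranks from below: no edge from `v` to
another vertex is spanned by the edges that avoid `v`. -/
structure IsPreFramework (M : Matroid β) (G : Graph α β) : Prop where
  ground_eq : M.E = E(G)
  notMem_closure : ∀ v ∈ V(G), ∀ w, w ≠ v → ∀ e, G.IsLink e v w →
    e ∉ M.closure E(G.deleteVerts {v})

lemma IsFramework.isPreFramework (h : IsFramework M G) : IsPreFramework M G :=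
  ⟨h.ground_eq, h.notMem_closure⟩

lemma exists_link_of_reach (h : Reach G S x y) (hx : x ∈ W) (hy : y ∉ W) :
    ∃ e ∈ S, ∃ a b, G.IsLink e a b ∧ a ∈ W ∧ b ∉ W := by
  by_contra! hcon
  exact hy (h.mem_of_closed hx fun e he a b hl ha => hcon e he a b hl ha)

/-- If every vertex can be reached from `W` along `S`, then a forest `T ⊆ S` grown from `W` has
`|V(G) ∖ W|` edges, reaches every vertex, and raises the rank of any set of edges inside `W` by
its size, since each new edge has an end that no previous edge meets. -/
lemma IsPreFramework.exists_growth [M.RankFinite] (hM : IsPreFramework M G) (hV : V(G).Finite)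
    (hS : S ⊆ E(G)) (hW : W ⊆ V(G)) (hcov : ∀ x ∈ V(G), ∃ w ∈ W, Reach G S w x) :
    ∃ T ⊆ S, T.Finite ∧ T.ncard + W.ncard = V(G).ncard ∧
      (∀ x ∈ V(G), ∃ w ∈ W, Reach G T w x) ∧
      ∀ Q ⊆ E(G.induce W), nrk M Q + T.ncard ≤ nrk M (Q ∪ T) := by
  induction hn : (V(G) \ W).ncard generalizing W with
  | zero =>
    rw [Set.ncard_eq_zero (hV.subset Set.sdiff_subset), Set.sdiff_eq_empty] at hn
    obtain rfl : W = V(G) := hW.antisymm hn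
    exact ⟨∅, by simp, by simp, by simp, fun x hx => ⟨x, hx, .refl _⟩, by simp⟩
  | succ n ih =>
    obtain ⟨x, hxV, hxW⟩ : (V(G) \ W).Nonempty := by
      rw [Set.nonempty_iff_ne_empty]
      rintro h
      simp [h] at hn
    obtain ⟨w, hw, hr⟩ := hcov x hxV
    obtain ⟨e, he, a, b, hl, ha, hb⟩ := exists_link_of_reach hr hw hxW
    have hW' : insert b W ⊆ V(G) := Set.insert_subset hl.right_mem hW
    have hn' : (V(G) \ insert b W).ncard = n := by
      have h1 : V(G) \ W = insert b (V(G) \ insert b W) := by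
        ext z
        simp only [Set.mem_sdiff, Set.mem_insert_iff, not_or]
        constructor
        · rintro ⟨h1, h2⟩
          by_cases hz : z = b
          exacts [.inl hz, .inr ⟨h1, hz, h2⟩]
        · rintro (rfl | ⟨h1, h2, h3⟩)
          exacts [⟨hl.right_mem, hb⟩, ⟨h1, h3⟩]
      rw [h1, Set.ncard_insert_of_notMem (by simp) (hV.subset Set.sdiff_subset)] at hn
      omega
    obtain ⟨T, hTS, hTf, hTc, hTr, hTk⟩ := ih hW' (fun x hx => by
      obtain ⟨w, hw, h⟩ := hcov x hx
      exact ⟨w, .inr hw, h⟩) hn'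
    have hrank : ∀ Q ⊆ E(G.induce W), nrk M (insert e Q) = nrk M Q + 1 := by
      intro Q hQ
      refine nrk_insert_of_notMem_closure (hM.ground_eq ▸ hS he) fun hcl => ?_
      refine hM.notMem_closure b hl.right_mem a (fun h => hb (h ▸ ha)) e hl.symm
        (M.closure_subset_closure ?_ hcl)
      intro f hf
      obtain ⟨c, d, hl', hc, hd⟩ := hQ hf
      rw [Graph.edgeSet_deleteVerts]
      exact ⟨c, d, hl', fun h => hb ((Set.mem_singleton_iff.1 h) ▸ hc),
        fun h => hb ((Set.mem_singleton_iff.1 h) ▸ hd)⟩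
    have heW : ∀ Q ⊆ E(G.induce W), insert e Q ⊆ E(G.induce (insert b W)) := by
      intro Q hQ
      refine Set.insert_subset ((mem_edgeSet_induce hl).2 ⟨.inr ha, .inl rfl⟩) fun f hf => ?_
      obtain ⟨c, d, hl', hc, hd⟩ := hQ hf
      exact ⟨c, d, hl', .inr hc, .inr hd⟩
    have heT : e ∉ T := by
      intro heT
      have h1 := hTk {e} (by simpa using heW ∅ (by simp))
      have h2 := hrank ∅ (by simp)
      rw [Set.singleton_union, Set.insert_eq_of_mem heT] at h1
      have h3 := nrk_le_ncard M hTf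
      simp only [insert_empty_eq] at h2
      omega
    refine ⟨insert e T, Set.insert_subset he hTS, hTf.insert _, ?_, ?_, ?_⟩
    · rw [Set.ncard_insert_of_notMem heT hTf]
      rw [Set.ncard_insert_of_notMem hb (hV.subset hW)] at hTc
      omega
    · intro x hx
      obtain ⟨w, rfl | hw, h⟩ := hTr x hx
      · exact ⟨a, ha, (Reach.of_link (.inl rfl) hl).trans (h.mono (Set.subset_insert _ _))⟩
      · exact ⟨w, hw, h.mono (Set.subset_insert _ _)⟩
    · intro Q hQ
      have h1 := hTk _ (heW Q hQ)
      rw [hrank Q hQ] at h1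
      rw [Set.ncard_insert_of_notMem heT hTf, Set.union_insert, ← Set.insert_union]
      omega

/-- The lower bound for ranks: a set of edges that reaches every vertex from `W` has rank at least
`|V(G) ∖ W|` more than its part inside `W`. -/
lemma IsPreFramework.le_nrk [M.RankFinite] (hM : IsPreFramework M G) (hV : V(G).Finite)
    (hS : S ⊆ E(G)) (hW : W ⊆ V(G)) (hcov : ∀ x ∈ V(G), ∃ w ∈ W, Reach G S w x)
    (hQS : Q ⊆ S) (hQ : Q ⊆ E(G.induce W)) :
    nrk M Q + V(G).ncard ≤ nrk M S + W.ncard := by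
  obtain ⟨T, hTS, -, hTc, -, hk⟩ := hM.exists_growth hV hS hW hcov
  have := hk Q hQ
  have := nrk_mono M (Set.union_subset hQS hTS)
  omega

lemma IsPreFramework.indep_path [M.RankFinite] (hM : IsPreFramework M G) (hV : V(G).Finite)
    {U : Set α} {P : Set β} (hp : PathIn G x y U P) (hx : x ∈ V(G)) : M.Indep P := by
  have hUV := hp.subset_vertexSet hx
  have hxU := hp.left_mem
  have hcard : (insert x (V(G) \ U)).ncard + U.ncard = V(G).ncard + 1 := by
    rw [Set.ncard_insert_of_notMem (by simp [hxU]) (hV.subset Set.sdiff_subset)]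
    have := Set.ncard_sdiff_add_ncard_of_subset hUV hV
    omega
  have h1 := hM.le_nrk (W := insert x (V(G) \ U)) (Q := ∅) hV hp.subset_edgeSet
    (Set.insert_subset hx Set.sdiff_subset) (fun z hz => by
      by_cases hzU : z ∈ U
      · exact ⟨x, .inl rfl, hp.reach z hzU⟩
      · exact ⟨z, .inr ⟨hz, hzU⟩, .refl _⟩) (by simp) (by simp)
  have h2 := hp.ncard
  have h3 := nrk_le_ncard M h2.1
  rw [Matroid.indep_iff_eRk_eq_encard, ← coe_nrk, ← h2.1.cast_ncard_eq]
  exact_mod_cast (by omega : nrk M P = P.ncard)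

/-- An unbalanced cycle is independent, as all proper subsets of a cycle are. -/
lemma IsPreFramework.indep_cycle [M.RankFinite] (hM : IsPreFramework M G) (hV : V(G).Finite)
    {C : Set β} (hC : IsCycle G C) (hnot : ¬ M.IsCircuit C) : M.Indep C := by
  rw [Matroid.indep_iff_forall_subset_not_isCircuit (by rw [hM.ground_eq]; exact hC.subset_edgeSet)]
  intro K hKC hK
  have hne : K ≠ C := fun h => hnot (h ▸ hK)
  obtain ⟨g, hg, hgK⟩ : ∃ g ∈ C, g ∉ K := by
    by_contra! h
    exact hne (hKC.antisymm h)
  obtain ⟨a, b, U, P, h⟩ := hC.exists_rep_edge hg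
  have hKP : K ⊆ P := fun z hz => by
    have := hKC hz
    rw [h.eq] at this
    exact this.resolve_left fun h' => hgK (h' ▸ hz)
  exact hK.not_indep ((hM.indep_path hV h.path h.link.right_mem).subset hKP)

lemma subset_edgeSet_induce_ends {C : Set β} (hC : C ⊆ E(G)) : C ⊆ E(G.induce (ends G C)) := by
  intro e he
  obtain ⟨a, b, hl⟩ := Graph.exists_isLink_of_mem_edgeSet (hC he)
  exact ⟨a, b, hl, ⟨e, he, hl.inc_left⟩, ⟨e, he, hl.inc_right⟩⟩

/-- A set of edges that contains an unbalanced cycle and joins every vertex to it has rank at least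
`|V(G)|`. -/
lemma IsPreFramework.ncard_le_nrk_of_cycle [M.RankFinite] (hM : IsPreFramework M G)
    (hV : V(G).Finite) (hS : S ⊆ E(G)) {C : Set β} (hC : IsCycle G C) (hCS : C ⊆ S)
    (hnot : ¬ M.IsCircuit C) (hcov : ∀ x ∈ V(G), ∃ w ∈ ends G C, Reach G S w x) :
    V(G).ncard ≤ nrk M S := by
  have h1 := hM.le_nrk hV hS (ends_subset_vertexSet C) hcov hCS
    (subset_edgeSet_induce_ends hC.subset_edgeSet)
  rw [nrk_eq_ncard_of_indep (hM.indep_cycle hV hC hnot), hC.ncard_ends] at h1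
  omega

/-- `W` contains exactly one vertex of each component of `(V(G), S)` that does not meet `Z`, and
no other vertices. -/
structure IsTransversal (G : Graph α β) (S : Set β) (Z W : Set α) : Prop where
  subset : W ⊆ V(G)
  cov : ∀ x ∈ V(G), (∃ z ∈ Z, Reach G S z x) ∨ ∃ w ∈ W, Reach G S w x
  inj : ∀ w ∈ W, ∀ w' ∈ W, Reach G S w w' → w = w'
  not_reach : ∀ z ∈ Z, ∀ w ∈ W, ¬ Reach G S z w

lemma exists_isTransversal (hV : V(G).Finite) (S : Set β) (Z : Set α) :
    ∃ W, IsTransversal G S Z W := by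
  let 𝓦 : Set (Set α) := {W | W ⊆ V(G) ∧ (∀ w ∈ W, ∀ w' ∈ W, Reach G S w w' → w = w') ∧
    ∀ z ∈ Z, ∀ w ∈ W, ¬ Reach G S z w}
  have hfin : 𝓦.Finite := hV.finite_subsets.subset fun W h => h.1
  obtain ⟨W, ⟨h1, h2, h3⟩, hmax⟩ := hfin.exists_maximal ⟨∅, by simp [𝓦]⟩
  refine ⟨W, h1, fun x hx => ?_, h2, h3⟩
  by_contra! hcon
  have hmem : insert x W ∈ 𝓦 := by
    refine ⟨Set.insert_subset hx h1, ?_, ?_⟩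
    · rintro w (rfl | hw) w' (rfl | hw') h
      · rfl
      · exact absurd h.symm (hcon.2 w' hw')
      · exact absurd h (hcon.2 w hw)
      · exact h2 w hw w' hw' h
    · rintro z hz w (rfl | hw)
      · exact hcon.1 z hz
      · exact h3 z hz w hw
  exact hcon.2 x (hmax hmem (Set.subset_insert _ _) (.inl rfl)) (.refl _)

/-- The rank formula: let `Q ⊆ S` be a set of edges inside `Z` that joins any two vertices of `Z`
in the same component of `(V(G), S)`. If every `R` with `Q ⊆ R ⊆ S` and the same components as
`S` spans `S`, then `r(S)` is `r(Q)` plus `|V(G) ∖ Z|` minus the number of components that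
avoid `Z`. -/
lemma IsPreFramework.nrk_eq [M.RankFinite] (hM : IsPreFramework M G) (hV : V(G).Finite)
    (hS : S ⊆ E(G)) (hZ : Z ⊆ V(G)) (hW : IsTransversal G S Z W) (hQS : Q ⊆ S)
    (hQ : Q ⊆ E(G.induce Z)) (hQZ : ∀ z ∈ Z, ∀ z' ∈ Z, Reach G S z z' → Reach G Q z z')
    (hcl : ∀ R ⊆ S, Q ⊆ R → (∀ x ∈ V(G), ∀ y, Reach G S x y → Reach G R x y) →
      S ⊆ M.closure R) :
    nrk M S + Z.ncard + W.ncard = nrk M Q + V(G).ncard := by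
  have hZW : Disjoint Z W := by
    rw [Set.disjoint_left]
    exact fun z hz hw => hW.not_reach z hz z hw (.refl _)
  have hcov : ∀ x ∈ V(G), ∃ w ∈ Z ∪ W, Reach G S w x := by
    intro x hx
    rcases hW.cov x hx with ⟨z, hz, h⟩ | ⟨w, hw, h⟩
    exacts [⟨z, .inl hz, h⟩, ⟨w, .inr hw, h⟩]
  obtain ⟨T, hTS, hTf, hTc, hTr, hTk⟩ :=
    hM.exists_growth hV hS (Set.union_subset hZ hW.subset) hcov
  rw [Set.ncard_union_eq hZW (hV.subset hZ) (hV.subset hW.subset)] at hTc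
  have hTk' := hTk Q (hQ.trans (by
    rintro e ⟨a, b, hl, ha, hb⟩; exact ⟨a, b, hl, .inl ha, .inl hb⟩))
  have hsub : S ⊆ M.closure (Q ∪ T) := by
    refine hcl _ (Set.union_subset hQS hTS) Set.subset_union_left fun x hx y hxy => ?_
    obtain ⟨w, hw, hwx⟩ := hTr x hx
    obtain ⟨w', hw', hwy⟩ := hTr y (hxy.mem_vertexSet hx)
    have hww : Reach G S w w' := (hwx.mono hTS).trans (hxy.trans (hwy.mono hTS).symm)
    have hww' : Reach G (Q ∪ T) w w' := by
      rcases hw with hw | hw <;> rcases hw' with hw' | hw'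
      · exact (hQZ w hw w' hw' hww).mono Set.subset_union_left
      · exact absurd hww (hW.not_reach w hw w' hw')
      · exact absurd hww.symm (hW.not_reach w' hw' w hw)
      · rw [hW.inj w hw w' hw' hww]; exact .refl _
    exact ((hwx.mono Set.subset_union_right).symm.trans hww').trans
      (hwy.mono Set.subset_union_right)
  have h1 := nrk_le_of_subset_closure M hsub
  have h2 := nrk_mono M (Set.union_subset hQS hTS)
  have h3 := nrk_submod M Q T
  have h4 := nrk_le_ncard M hTf
  omega

/-- An edge of `S` outside `R`, where `R` has the same components as `S`, closes a cycle with
`R`. -/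
lemma exists_cycle_of_reach (hl : G.IsLink f x y) (hfR : f ∉ R) (h : Reach G R x y) :
    ∃ D, IsCycle G D ∧ f ∈ D ∧ D ⊆ insert f R ∧ x ∈ ends G D := by
  obtain ⟨U, P, hp, hPR⟩ := h.exists_path
  have hrep := cycleRep_of_path hl.symm hp (fun h => hfR (hPR h))
  exact ⟨_, hrep.isCycle, .inl rfl, Set.insert_subset_insert hPR, f, .inl rfl, hl.inc_left⟩

/-- If every cycle in `S` is balanced, the rank of `S` is as in the cycle matroid. -/
lemma IsPreFramework.nrk_eq_of_balanced [M.RankFinite] (hM : IsPreFramework M G)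
    (hV : V(G).Finite) (hS : S ⊆ E(G)) (hbal : ∀ C, IsCycle G C → C ⊆ S → M.IsCircuit C)
    (hW : IsTransversal G S ∅ W) : nrk M S + W.ncard = V(G).ncard := by
  have := hM.nrk_eq (Q := ∅) hV hS (Set.empty_subset _) hW (by simp) (by simp) (by simp) ?_
  · simpa [nrk] using this
  · intro R hRS _ hR f hf
    by_cases hfR : f ∈ R
    · exact M.mem_closure_of_mem' hfR (hM.ground_eq ▸ hS hf)
    obtain ⟨x, y, hl⟩ := Graph.exists_isLink_of_mem_edgeSet (hS hf)
    obtain ⟨D, hD, hfD, hDR, -⟩ :=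
      exists_cycle_of_reach hl hfR (hR x hl.left_mem y (.of_link hf hl))
    have hDc := hbal D hD (hDR.trans (Set.insert_subset hf hRS))
    refine M.closure_subset_closure ?_ (hDc.mem_closure_sdiff_singleton_of_mem hfD)
    exact fun g hg => (hDR hg.1).resolve_left hg.2

/-- A set with only balanced cycles has rank less than `|V(G)|`. -/
lemma IsPreFramework.nrk_lt_of_balanced [M.RankFinite] (hM : IsPreFramework M G)
    (hV : V(G).Finite) (hne : V(G).Nonempty) (hS : S ⊆ E(G))
    (hbal : ∀ C, IsCycle G C → C ⊆ S → M.IsCircuit C) : nrk M S < V(G).ncard := by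
  obtain ⟨W, hW⟩ := exists_isTransversal hV S ∅
  have h1 := hM.nrk_eq_of_balanced hV hS hbal hW
  have h2 : W.Nonempty := by
    obtain ⟨x, hx⟩ := hne
    obtain ⟨z, hz, -⟩ | ⟨w, hw, -⟩ := hW.cov x hx
    exacts [absurd hz (by simp), ⟨w, hw⟩]
  have := (Set.ncard_pos (hV.subset hW.subset)).2 h2
  omega

lemma isCycle_deleteEdges_iff {X C : Set β} :
    IsCycle (G.deleteEdges X) C ↔ IsCycle G C ∧ Disjoint C X := by
  constructor
  · rintro ⟨n, v, e, hv, he, hl, rfl⟩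
    refine ⟨⟨n, v, e, hv, he, fun i => (hl i).1, rfl⟩, ?_⟩
    rw [Set.disjoint_left]
    rintro _ ⟨i, rfl⟩
    exact (hl i).2
  · rintro ⟨⟨n, v, e, hv, he, hl, rfl⟩, hd⟩
    exact ⟨n, v, e, hv, he, fun i => ⟨hl i, Set.disjoint_left.1 hd ⟨i, rfl⟩⟩, rfl⟩

end PreFramework

section NearlyComplete

variable {α β : Type*} {G : Graph α β}

/-- In a nearly complete graph, the pairs of distinct non-adjacent vertices are among two pairs
with a common vertex `m`. -/
lemma IsNearlyComplete.exists_center (h : IsNearlyComplete G) :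
    ∃ m a b, m ∈ V(G) ∧ ∀ x ∈ V(G), ∀ y ∈ V(G), x ≠ y → ¬ G.Adj x y →
      (x = m ∧ (y = a ∨ y = b)) ∨ (y = m ∧ (x = a ∨ x = b)) := by
  obtain ⟨u, w, p, -, hlen, hG⟩ := h
  have key : ∀ x (hx : x ∈ V(G)) y (hy : y ∈ V(G)), x ≠ y → ¬ G.Adj x y →
      s((⟨x, hx⟩ : V(G)), ⟨y, hy⟩) ∈ p.edges := by
    intro x hx y hy hxy hadj
    by_contra hcon
    have : G.toSimpleGraph.Adj ⟨x, hx⟩ ⟨y, hy⟩ := by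
      rw [hG, SimpleGraph.deleteEdges_adj]
      exact ⟨fun h => hxy (congrArg Subtype.val h), hcon⟩
    exact hadj this.2
  match p, hlen with
  | .nil, _ =>
    refine ⟨u, u, u, u.2, fun x hx y hy hxy hadj => ?_⟩
    simpa using key x hx y hy hxy hadj
  | .cons (v := v) _ .nil, _ =>
    refine ⟨u, v, v, u.2, fun x hx y hy hxy hadj => ?_⟩
    have := key x hx y hy hxy hadj
    simp only [SimpleGraph.Walk.edges_cons, SimpleGraph.Walk.edges_nil, List.mem_singleton,
      Sym2.eq_iff, Subtype.ext_iff] at this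
    tauto
  | .cons (v := v) _ (.cons _ .nil), _ =>
    refine ⟨v, u, w, v.2, fun x hx y hy hxy hadj => ?_⟩
    have := key x hx y hy hxy hadj
    simp only [SimpleGraph.Walk.edges_cons, SimpleGraph.Walk.edges_nil, List.mem_cons,
      List.not_mem_nil, or_false, Sym2.eq_iff, Subtype.ext_iff] at this
    tauto
  | .cons _ (.cons _ (.cons _ _)), h => simp at h

end NearlyComplete

/-! ### 3-connectivity -/

section ThreeConnected

variable {α β : Type*} {G : Graph α β} {M : Matroid β} {X Y S : Set β} {𝓑 : Set (Set β)}

/-- A graph with more than three vertices in which the non-adjacent pairs are as in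
`IsNearlyComplete.exists_center` is connected: a vertex outside `m`, `a`, `b` is adjacent to all
others. -/
lemma IsNearlyComplete.reach (h : IsNearlyComplete G) (hn : 3 < V(G).ncard) :
    ∀ x ∈ V(G), ∀ y ∈ V(G), Reach G E(G) x y := by
  obtain ⟨m, a, b, hm, hG⟩ := h.exists_center
  obtain ⟨z, hz, hz'⟩ : ∃ z ∈ V(G), z ∉ ({m, a, b} : Set α) := by
    by_contra! hcon
    have h1 := Set.ncard_le_ncard (show V(G) ⊆ {m, a, b} from hcon) (by simp)
    have h2 := Set.ncard_insert_le m {a, b}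
    have h3 := Set.ncard_insert_le a {b}
    have h4 := Set.ncard_singleton b
    omega
  simp only [Set.mem_insert_iff, Set.mem_singleton_iff, not_or] at hz'
  have key : ∀ x ∈ V(G), Reach G E(G) x z := by
    intro x hx
    by_cases hxz : x = z
    · exact hxz ▸ .refl _
    · by_contra hcon
      have := hG x hx z hz hxz fun ⟨e, he⟩ => hcon (.of_link he.edge_mem he)
      tauto
  exact fun x hx y hy => (key x hx).trans (key y hy).symm

/-- The rank bound for two complementary sets of edges neither of which joins all vertices, in the
case where the vertices reached from the centre `m` along `X` are reached along `Y` as well. -/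
lemma IsPreFramework.ncard_add_two_le_aux [M.RankFinite] (hM : IsPreFramework M G)
    (hV : V(G).Finite) (hn : 6 < V(G).ncard) {m a b : α} (hm : m ∈ V(G))
    (hG : ∀ x ∈ V(G), ∀ y ∈ V(G), x ≠ y → ¬ G.Adj x y →
      (x = m ∧ (y = a ∨ y = b)) ∨ (y = m ∧ (x = a ∨ x = b)))
    (hXY : X ∪ Y = E(G)) {z : α} (hz : z ∈ V(G)) (hzY : ¬ Reach G Y m z)
    (hsub : ∀ x, Reach G X m x → Reach G Y m x) :
    V(G).ncard + 2 ≤ nrk M X + nrk M Y := by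
  have hXE : X ⊆ E(G) := hXY ▸ Set.subset_union_left
  have hYE : Y ⊆ E(G) := hXY ▸ Set.subset_union_right
  -- an edge that leaves the set reached along `X` and the set reached along `Y` cannot exist
  have hnadj : ∀ p q, Reach G X m p → ¬ Reach G Y m q → ¬ G.Adj p q := by
    rintro p q hp hq ⟨e, he⟩
    rcases hXY.symm ▸ he.edge_mem with h | h
    · exact hq (hsub q (hp.trans (.of_link h he)))
    · exact hq ((hsub p hp).trans (.of_link h he))
  have hAm : ∀ p, Reach G X m p → p = m := by
    intro p hp
    by_contra hpm
    have hpz : p ≠ z := fun h => hzY (h ▸ hsub p hp)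
    rcases hG p (hp.mem_vertexSet hm) z hz hpz (hnadj p z hp hzY) with h | h
    · exact hpm h.1
    · exact hzY (h.1 ▸ .refl _)
  have hB : ∀ q ∈ V(G), ¬ Reach G Y m q → q = a ∨ q = b := by
    intro q hq hqY
    have hmq : m ≠ q := fun h => hqY (h ▸ .refl _)
    rcases hG m hm q hq hmq (hnadj m q (.refl _) hqY) with h | h
    · exact h.2
    · exact absurd h.1.symm hmq
  -- all edges between the other vertices reached along `Y` and those that are not belong to `X`
  have hX : ∀ p ∈ V(G), p ≠ m → Reach G Y m p → ∀ q ∈ V(G), ¬ Reach G Y m q → Reach G X p q := by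
    intro p hp hpm hpY q hq hqY
    have hpq : p ≠ q := fun h => hqY (h ▸ hpY)
    have hadj : G.Adj p q := by
      by_contra hcon
      rcases hG p hp q hq hpq hcon with h | h
      · exact hpm h.1
      · exact hqY (h.1 ▸ .refl _)
    obtain ⟨e, he⟩ := hadj
    rcases hXY.symm ▸ he.edge_mem with h | h
    · exact .of_link h he
    · exact absurd (hpY.trans (.of_link h he)) hqY
  have hcard : ({m, a, b} : Set α).ncard ≤ 3 := by
    have h2 := Set.ncard_insert_le m {a, b}
    have h3 := Set.ncard_insert_le a {b}
    have h4 := Set.ncard_singleton b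
    omega
  obtain ⟨y, hy, hy'⟩ : ∃ z ∈ V(G), z ∉ ({m, a, b} : Set α) := by
    by_contra! hcon
    have h1 := Set.ncard_le_ncard (show V(G) ⊆ {m, a, b} from hcon) (by simp)
    omega
  simp only [Set.mem_insert_iff, Set.mem_singleton_iff, not_or] at hy'
  have hyY : Reach G Y m y := by
    by_contra h
    have := hB y hy h
    tauto
  have rX := hM.le_nrk (S := X) (Q := ∅) (W := {m, z}) hV hXE
    (Set.insert_subset hm (by simpa using hz)) (fun x hx => by
      by_cases hxm : x = m
      · exact ⟨m, by simp, hxm ▸ .refl _⟩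
      refine ⟨z, by simp, ?_⟩
      by_cases hxY : Reach G Y m x
      · exact (hX x hx hxm hxY z hz hzY).symm
      · exact (hX y hy hy'.1 hyY z hz hzY).symm.trans (hX y hy hy'.1 hyY x hx hxY)) (by simp) (by simp)
  have rY := hM.le_nrk (S := Y) (Q := ∅) (W := {m, a, b} ∩ V(G)) hV hYE Set.inter_subset_right
    (fun x hx => by
      by_cases hxm : x ∈ ({m, a, b} : Set α)
      · exact ⟨x, ⟨hxm, hx⟩, .refl _⟩
      simp only [Set.mem_insert_iff, Set.mem_singleton_iff, not_or] at hxm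
      refine ⟨m, ⟨by simp, hm⟩, ?_⟩
      have hadj : G.Adj m x := by
        by_contra hcon
        have := hG m hm x hx (Ne.symm hxm.1) hcon
        tauto
      obtain ⟨e, he⟩ := hadj
      rcases hXY.symm ▸ he.edge_mem with h | h
      · exact absurd (hAm x (.of_link h he)) hxm.1
      · exact .of_link h he) (by simp) (by simp)
  have h1 : ({m, z} : Set α).ncard ≤ 2 := (Set.ncard_insert_le m {z}).trans (by simp)
  have h2 : (({m, a, b} : Set α) ∩ V(G)).ncard ≤ ({m, a, b} : Set α).ncard :=
    Set.ncard_le_ncard Set.inter_subset_left (by simp)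
  have h3 : nrk M ∅ = 0 := by simp [nrk]
  omega

/-- In a nearly complete graph on at least seven vertices, two complementary sets of edges neither
of which joins all vertices have ranks summing to at least `|V(G)| + 2`. -/
lemma IsPreFramework.ncard_add_two_le [M.RankFinite] (hM : IsPreFramework M G)
    (hV : V(G).Finite) (hG : IsNearlyComplete G) (hn : 6 < V(G).ncard) (hXY : X ∪ Y = E(G))
    (hX : ¬ ∀ x ∈ V(G), ∀ y ∈ V(G), Reach G X x y)
    (hY : ¬ ∀ x ∈ V(G), ∀ y ∈ V(G), Reach G Y x y) :
    V(G).ncard + 2 ≤ nrk M X + nrk M Y := by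
  obtain ⟨m, a, b, hm, hmab⟩ := hG.exists_center
  have hcut : ∀ S : Set β, (¬ ∀ x ∈ V(G), ∀ y ∈ V(G), Reach G S x y) →
      ∃ z ∈ V(G), ¬ Reach G S m z := by
    intro S hS
    by_contra! hcon
    exact hS fun x hx y hy => (hcon x hx).symm.trans (hcon y hy)
  obtain ⟨z, hz, hzX⟩ := hcut X hX
  obtain ⟨w, hw, hwY⟩ := hcut Y hY
  by_cases hsub : ∀ x, Reach G X m x → Reach G Y m x
  · exact hM.ncard_add_two_le_aux hV hn hm hmab hXY hw hwY hsub
  by_cases hsub' : ∀ x, Reach G Y m x → Reach G X m x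
  · rw [add_comm (nrk M X)]
    exact hM.ncard_add_two_le_aux hV hn hm hmab (Set.union_comm X Y ▸ hXY) hz hzX hsub'
  push Not at hsub hsub'
  obtain ⟨p, hpX, hpY⟩ := hsub
  obtain ⟨q, hqY, hqX⟩ := hsub'
  have hpq : p ≠ q := fun h => hqX (h ▸ hpX)
  exfalso
  rcases hmab p (hpX.mem_vertexSet hm) q (hqY.mem_vertexSet hm) hpq (by
    rintro ⟨e, he⟩
    rcases hXY.symm ▸ he.edge_mem with h | h
    · exact hqX (hpX.trans (.of_link h he))
    · exact hpY (hqY.trans (.of_link h he.symm))) with h | h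
  · exact hpY (h.1 ▸ .refl _)
  · exact hqX (h.1 ▸ .refl _)

lemma isSeparation_iff [M.Finite] {k : ℕ} :
    IsSeparation M k X Y ↔ X ∪ Y = M.E ∧ Disjoint X Y ∧ k ≤ X.ncard ∧ k ≤ Y.ncard ∧
      nrk M X + nrk M Y < nrk M M.E + k := by
  unfold IsSeparation
  constructor
  · rintro ⟨h1, h2, h3, h4, h5⟩
    have fX : X.Finite := M.ground_finite.subset (h1 ▸ Set.subset_union_left)
    have fY : Y.Finite := M.ground_finite.subset (h1 ▸ Set.subset_union_right)
    rw [← fX.cast_ncard_eq] at h3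
    rw [← fY.cast_ncard_eq] at h4
    rw [← coe_nrk, ← coe_nrk, ← nrk_ground] at h5
    exact ⟨h1, h2, by exact_mod_cast h3, by exact_mod_cast h4, by exact_mod_cast h5⟩
  · rintro ⟨h1, h2, h3, h4, h5⟩
    have fX : X.Finite := M.ground_finite.subset (h1 ▸ Set.subset_union_left)
    have fY : Y.Finite := M.ground_finite.subset (h1 ▸ Set.subset_union_right)
    rw [← fX.cast_ncard_eq, ← fY.cast_ncard_eq, ← coe_nrk, ← coe_nrk, ← nrk_ground]
    exact ⟨h1, h2, by exact_mod_cast h3, by exact_mod_cast h4, by exact_mod_cast h5⟩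

/-- In a simple matroid any two elements are independent. -/
lemma MatroidSimple.le_nrk [M.Finite] (hs : MatroidSimple M) (hX : X ⊆ M.E) {k : ℕ} (hk : k ≤ 2)
    (hkX : k ≤ X.ncard) : k ≤ nrk M X := by
  obtain ⟨I, hIX, hI⟩ := Set.exists_subset_card_eq hkX
  have fI : I.Finite := M.ground_finite.subset (hIX.trans hX)
  have : M.Indep I := by
    rw [Matroid.indep_iff_forall_subset_not_isCircuit (hIX.trans hX)]
    intro C hCI hC
    have h1 := hs C hC
    have h2 := Set.encard_le_encard hCI
    rw [← fI.cast_ncard_eq, hI] at h2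
    have h3 : (k : ℕ∞) ≤ 2 := by exact_mod_cast hk
    exact absurd (h2.trans h3) (not_le.2 h1)
  exact hI ▸ ncard_le_nrk_of_indep this hIX

/-- The characterization of 3-connectivity. Only the lower rank bounds of a framework and the
bound `r(M) ≤ |V(G)|` are needed. -/
lemma IsPreFramework.threeConnected_iff [M.Finite] (hM : IsPreFramework M G)
    (hV : V(G).Finite) (hG : IsNearlyComplete G) (hn : 6 < V(G).ncard)
    (hr : nrk M M.E ≤ V(G).ncard) (h𝓑 : ∀ C, IsCycle G C → (C ∈ 𝓑 ↔ M.IsCircuit C)) :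
    ThreeConnected M ↔ MatroidSimple M ∧ ¬ ∃ X, IsBalancingSet G 𝓑 X ∧ M.eRk X ≤ 2 := by
  have hconn := hG.reach (by omega)
  obtain ⟨x₀, hx₀⟩ : V(G).Nonempty := (Set.ncard_pos hV).1 (by omega)
  have hE := hM.ground_eq
  have hlow : ∀ S ⊆ E(G), (∀ x ∈ V(G), ∀ y ∈ V(G), Reach G S x y) →
      V(G).ncard ≤ nrk M S + 1 := by
    intro S hS hSc
    have := hM.le_nrk (Q := ∅) (W := {x₀}) hV hS (by simpa using hx₀)
      (fun x hx => ⟨x₀, rfl, hSc x₀ hx₀ x hx⟩) (by simp) (by simp)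
    rw [Set.ncard_singleton] at this
    simpa [nrk] using this
  have hunb : ∀ S ⊆ E(G), (∀ x ∈ V(G), ∀ y ∈ V(G), Reach G S x y) →
      (∃ C, IsCycle G C ∧ C ⊆ S ∧ C ∉ 𝓑) → V(G).ncard ≤ nrk M S := by
    rintro S hS hSc ⟨C, hC, hCS, hCB⟩
    obtain ⟨w, hw⟩ := hC.ends_nonempty
    exact hM.ncard_le_nrk_of_cycle hV hS hC hCS (fun h => hCB ((h𝓑 C hC).2 h))
      fun x hx => ⟨w, hw, hSc w (ends_subset_vertexSet _ hw) x hx⟩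
  have hbal : ∀ S ⊆ E(G), (∀ C, IsCycle G C → C ⊆ S → C ∈ 𝓑) → nrk M S < V(G).ncard :=
    fun S hS h => hM.nrk_lt_of_balanced hV ⟨x₀, hx₀⟩ hS fun C hC hCS => (h𝓑 C hC).1 (h C hC hCS)
  have hrE := hlow E(G) subset_rfl hconn
  rw [← hE] at hrE
  constructor
  · intro hT
    refine ⟨fun C hC => ?_, ?_⟩
    · by_contra! hcon
      have hCE := hC.subset_ground
      have hCf : C.Finite := M.ground_finite.subset hCE
      have hC1 : 1 ≤ C.ncard := (Set.ncard_pos hCf).2 hC.nonempty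
      have hC2 : C.ncard ≤ 2 := by
        rw [← hCf.cast_ncard_eq] at hcon; exact_mod_cast hcon
      have hrC : nrk M C + 1 = C.ncard := by
        have := hC.eRk_add_one_eq
        rw [← coe_nrk, ← hCf.cast_ncard_eq] at this
        exact_mod_cast this
      have h1 := nrk_submod M C (M.E \ C)
      rw [Set.union_sdiff_cancel hCE] at h1
      have h2 := nrk_mono M (show M.E \ C ⊆ M.E from Set.sdiff_subset)
      have h3 := nrk_le_ncard M (M.ground_finite.subset (show M.E \ C ⊆ M.E from Set.sdiff_subset))
      exact hT C.ncard hC1 (by omega) C (M.E \ C) (isSeparation_iff.2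
        ⟨Set.union_sdiff_cancel hCE, Set.disjoint_sdiff_right, le_rfl, by omega, by omega⟩)
    · rintro ⟨X, ⟨hXE, ⟨C, hC, hCB⟩, hXb⟩, hX2⟩
      rw [← hE] at hXE
      have hXf : X.Finite := M.ground_finite.subset hXE
      have hX2 : nrk M X ≤ 2 := by
        rw [← coe_nrk] at hX2; exact_mod_cast hX2
      have hY := hbal (M.E \ X) (hE ▸ Set.sdiff_subset) fun D hD hDX =>
        hXb D (isCycle_deleteEdges_iff.2 ⟨hD, (Set.subset_sdiff.1 hDX).2⟩)
      have hrn := hunb E(G) subset_rfl hconn ⟨C, hC, hC.subset_edgeSet, hCB⟩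
      rw [← hE] at hrn
      have hX0 : 1 ≤ X.ncard := by
        rw [Nat.one_le_iff_ne_zero, Ne, Set.ncard_eq_zero hXf]
        rintro rfl
        exact hCB (hXb C (isCycle_deleteEdges_iff.2 ⟨hC, by simp⟩))
      have h1 := nrk_submod M X (M.E \ X)
      rw [Set.union_sdiff_cancel hXE] at h1
      have h3 := nrk_le_ncard M (M.ground_finite.subset (show M.E \ X ⊆ M.E from Set.sdiff_subset))
      have h4 := nrk_le_ncard M hXf
      by_cases hX1 : X.ncard = 1
      · exact hT 1 le_rfl (by omega) X (M.E \ X) (isSeparation_iff.2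
          ⟨Set.union_sdiff_cancel hXE, Set.disjoint_sdiff_right, by omega, by omega, by omega⟩)
      · exact hT 2 (by omega) (by omega) X (M.E \ X) (isSeparation_iff.2
          ⟨Set.union_sdiff_cancel hXE, Set.disjoint_sdiff_right, by omega, by omega, by omega⟩)
  · rintro ⟨hs, hno⟩ k hk1 hk3 X Y hsep
    obtain ⟨hXY, hdisj, hkX, hkY, hrk⟩ := isSeparation_iff.1 hsep
    -- if one side joins all vertices, the other side has rank at least `k`, and at least `3` if
    -- it is a balancing set
    have side : ∀ X Y : Set β, X ∪ Y = M.E → Disjoint X Y → k ≤ X.ncard →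
        (∀ x ∈ V(G), ∀ y ∈ V(G), Reach G Y x y) → nrk M M.E + k ≤ nrk M X + nrk M Y := by
      intro X Y hXY hdisj hkX hYc
      have hXE : X ⊆ M.E := hXY ▸ Set.subset_union_left
      have hYE : Y ⊆ M.E := hXY ▸ Set.subset_union_right
      have h1 := hs.le_nrk hXE (by omega) hkX
      by_cases hYb : ∃ C, IsCycle G C ∧ C ⊆ Y ∧ C ∉ 𝓑
      · have := hunb Y (hE ▸ hYE) hYc hYb
        omega
      · push Not at hYb
        have h2 := hlow Y (hE ▸ hYE) hYc
        by_cases hGb : ∃ C, IsCycle G C ∧ C ∉ 𝓑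
        · have h3 : ¬ nrk M X ≤ 2 := by
            intro hX2
            refine hno ⟨X, ⟨hE ▸ hXE, hGb, fun C hC => ?_⟩, ?_⟩
            · rw [isCycle_deleteEdges_iff] at hC
              refine hYb C hC.1 fun e he => ?_
              have : e ∈ X ∪ Y := by rw [hXY, hE]; exact hC.1.subset_edgeSet he
              exact this.resolve_left (Set.disjoint_left.1 hC.2 he)
            · rw [← coe_nrk]; exact_mod_cast hX2
          omega
        · push Not at hGb
          have := hbal M.E hE.subset fun C hC _ => hGb C hC
          omega
    by_cases hYc : ∀ x ∈ V(G), ∀ y ∈ V(G), Reach G Y x y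
    · have := side X Y hXY hdisj hkX hYc
      omega
    by_cases hXc : ∀ x ∈ V(G), ∀ y ∈ V(G), Reach G X x y
    · have := side Y X (Set.union_comm X Y ▸ hXY) hdisj.symm hkY hXc
      omega
    have := hM.ncard_add_two_le hV hG hn (hXY.trans hE) hXc hYc
    omega

lemma IsFramework.threeConnected_iff [M.Finite] (hM : IsFramework M G)
    (hV : V(G).Finite) (hG : IsNearlyComplete G) (hn : 6 < V(G).ncard) :
    ThreeConnected M ↔ MatroidSimple M ∧
      ¬ ∃ X, IsBalancingSet G (circuitCycles M G) X ∧ M.eRk X ≤ 2 := by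
  refine hM.isPreFramework.threeConnected_iff hV hG hn ?_ fun C hC => ⟨fun h => h.2, fun h => ⟨hC, h⟩⟩
  have hconn : IsConnected G :=
    isConnected_iff.2 ⟨(Set.ncard_pos hV).1 (by omega), hG.reach (by omega)⟩
  have := hM.rank_component_le G Graph.IsClosedSubgraph.rfl hconn
  rw [← coe_nrk, ← hV.cast_ncard_eq, ← hM.ground_eq] at this
  exact_mod_cast this

end ThreeConnected

/-! ### Circuits of the matroid of a proper tripartition -/

section Circuits

variable {α β : Type*} {G : Graph α β} {T : ProperTripartition G} {M : Matroid β}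
  {C D K R S Q : Set β} {x y a b : α} {e f : β}

lemma PathIn.eq_of_self {U : Set α} {P : Set β} (h : PathIn G x x U P) : U = {x} ∧ P = ∅ := by
  cases h with
  | nil => exact ⟨rfl, rfl⟩
  | cons _ hp hx => exact absurd hp.right_mem hx

/-- An inner vertex of a path meets two edges of it. -/
lemma PathIn.exists_other {U : Set α} {P : Set β} (h : PathIn G a b U P) (he : e ∈ P)
    (hl : G.IsLink e x y) (hxa : x ≠ a) (hxb : x ≠ b) : ∃ f ∈ P, f ≠ e ∧ G.Inc f x := by
  obtain ⟨U₁, P₁, U₂, P₂, h1, h2, -, hi, rfl⟩ := h.split (h.ends_mem he hl).1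
  obtain ⟨f₁, hf₁, i₁⟩ := h1.inc_of_ne hxa.symm x h1.right_mem
  obtain ⟨f₂, hf₂, i₂⟩ := h2.inc_of_ne hxb x h2.left_mem
  have hd := h1.disjoint_of_inter_subset h2 hi.subset
  by_cases h' : f₁ = e
  · refine ⟨f₂, .inr hf₂, ?_, i₂⟩
    rintro rfl
    exact Set.disjoint_left.1 hd hf₁ (h' ▸ hf₂)
  · exact ⟨f₁, .inl hf₁, h', i₁⟩

namespace ProperTripartition

lemma isCycle_balanced (hC : C ∈ T.balanced) : IsCycle G C := by
  have : C ∈ T.balanced ∪ T.lift ∪ T.frame := .inl (.inl hC)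
  rwa [T.union_eq] at this

lemma isCycle_lift (hC : C ∈ T.lift) : IsCycle G C := by
  have : C ∈ T.balanced ∪ T.lift ∪ T.frame := .inl (.inr hC)
  rwa [T.union_eq] at this

lemma isCycle_frame (hC : C ∈ T.frame) : IsCycle G C := by
  have : C ∈ T.balanced ∪ T.lift ∪ T.frame := .inr hC
  rwa [T.union_eq] at this

lemma lift_or_frame (hC : IsCycle G C) (hCb : C ∉ T.balanced) : C ∈ T.lift ∨ C ∈ T.frame := by
  have : C ∈ T.balanced ∪ T.lift ∪ T.frame := by rw [T.union_eq]; exact hC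
  rcases this with (h | h) | h
  exacts [absurd h hCb, .inl h, .inr h]

lemma notMem_balanced_of_lift (hC : C ∈ T.lift) : C ∉ T.balanced :=
  fun h => Set.disjoint_left.1 T.disjoint_balanced_lift h hC

lemma notMem_balanced_of_frame (hC : C ∈ T.frame) : C ∉ T.balanced :=
  fun h => Set.disjoint_left.1 T.disjoint_balanced_frame h hC

lemma lift_of_disjoint (hC : C ∈ T.lift) (hD : IsCycle G D) (hDb : D ∉ T.balanced)
    (hdisj : Disjoint (ends G C) (ends G D)) : D ∈ T.lift :=
  (T.lift_or_frame hD hDb).resolve_right fun h =>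
    Set.not_disjoint_iff_nonempty_inter.2 (T.lift_meets_frame C hC D h) hdisj

lemma frame_of_disjoint (hC : C ∈ T.frame) (hD : IsCycle G D) (hDb : D ∉ T.balanced)
    (hdisj : Disjoint (ends G C) (ends G D)) : D ∈ T.frame :=
  (T.lift_or_frame hD hDb).resolve_left fun h =>
    Set.not_disjoint_iff_nonempty_inter.2 (T.lift_meets_frame D h C hC) hdisj.symm

/-- No vertex meets just one edge of a circuit, unless that edge is a loop. -/
lemma IsCircuitSet.exists_other (hK : T.IsCircuitSet K) (he : e ∈ K) (hl : G.IsLink e x y)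
    (hxy : x ≠ y) : ∃ f ∈ K, f ≠ e ∧ G.Inc f x := by
  have cyc : ∀ C ⊆ K, IsCycle G C → e ∈ C → ∃ f ∈ K, f ≠ e ∧ G.Inc f x := by
    intro C hCK hC heC
    obtain ⟨f, hf, h⟩ := hC.exists_other heC hl hxy
    exact ⟨f, hCK hf, h⟩
  have sub : ∀ C ⊆ K, (∃ f ∈ C, f ≠ e ∧ G.Inc f x) → ∃ f ∈ K, f ≠ e ∧ G.Inc f x :=
    fun C hC ⟨f, hf, h⟩ => ⟨f, hC hf, h⟩
  cases hK with
  | balanced_cycle _ hC => exact cyc _ subset_rfl (isCycle_balanced hC) he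
  | theta P₁ P₂ P₃ h =>
    obtain ⟨u, v, U₁, U₂, U₃, huv, p1, p2, p3, -, -, -, d12, d13, d23⟩ := h
    rw [isPath_iff] at p1 p2 p3
    have two : ∀ U P U' P', PathIn G u v U P → PathIn G u v U' P' → Disjoint P P' → e ∈ P →
        ∃ f ∈ P ∪ P', f ≠ e ∧ G.Inc f x := by
      intro U P U' P' p p' d heP
      have hne : ∀ f ∈ P', f ≠ e := fun f hf h => Set.disjoint_left.1 d heP (h ▸ hf)
      by_cases hxu : x = u
      · obtain ⟨f, hf, hi⟩ := p'.inc_of_ne huv u p'.left_mem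
        exact ⟨f, .inr hf, hne f hf, hxu ▸ hi⟩
      by_cases hxv : x = v
      · obtain ⟨f, hf, hi⟩ := p'.inc_of_ne huv v p'.right_mem
        exact ⟨f, .inr hf, hne f hf, hxv ▸ hi⟩
      obtain ⟨f, hf, h⟩ := p.exists_other heP hl hxu hxv
      exact ⟨f, .inl hf, h⟩
    rcases he with (he | he) | he
    · exact sub _ Set.subset_union_left (two _ _ _ _ p1 p2 d12 he)
    · exact sub _ (by rw [Set.union_comm]; exact Set.subset_union_left)
        (two _ _ _ _ p2 p1 d12.symm he)
    · exact sub _ (Set.union_subset Set.subset_union_right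
        (Set.subset_union_left.trans Set.subset_union_left)) (two _ _ _ _ p3 p1 d13.symm he)
  | tight_handcuff C D hC hD =>
    rcases he with he | he
    · exact cyc _ Set.subset_union_left hC he
    · exact cyc _ Set.subset_union_right hD he
  | lift_pair C D hC hD =>
    rcases he with he | he
    · exact cyc _ Set.subset_union_left (isCycle_lift hC) he
    · exact cyc _ Set.subset_union_right (isCycle_lift hD) he
  | loose_handcuff C D P U u v hC hD hdisj hP hu hv =>
    have huC : u ∈ ends G C := (hu.symm.subset rfl : u ∈ U ∩ ends G C).2
    have hvD : v ∈ ends G D := (hv.symm.subset rfl : v ∈ U ∩ ends G D).2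
    by_cases heC : e ∈ C
    · exact cyc _ (Set.subset_union_left.trans Set.subset_union_left) (isCycle_frame hC) heC
    by_cases heD : e ∈ D
    · exact cyc _ (Set.subset_union_right.trans Set.subset_union_left) (isCycle_frame hD) heD
    have heP : e ∈ P := by
      rcases he with (he | he) | he
      exacts [absurd he heC, absurd he heD, he]
    rw [isPath_iff] at hP
    by_cases hxu : x = u
    · obtain ⟨f, hf, hi⟩ := huC
      exact ⟨f, .inl (.inl hf), fun h => heC (h ▸ hf), hxu ▸ hi⟩
    by_cases hxv : x = v
    · obtain ⟨f, hf, hi⟩ := hvD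
      exact ⟨f, .inl (.inr hf), fun h => heD (h ▸ hf), hxv ▸ hi⟩
    exact sub _ Set.subset_union_right (hP.exists_other heP hl hxu hxv)

/-- A circuit through an edge from `v` to another vertex has a second edge at `v`. -/
lemma IsMatroid.isPreFramework (hM : T.IsMatroid M) : IsPreFramework M G := by
  refine ⟨hM.1, fun v hv w hwv e hl hcl => ?_⟩
  have hnot : ∀ f ∈ E(G.deleteVerts {v}), ¬ G.Inc f v := by
    rintro f hf ⟨z, hz⟩
    rw [Graph.edgeSet_deleteVerts] at hf
    obtain ⟨c, d, hcd, hc, hd⟩ := hf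
    rcases hz.left_eq_or_eq hcd with rfl | rfl
    exacts [hc rfl, hd rfl]
  obtain ⟨K, hKs, hK, heK⟩ := Matroid.exists_isCircuit_of_mem_closure hcl
    (fun h => hnot e h hl.inc_left)
  obtain ⟨f, hf, hfe, hi⟩ := ((hM.2 K).1 hK).exists_other heK hl hwv.symm
  exact hnot f ((hKs hf).resolve_left hfe) hi

/-- A cycle contained in the union of two vertex-disjoint (or equal) cycles is one of them. -/
lemma _root_.QuasiGraphic.IsCycle.eq_or_eq {C₁ C₂ : Set β} (h1 : IsCycle G C₁) (h2 : IsCycle G C₂)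
    (h12 : C₁ = C₂ ∨ Disjoint (ends G C₁) (ends G C₂)) (hD : IsCycle G D) (hDs : D ⊆ C₁ ∪ C₂) :
    D = C₁ ∨ D = C₂ := by
  rcases h12 with rfl | h12
  · rw [Set.union_self] at hDs
    exact .inl (h1.eq_of_subset hD hDs)
  obtain ⟨e, he⟩ := hD.nonempty
  have key : ∀ A B : Set β, IsCycle G A → Disjoint (ends G A) (ends G B) → D ⊆ A ∪ B → e ∈ A →
      D = A := by
    intro A B hA hAB hDs heA
    refine (hD.eq_of_subset hA (hA.subset_of_inter hD ?_ ⟨e, he, heA⟩)).symm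
    intro f hf hfA x hx hi
    exact Set.disjoint_left.1 hAB hx ⟨f, (hDs hf).resolve_left hfA, hi⟩
  rcases hDs he with h | h
  · exact .inl (key C₁ C₂ h1 h12 hDs h)
  · exact .inr (key C₂ C₁ h2 h12.symm (by rwa [Set.union_comm]) h)

/-- Two vertex-disjoint frame-type cycles form an independent set, and so does an unbalanced
cycle. -/
lemma IsCircuitSet.not_subset {C₁ C₂ : Set β} (h1 : IsCycle G C₁) (h2 : IsCycle G C₂)
    (hb1 : C₁ ∉ T.balanced) (hb2 : C₂ ∉ T.balanced)
    (h12 : C₁ = C₂ ∨ Disjoint (ends G C₁) (ends G C₂) ∧ C₁ ∈ T.frame ∧ C₂ ∈ T.frame)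
    (hK : T.IsCircuitSet K) : ¬ K ⊆ C₁ ∪ C₂ := by
  intro hKs
  have h12' : C₁ = C₂ ∨ Disjoint (ends G C₁) (ends G C₂) := h12.imp_right And.left
  cases hK with
  | balanced_cycle _ hC =>
    rcases h1.eq_or_eq h2 h12' (isCycle_balanced hC) hKs with rfl | rfl
    exacts [hb1 hC, hb2 hC]
  | theta P₁ P₂ P₃ h =>
    obtain ⟨u, v, U₁, U₂, U₃, huv, p1, p2, p3, -, -, -, d12, d13, d23⟩ := h
    rw [isPath_iff] at p1 p2 p3
    obtain ⟨e₁, he₁, i₁⟩ := p1.inc_of_ne huv u p1.left_mem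
    obtain ⟨e₂, he₂, i₂⟩ := p2.inc_of_ne huv u p2.left_mem
    obtain ⟨e₃, he₃, i₃⟩ := p3.inc_of_ne huv u p3.left_mem
    have m1 := hKs (.inl (.inl he₁))
    have m2 := hKs (.inl (.inr he₂))
    have m3 := hKs (.inr he₃)
    have n12 : e₁ ≠ e₂ := fun h => Set.disjoint_left.1 d12 he₁ (h ▸ he₂)
    have n13 : e₁ ≠ e₃ := fun h => Set.disjoint_left.1 d13 he₁ (h ▸ he₃)
    have n23 : e₂ ≠ e₃ := fun h => Set.disjoint_left.1 d23 he₂ (h ▸ he₃)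
    have same : ∀ A B : Set β, IsCycle G A → (A = B ∨ Disjoint (ends G A) (ends G B)) →
        e₁ ∈ A → e₂ ∈ A ∪ B → e₃ ∈ A ∪ B → False := by
      intro A B hA hAB k1 k2 k3
      have : ∀ e ∈ A ∪ B, G.Inc e u → e ∈ A := by
        rintro e (he | he) hi
        · exact he
        · rcases hAB with rfl | hAB
          · exact he
          · exact absurd (⟨e, he, hi⟩ : u ∈ ends G B) (Set.disjoint_left.1 hAB ⟨e₁, k1, i₁⟩)
      exact hA.not_three k1 (this _ k2 i₂) (this _ k3 i₃) i₁ i₂ i₃ n12 n13 n23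
    rcases m1 with m1 | m1
    · exact same C₁ C₂ h1 h12' m1 m2 m3
    · exact same C₂ C₁ h2 (h12'.imp Eq.symm fun h => h.symm) m1 m2.symm m3.symm
  | tight_handcuff C D hC hD hCb hDb hdisj x hx =>
    have hxx : x ∈ ends G C ∩ ends G D := hx.symm.subset rfl
    have hCD : C ≠ D := by
      rintro rfl
      obtain ⟨e, he⟩ := hC.nonempty
      exact Set.disjoint_left.1 hdisj he he
    have hd : C₁ ≠ C₂ → Disjoint (ends G C₁) (ends G C₂) := fun h => h12'.resolve_left h
    rcases h1.eq_or_eq h2 h12' hC (Set.subset_union_left.trans hKs) with rfl | rfl <;>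
      rcases h1.eq_or_eq h2 h12' hD (Set.subset_union_right.trans hKs) with rfl | rfl
    · exact hCD rfl
    · exact Set.disjoint_left.1 (hd hCD) hxx.1 hxx.2
    · exact Set.disjoint_left.1 (hd hCD.symm) hxx.2 hxx.1
    · exact hCD rfl
  | lift_pair C D hC hD hdisj =>
    have hne : C ≠ D := by
      rintro rfl
      obtain ⟨x, hx⟩ := (isCycle_lift hC).ends_nonempty
      exact Set.disjoint_left.1 hdisj hx hx
    have h := h1.eq_or_eq h2 h12' (isCycle_lift hC) (Set.subset_union_left.trans hKs)
    have h' := h1.eq_or_eq h2 h12' (isCycle_lift hD) (Set.subset_union_right.trans hKs)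
    rcases h12 with rfl | ⟨-, f1, f2⟩
    · rw [or_self] at h h'
      exact hne (h.trans h'.symm)
    · rcases h with rfl | rfl
      · exact Set.disjoint_left.1 T.disjoint_lift_frame hC f1
      · exact Set.disjoint_left.1 T.disjoint_lift_frame hC f2
  | loose_handcuff C D P U u v hC hD hdisj hP hu hv =>
    have huC : u ∈ ends G C := (hu.symm.subset rfl : u ∈ U ∩ ends G C).2
    have hvD : v ∈ ends G D := (hv.symm.subset rfl : v ∈ U ∩ ends G D).2
    have huv : u ≠ v := by
      rintro rfl
      exact Set.disjoint_left.1 hdisj huC hvD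
    have hne : C ≠ D := by
      rintro rfl
      exact Set.disjoint_left.1 hdisj huC huC
    have h := h1.eq_or_eq h2 h12' (isCycle_frame hC)
      ((Set.subset_union_left.trans Set.subset_union_left).trans hKs)
    have h' := h1.eq_or_eq h2 h12' (isCycle_frame hD)
      ((Set.subset_union_right.trans Set.subset_union_left).trans hKs)
    have hPs : P ⊆ C ∪ D := by
      refine (Set.subset_union_right.trans hKs).trans ?_
      rcases h with rfl | rfl <;> rcases h' with rfl | rfl
      exacts [absurd rfl hne, subset_rfl, (Set.union_comm _ _).subset, absurd rfl hne]
    rw [isPath_iff] at hP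
    obtain ⟨e, he, z, hz⟩ := hP.inc_of_ne huv u hP.left_mem
    have heC : e ∈ C := (hPs he).resolve_right fun h =>
      Set.disjoint_left.1 hdisj huC ⟨e, h, hz.inc_left⟩
    have hzU : z ∈ U ∩ ends G C := ⟨(hP.ends_mem he hz).2, e, heC, hz.inc_right⟩
    rw [hu] at hzU
    exact hP.ne_of_isLink he hz (Set.mem_singleton_iff.1 hzU).symm

/-- The balanced cycles of a tripartition are the cycles that are circuits. -/
lemma IsMatroid.mem_balanced_iff (hM : T.IsMatroid M) (hC : IsCycle G C) :
    C ∈ T.balanced ↔ M.IsCircuit C := by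
  refine ⟨fun h => (hM.2 C).2 (.balanced_cycle C h), fun h => ?_⟩
  by_contra hCb
  exact ((hM.2 C).1 h).not_subset hC hC hCb hCb (.inl rfl) Set.subset_union_left

lemma IsMatroid.nrk_cycle [M.RankFinite] (hM : T.IsMatroid M) (hV : V(G).Finite)
    (hC : IsCycle G C) (hCb : C ∉ T.balanced) : nrk M C = (ends G C).ncard := by
  rw [nrk_eq_ncard_of_indep (hM.isPreFramework.indep_cycle hV hC
    fun h => hCb ((hM.mem_balanced_iff hC).2 h)), hC.ncard_ends]

lemma IsMatroid.nrk_frame_pair [M.RankFinite] (hM : T.IsMatroid M) (hC : C ∈ T.frame)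
    (hD : D ∈ T.frame) (hdisj : Disjoint (ends G C) (ends G D)) :
    nrk M (C ∪ D) = (ends G C ∪ ends G D).ncard := by
  have cC := isCycle_frame hC
  have cD := isCycle_frame hD
  have hind : M.Indep (C ∪ D) := by
    rw [Matroid.indep_iff_forall_subset_not_isCircuit
      (by rw [hM.1]; exact Set.union_subset cC.subset_edgeSet cD.subset_edgeSet)]
    intro K hK hKc
    exact ((hM.2 K).1 hKc).not_subset cC cD (notMem_balanced_of_frame hC)
      (notMem_balanced_of_frame hD) (.inr ⟨hdisj, hC, hD⟩) hK
  have fin : ∀ C, IsCycle G C → (ends G C).Finite := by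
    intro C hC
    obtain ⟨x, hx⟩ := hC.ends_nonempty
    obtain ⟨_, _, U, P, h⟩ := hC.exists_rep_vertex hx
    rw [h.ends_eq]; exact h.path.finite
  have hd : Disjoint C D := by
    rw [Set.disjoint_left]
    intro e he he'
    obtain ⟨a, b, hl⟩ := Graph.exists_isLink_of_mem_edgeSet (cC.subset_edgeSet he)
    exact Set.disjoint_left.1 hdisj ⟨e, he, hl.inc_left⟩ ⟨e, he', hl.inc_left⟩
  rw [nrk_eq_ncard_of_indep hind, Set.ncard_union_eq hd cC.finite cD.finite,
    Set.ncard_union_eq hdisj (fin C cC) (fin D cD), cC.ncard_ends, cD.ncard_ends]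

end ProperTripartition

end Circuits

/-! ### Rank formulas for the matroid of a proper tripartition -/

section Spanning

variable {α β : Type*} {G : Graph α β} {T : ProperTripartition G} {M : Matroid β}
  {C D K R S Q : Set β} {x y a b : α} {e f : β}

namespace ProperTripartition

/-- An unbalanced cycle `C` and a path `P` that meets it exactly in the two ends of `P` span a
circuit that contains `P`: either one of the two new cycles is balanced, or the theta subgraph has
no balanced cycle. -/
lemma exists_isCircuitSet_of_ear (hC : IsCycle G C) (hCb : C ∉ T.balanced) {U : Set α}
    {P : Set β} (hP : PathIn G x y U P) (hxy : x ≠ y) (hU : U ∩ ends G C = {x, y})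
    (hPC : Disjoint P C) : ∃ K, T.IsCircuitSet K ∧ P ⊆ K ∧ K ⊆ C ∪ P := by
  have hx : x ∈ ends G C := (hU.symm.subset (.inl rfl) : x ∈ U ∩ ends G C).2
  have hy : y ∈ ends G C := (hU.symm.subset (.inr rfl) : y ∈ U ∩ ends G C).2
  obtain ⟨e₀, c, Z, P₀, h⟩ := hC.exists_rep_vertex hx
  obtain ⟨U₁, A, U₂, B, hA, hB, hU12, hi, hAB⟩ := h.path.split (h.ends_eq ▸ hy)
  have hxU₂ : x ∉ U₂ := by
    intro hx'
    have : x ∈ U₁ ∩ U₂ := ⟨hA.left_mem, hx'⟩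
    rw [hi] at this
    exact hxy this
  have hB' : PathIn G x y (insert x U₂) (insert e₀ B) := .cons h.link.symm hB.reverse hxU₂
  have hCeq : A ∪ insert e₀ B = C := by
    rw [Set.union_insert, hAB, h.eq]
  have hUZ : U₁ ∪ insert x U₂ = ends G C := by
    rw [Set.union_insert, hU12, h.ends_eq, Set.insert_eq_of_mem h.path.left_mem]
  have i1 : U₁ ∩ insert x U₂ = {x, y} := by
    rw [Set.inter_comm, Set.insert_inter_of_mem hA.left_mem, Set.inter_comm, hi]
  have i2 : ∀ U', U' ⊆ ends G C → x ∈ U' → y ∈ U' → U' ∩ U = {x, y} := by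
    intro U' h' hx' hy'
    refine Set.Subset.antisymm (fun z hz => ?_) ?_
    · rw [← hU]; exact ⟨hz.2, h' hz.1⟩
    · rintro z (rfl | rfl)
      exacts [⟨hx', hP.left_mem⟩, ⟨hy', hP.right_mem⟩]
  have d1 : Disjoint A (insert e₀ B) := by
    rw [Set.disjoint_insert_right]
    exact ⟨fun h' => h.notMem (hAB ▸ .inl h'), hA.disjoint_of_inter_subset hB hi.subset⟩
  have hAC : A ⊆ C := hCeq ▸ Set.subset_union_left
  have hBC : insert e₀ B ⊆ C := hCeq ▸ Set.subset_union_right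
  by_cases b1 : A ∪ P ∈ T.balanced
  · exact ⟨_, .balanced_cycle _ b1, Set.subset_union_right, Set.union_subset_union_left _ hAC⟩
  by_cases b2 : insert e₀ B ∪ P ∈ T.balanced
  · exact ⟨_, .balanced_cycle _ b2, Set.subset_union_right, Set.union_subset_union_left _ hBC⟩
  refine ⟨_, .theta A (insert e₀ B) P ⟨x, y, U₁, insert x U₂, U, hxy, isPath_iff.2 hA,
    isPath_iff.2 hB', isPath_iff.2 hP, i1, i2 _ (hUZ ▸ Set.subset_union_left) hA.left_mem hA.right_mem,
    i2 _ (hUZ ▸ Set.subset_union_right) hB'.left_mem hB'.right_mem, d1,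
    hPC.symm.mono_left hAC, hPC.symm.mono_left hBC⟩ (hCeq ▸ hCb) b1 b2, Set.subset_union_right, ?_⟩
  rw [hCeq]

/-- Given unbalanced cycles `C` and `D` and an edge `f` of `D` outside `C`, there is a circuit
through `f` in the union of `C`, `D` and, if both are of frame type and disjoint, a path joining
them. -/
lemma exists_isCircuitSet_of_cycles (hC : IsCycle G C) (hCb : C ∉ T.balanced) (hD : IsCycle G D)
    (hDb : D ∉ T.balanced) (hf : f ∈ D) (hfC : f ∉ C) (hCR : C ⊆ R) (hDR : D ⊆ insert f R)
    (hreach : C ∈ T.frame → D ∈ T.frame → ∃ x ∈ ends G C, ∃ y ∈ ends G D, Reach G R x y) :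
    ∃ K, T.IsCircuitSet K ∧ f ∈ K ∧ K ⊆ insert f R := by
  have hCR' : C ⊆ insert f R := hCR.trans (Set.subset_insert _ _)
  by_cases hdisj : Disjoint (ends G C) (ends G D)
  · rcases T.lift_or_frame hC hCb with hCl | hCf
    · exact ⟨_, .lift_pair C D hCl (T.lift_of_disjoint hCl hD hDb hdisj) hdisj, .inr hf,
        Set.union_subset hCR' hDR⟩
    · have hDf := T.frame_of_disjoint hCf hD hDb hdisj
      obtain ⟨x, hx, y, hy, hr⟩ := hreach hCf hDf
      obtain ⟨U, P, hp, hPR⟩ := hr.exists_path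
      obtain ⟨w, U₁, P₁, -, P₂, p1, -, -, -, rfl, hw⟩ := hp.split_first hy
      obtain ⟨w', U₂, Q₁, U₃, Q₂, q1, -, hUU, -, rfl, hw'⟩ := p1.reverse.split_first hx
      have hwD : U₂ ∩ ends G D = {w} := by
        refine Set.Subset.antisymm (fun z hz => ?_) ?_
        · rw [← hw]; exact ⟨hUU ▸ .inl hz.1, hz.2⟩
        · rintro z rfl
          exact ⟨q1.left_mem, (hw.symm.subset rfl : z ∈ U₁ ∩ ends G D).2⟩
      refine ⟨_, .loose_handcuff C D Q₁ U₂ w' w hCf hDf hdisj (isPath_iff.2 q1.reverse) hw' hwD,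
        .inl (.inr hf), Set.union_subset (Set.union_subset hCR' hDR) ?_⟩
      exact ((Set.subset_union_left.trans Set.subset_union_left).trans hPR).trans
        (Set.subset_insert _ _)
  · obtain ⟨a, b, U, P, h⟩ := hD.exists_rep_edge hf
    obtain ⟨z, hzC, hzD⟩ := Set.not_disjoint_iff.1 hdisj
    have hPR : P ⊆ R := by
      intro g hg
      have : g ∈ insert f R := hDR (h.eq ▸ .inr hg)
      exact this.resolve_left fun h' => h.notMem (h' ▸ hg)
    obtain ⟨U₁, P₁, U₂, P₂, p1, p2, hU, hi, hP⟩ := h.path.split (h.ends_eq ▸ hzD)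
    obtain ⟨s, V₁, Q₁, V₁', Q₁', q1, q1', hV1, hi1, hQ1, hs⟩ := p1.split_first hzC
    obtain ⟨t, V₂, Q₂, V₂', Q₂', q2, q2', hV2, hi2, hQ2, ht⟩ := p2.reverse.split_first hzC
    have hVU1 : V₁ ⊆ U₁ := hV1 ▸ Set.subset_union_left
    have hVU2 : V₂ ⊆ U₂ := hV2 ▸ Set.subset_union_left
    have hQP1 : Q₁ ⊆ P := by rw [← hP, ← hQ1]; exact Set.subset_union_left.trans Set.subset_union_left
    have hQP2 : Q₂ ⊆ P := by rw [← hP, ← hQ2]; exact Set.subset_union_left.trans Set.subset_union_right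
    have hsC : s ∈ ends G C := (hs.symm.subset rfl : s ∈ V₁ ∩ ends G C).2
    have htC : t ∈ ends G C := (ht.symm.subset rfl : t ∈ V₂ ∩ ends G C).2
    have dis : ∀ g, ∀ (V : Set α) (Q : Set β) (c d : α), PathIn G c d V Q → V ∩ ends G C = {d} →
        g ∈ Q → g ∉ C := by
      intro g V Q c d q hd hg hgC
      obtain ⟨u, v, hl⟩ := Graph.exists_isLink_of_mem_edgeSet (q.subset_edgeSet hg)
      exact q.not_both_mem hd.subset hg hl ⟨⟨g, hgC, hl.inc_left⟩, ⟨g, hgC, hl.inc_right⟩⟩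
    by_cases hst : s = t
    · -- `C` and `D` meet in one vertex
      subst hst
      have hsz : s = z := by
        have : s ∈ U₁ ∩ U₂ := ⟨hVU1 q1.right_mem, hVU2 q2.right_mem⟩
        rw [hi] at this
        exact this
      subst hsz
      obtain ⟨rfl, rfl⟩ := q1'.eq_of_self
      obtain ⟨rfl, rfl⟩ := q2'.eq_of_self
      rw [Set.union_eq_self_of_subset_right (by simpa using q1.right_mem)] at hV1
      rw [Set.union_eq_self_of_subset_right (by simpa using q2.right_mem)] at hV2
      rw [Set.union_empty] at hQ1 hQ2
      subst hV1 hV2 hQ1 hQ2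
      refine ⟨_, .tight_handcuff C D hC hD hCb hDb ?_ s ?_, .inr hf, Set.union_subset hCR' hDR⟩
      · rw [Set.disjoint_left]
        intro g hgC hgD
        rw [h.eq, ← hP] at hgD
        rcases hgD with rfl | hg | hg
        · exact hfC hgC
        · exact dis g _ _ _ _ q1 hs hg hgC
        · exact dis g _ _ _ _ q2 ht hg hgC
      · rw [h.ends_eq, ← hU, Set.inter_union_distrib_left, Set.inter_comm, hs,
          Set.inter_comm, ht, Set.union_self]
    · -- the part of `D` around `f` up to `C` is an ear
      have hV12 : ∀ v ∈ V₁, v ∉ V₂ := by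
        intro v h1 h2
        have : v ∈ U₁ ∩ U₂ := ⟨hVU1 h1, hVU2 h2⟩
        rw [hi] at this
        obtain rfl := Set.mem_singleton_iff.1 this
        have k1 : v ∈ V₁ ∩ ends G C := ⟨h1, hzC⟩
        have k2 : v ∈ V₂ ∩ ends G C := ⟨h2, hzC⟩
        rw [hs] at k1
        rw [ht] at k2
        exact hst (k1.symm.trans k2)
      have hp1 : PathIn G b t (insert b V₂) (insert f Q₂) := .cons h.link.symm q2 (hV12 b q1.left_mem)
      have hp2 := q1.reverse.append hp1 (by
        rintro v ⟨h1, rfl | h2⟩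
        · rfl
        · exact absurd h2 (hV12 v h1))
      rw [Set.union_insert, Set.insert_eq_of_mem (.inl q1.left_mem)] at hp2
      obtain ⟨K, hK, hPK, hKs⟩ := exists_isCircuitSet_of_ear hC hCb hp2 hst (by
        rw [Set.union_inter_distrib_right, hs, ht]; rfl) (by
        rw [Set.disjoint_left]
        rintro g (hg | rfl | hg)
        · exact dis g _ _ _ _ q1 hs hg
        · exact hfC
        · exact dis g _ _ _ _ q2 ht hg)
      refine ⟨K, hK, hPK (.inr (.inl rfl)), hKs.trans (Set.union_subset hCR' ?_)⟩
      rintro g (hg | rfl | hg)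
      · exact .inr (hPR (hQP1 hg))
      · exact .inl rfl
      · exact .inr (hPR (hQP2 hg))

/-- If `Q ⊆ S` contains, for each unbalanced cycle `D` of `S`, an unbalanced cycle that lies in the
same component of `S` as `D` if both are of frame type, then a set between `Q` and `S` with the
same components as `S` spans `S`. -/
lemma IsMatroid.subset_closure (hM : T.IsMatroid M) (hS : S ⊆ E(G)) (hRS : R ⊆ S)
    (hQR : Q ⊆ R) (hR : ∀ x ∈ V(G), ∀ y, Reach G S x y → Reach G R x y)
    (hQ : ∀ D, IsCycle G D → D ⊆ S → D ∉ T.balanced → ∃ C ⊆ Q, IsCycle G C ∧ C ∉ T.balanced ∧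
      (C ∈ T.frame → D ∈ T.frame → ∃ x ∈ ends G C, ∃ y ∈ ends G D, Reach G S x y)) :
    S ⊆ M.closure R := by
  intro f hf
  by_cases hfR : f ∈ R
  · exact M.mem_closure_of_mem' hfR (hM.1 ▸ hS hf)
  rw [Matroid.mem_closure_iff_exists_isCircuit hfR]
  obtain ⟨x, y, hl⟩ := Graph.exists_isLink_of_mem_edgeSet (hS hf)
  obtain ⟨D, hD, hfD, hDR, -⟩ :=
    exists_cycle_of_reach hl hfR (hR x hl.left_mem y (.of_link hf hl))
  by_cases hDb : D ∈ T.balanced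
  · exact ⟨D, hDR, (hM.2 D).2 (.balanced_cycle D hDb), hfD⟩
  obtain ⟨C, hCQ, hC, hCb, hCD⟩ := hQ D hD (hDR.trans (Set.insert_subset hf hRS)) hDb
  obtain ⟨K, hK, hfK, hKR⟩ := exists_isCircuitSet_of_cycles hC hCb hD hDb hfD
    (fun h => hfR (hQR (hCQ h))) (hCQ.trans hQR) hDR fun h h' => by
      obtain ⟨u, hu, v, hv, huv⟩ := hCD h h'
      exact ⟨u, hu, v, hv, hR u (ends_subset_vertexSet _ hu) v huv⟩
  exact ⟨K, hKR, (hM.2 K).2 hK, hfK⟩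

variable {W : Set α}

/-- Rank of a set with only balanced cycles. -/
lemma IsMatroid.nrk_balanced [M.RankFinite] (hM : T.IsMatroid M) (hV : V(G).Finite)
    (hS : S ⊆ E(G)) (hbal : ∀ D, IsCycle G D → D ⊆ S → D ∈ T.balanced)
    (hW : IsTransversal G S ∅ W) : nrk M S + W.ncard = V(G).ncard :=
  hM.isPreFramework.nrk_eq_of_balanced hV hS
    (fun C hC hCS => (hM.mem_balanced_iff hC).1 (hbal C hC hCS)) hW

/-- Rank of a set in which the unbalanced cycle `C` is not in a different component from any
frame-type cycle, if `C` itself is of frame type. The set `W` represents the components other than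
that of `C`. -/
lemma IsMatroid.nrk_unbalanced [M.RankFinite] (hM : T.IsMatroid M) (hV : V(G).Finite)
    (hS : S ⊆ E(G)) (hC : IsCycle G C) (hCb : C ∉ T.balanced) (hCS : C ⊆ S)
    (hD : C ∈ T.frame → ∀ D ∈ T.frame, D ⊆ S → ∃ x ∈ ends G C, ∃ y ∈ ends G D, Reach G S x y)
    (hW : IsTransversal G S (ends G C) W) : nrk M S + W.ncard = V(G).ncard := by
  have := hM.isPreFramework.nrk_eq (Q := C) hV hS (ends_subset_vertexSet _) hW hCS
    (subset_edgeSet_induce_ends hC.subset_edgeSet) (fun z hz z' hz' _ => hC.reach hz hz')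
    fun R hRS hCR hR => hM.subset_closure hS hRS hCR hR fun D _ hDS _ =>
      ⟨C, subset_rfl, hC, hCb, fun hCf hDf => hD hCf D hDf hDS⟩
  rw [hM.nrk_cycle hV hC hCb] at this
  omega

/-- Rank of a set with frame-type cycles `C` and `C'` in different components, such that all other
frame-type cycles are in these two components. -/
lemma IsMatroid.nrk_two_frame [M.RankFinite] (hM : T.IsMatroid M) (hV : V(G).Finite)
    (hS : S ⊆ E(G)) {C' : Set β} (hC : C ∈ T.frame) (hC' : C' ∈ T.frame) (hCS : C ⊆ S)
    (hCS' : C' ⊆ S) (hno : ∀ x ∈ ends G C, ∀ y ∈ ends G C', ¬ Reach G S x y)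
    (hD : ∀ D ∈ T.frame, D ⊆ S → (∃ x ∈ ends G C, ∃ y ∈ ends G D, Reach G S x y) ∨
      ∃ x ∈ ends G C', ∃ y ∈ ends G D, Reach G S x y)
    (hW : IsTransversal G S (ends G C ∪ ends G C') W) : nrk M S + W.ncard = V(G).ncard := by
  have cC := isCycle_frame hC
  have cC' := isCycle_frame hC'
  have hdisj : Disjoint (ends G C) (ends G C') := by
    rw [Set.disjoint_left]
    exact fun z hz hz' => hno z hz z hz' (.refl _)
  have hQ : C ∪ C' ⊆ E(G.induce (ends G C ∪ ends G C')) := by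
    rintro e (he | he)
    · obtain ⟨a, b, hl, ha, hb⟩ := subset_edgeSet_induce_ends cC.subset_edgeSet he
      exact ⟨a, b, hl, .inl ha, .inl hb⟩
    · obtain ⟨a, b, hl, ha, hb⟩ := subset_edgeSet_induce_ends cC'.subset_edgeSet he
      exact ⟨a, b, hl, .inr ha, .inr hb⟩
  have := hM.isPreFramework.nrk_eq (Q := C ∪ C') hV hS
    (Set.union_subset (ends_subset_vertexSet _) (ends_subset_vertexSet _)) hW
    (Set.union_subset hCS hCS') hQ (by
      rintro z (hz | hz) z' (hz' | hz') h
      · exact (cC.reach hz hz').mono Set.subset_union_left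
      · exact absurd h (hno z hz z' hz')
      · exact absurd h.symm (hno z' hz' z hz)
      · exact (cC'.reach hz hz').mono Set.subset_union_right)
    fun R hRS hCR hR => hM.subset_closure hS hRS hCR hR fun D hDc hDS hDb => by
      rcases T.lift_or_frame hDc hDb with hl | hf
      · exact ⟨C, Set.subset_union_left, cC, notMem_balanced_of_frame hC, fun _ hf =>
          absurd hf (Set.disjoint_left.1 T.disjoint_lift_frame hl)⟩
      · rcases hD D hf hDS with h | h
        · exact ⟨C, Set.subset_union_left, cC, notMem_balanced_of_frame hC, fun _ _ => h⟩
        · exact ⟨C', Set.subset_union_right, cC', notMem_balanced_of_frame hC', fun _ _ => h⟩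
  rw [hM.nrk_frame_pair hC hC' hdisj] at this
  omega

/-- A set that joins every vertex to one of two disjoint frame-type cycles in it has rank at least
`|V(G)|`. -/
lemma IsMatroid.ncard_le_nrk_of_two_frame [M.RankFinite] (hM : T.IsMatroid M) (hV : V(G).Finite)
    (hS : S ⊆ E(G)) {C' : Set β} (hC : C ∈ T.frame) (hC' : C' ∈ T.frame) (hCS : C ⊆ S)
    (hCS' : C' ⊆ S) (hdisj : Disjoint (ends G C) (ends G C'))
    (hcov : ∀ x ∈ V(G), ∃ w ∈ ends G C ∪ ends G C', Reach G S w x) :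
    V(G).ncard ≤ nrk M S := by
  have hQ : C ∪ C' ⊆ E(G.induce (ends G C ∪ ends G C')) := by
    rintro e (he | he)
    · obtain ⟨a, b, hl, ha, hb⟩ := subset_edgeSet_induce_ends (isCycle_frame hC).subset_edgeSet he
      exact ⟨a, b, hl, .inl ha, .inl hb⟩
    · obtain ⟨a, b, hl, ha, hb⟩ := subset_edgeSet_induce_ends (isCycle_frame hC').subset_edgeSet he
      exact ⟨a, b, hl, .inr ha, .inr hb⟩
  have := hM.isPreFramework.le_nrk hV hS
    (Set.union_subset (ends_subset_vertexSet _) (ends_subset_vertexSet _)) hcov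
    (Set.union_subset hCS hCS') hQ
  rw [hM.nrk_frame_pair hC hC' hdisj] at this
  omega

/-- A set that joins every vertex to an unbalanced cycle in it has rank at least `|V(G)|`. -/
lemma IsMatroid.ncard_le_nrk [M.RankFinite] (hM : T.IsMatroid M) (hV : V(G).Finite)
    (hS : S ⊆ E(G)) (hC : IsCycle G C) (hCb : C ∉ T.balanced) (hCS : C ⊆ S)
    (hcov : ∀ x ∈ V(G), ∃ w ∈ ends G C, Reach G S w x) : V(G).ncard ≤ nrk M S :=
  hM.isPreFramework.ncard_le_nrk_of_cycle hV hS hC hCS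
    (fun h => hCb ((hM.mem_balanced_iff hC).2 h)) hcov

/-- The matroid of a proper tripartition of the cycles of a connected graph has rank at most
`|V(G)|`. -/
lemma IsMatroid.nrk_ground_le [M.RankFinite] (hM : T.IsMatroid M) (hV : V(G).Finite)
    (hG : ∀ x ∈ V(G), ∀ y ∈ V(G), Reach G E(G) x y) : nrk M M.E ≤ V(G).ncard := by
  rw [hM.1]
  by_cases h : ∃ C, IsCycle G C ∧ C ∉ T.balanced
  · obtain ⟨C, hC, hCb⟩ := h
    obtain ⟨W, hW⟩ := exists_isTransversal hV E(G) (ends G C)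
    have := hM.nrk_unbalanced hV subset_rfl hC hCb hC.subset_edgeSet (fun _ D hD _ => by
      obtain ⟨x, hx⟩ := hC.ends_nonempty
      obtain ⟨y, hy⟩ := (isCycle_frame hD).ends_nonempty
      exact ⟨x, hx, y, hy, hG x (ends_subset_vertexSet _ hx) y (ends_subset_vertexSet _ hy)⟩) hW
    omega
  · push Not at h
    obtain ⟨W, hW⟩ := exists_isTransversal hV E(G) ∅
    have := hM.nrk_balanced hV subset_rfl (fun D hD _ => h D hD) hW
    omega

lemma IsMatroid.threeConnected_iff [M.Finite] (hM : T.IsMatroid M)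
    (hV : V(G).Finite) (hG : IsNearlyComplete G) (hn : 6 < V(G).ncard) :
    ThreeConnected M ↔ MatroidSimple M ∧
      ¬ ∃ X, IsBalancingSet G T.balanced X ∧ M.eRk X ≤ 2 :=
  hM.isPreFramework.threeConnected_iff hV hG hn (hM.nrk_ground_le hV (hG.reach (by omega)))
    fun _ hC => hM.mem_balanced_iff hC

end ProperTripartition

end Spanning

/-! ### Each outcome yields two non-spanning sets that cover the ground set -/

section Outcomes

variable {α β : Type*} {G : Graph α β} {T : ProperTripartition G} {M : Matroid β}
  {C D S R H X : Set β} {A W V₁ V₂ V₃ : Set α} {x y a b p q : α} {e f : β}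

lemma Reach.of_forall (h : Reach G S x y)
    (hS : ∀ e ∈ S, ∀ a b, G.IsLink e a b → Reach G R a b) : Reach G R x y := by
  induction h with
  | refl => exact .refl _
  | tail _ h ih =>
    obtain ⟨e, he, hl⟩ := h
    exact ih.trans (hS e he _ _ hl)

/-- Every finite set of edges contains a forest with the same components. -/
lemma exists_forest (G : Graph α β) (hS : S.Finite) :
    ∃ F ⊆ S, (∀ x y, Reach G S x y → Reach G F x y) ∧ ∀ C, IsCycle G C → ¬ C ⊆ F := by
  let 𝓕 : Set (Set β) := {F | F ⊆ S ∧ ∀ x y, Reach G S x y → Reach G F x y}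
  have hfin : 𝓕.Finite := hS.finite_subsets.subset fun F h => h.1
  obtain ⟨F, ⟨hFS, hF⟩, hmin⟩ := hfin.exists_minimal ⟨S, subset_rfl, fun _ _ h => h⟩
  refine ⟨F, hFS, hF, fun C hC hCF => ?_⟩
  obtain ⟨e, he⟩ := hC.nonempty
  obtain ⟨a, b, U, P, h⟩ := hC.exists_rep_edge he
  have hPF : P ⊆ F \ {e} := fun g hg =>
    ⟨hCF (h.eq ▸ .inr hg), fun h' => h.notMem (Set.mem_singleton_iff.1 h' ▸ hg)⟩
  have hab : Reach G (F \ {e}) b a := (h.path.reach a h.path.right_mem).mono hPF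
  have hmem : F \ {e} ∈ 𝓕 := by
    refine ⟨Set.sdiff_subset.trans hFS, fun x y hxy => (hF x y hxy).of_forall ?_⟩
    intro g hg u v hl
    by_cases hge : g = e
    · subst hge
      rcases hl.eq_and_eq_or_eq_and_eq h.link with ⟨rfl, rfl⟩ | ⟨rfl, rfl⟩
      exacts [hab.symm, hab]
    · exact .of_link ⟨hg, hge⟩ hl
  exact (hmin hmem Set.sdiff_subset (hCF he)).2 rfl

/-- A cycle that avoids a balancing set is balanced. -/
lemma IsBalancingSet.mem_of_disjoint {𝓑 : Set (Set β)} (hX : IsBalancingSet G 𝓑 X)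
    (hC : IsCycle G C) (h : Disjoint C X) : C ∈ 𝓑 :=
  hX.2.2 C (isCycle_deleteEdges_iff.2 ⟨hC, h⟩)

lemma IsBalancingSet.mem_of_subset {𝓑 : Set (Set β)} (hX : IsBalancingSet G 𝓑 X)
    (hC : IsCycle G C) (h : C ⊆ E(G) \ X) : C ∈ 𝓑 :=
  hX.mem_of_disjoint hC (Set.subset_sdiff.1 h).2

lemma mem_left_of_mem_ends {A : Set α} (hC : C ⊆ E(G.induce A)) (hx : x ∈ ends G C) : x ∈ A := by
  obtain ⟨e, he, y, hl⟩ := hx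
  exact ((mem_edgeSet_induce hl).1 (hC he)).1

lemma not_reach_of_closed (hx : x ∈ A) (hy : y ∉ A)
    (hA : ∀ e ∈ S, ∀ a b, G.IsLink e a b → a ∈ A → b ∈ A) : ¬ Reach G S x y :=
  fun h => hy (h.mem_of_closed hx hA)

namespace ProperTripartition.IsMatroid

variable [M.Finite]

lemma nrk_lt_of_not_reach (hM : T.IsMatroid M) (hV : V(G).Finite)
    (hS : S ⊆ E(G)) (hC : IsCycle G C) (hCb : C ∉ T.balanced) (hCS : C ⊆ S)
    (hD : C ∈ T.frame → ∀ D ∈ T.frame, D ⊆ S → ∃ x ∈ ends G C, ∃ y ∈ ends G D, Reach G S x y)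
    (hx : x ∈ V(G)) (hy : y ∈ V(G)) (hxy : ¬ Reach G S x y) : nrk M S < V(G).ncard := by
  obtain ⟨W, hW⟩ := exists_isTransversal hV S (ends G C)
  have h1 := hM.nrk_unbalanced hV hS hC hCb hCS hD hW
  have h2 : W.Nonempty := by
    rw [Set.nonempty_iff_ne_empty]
    rintro rfl
    have key : ∀ z ∈ V(G), ∃ w ∈ ends G C, Reach G S w z := fun z hz =>
      (hW.cov z hz).resolve_right (by simp)
    obtain ⟨u, hu, hux⟩ := key x hx
    obtain ⟨v, hv, hvy⟩ := key y hy
    exact hxy (hux.symm.trans (((hC.reach hu hv).mono hCS).trans hvy))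
  have := (Set.ncard_pos (hV.subset hW.subset)).2 h2
  omega

lemma nrk_lt_of_balanced (hM : T.IsMatroid M) (hV : V(G).Finite) (hx : x ∈ V(G))
    (hS : S ⊆ E(G)) (hbal : ∀ C, IsCycle G C → C ⊆ S → C ∈ T.balanced) :
    nrk M S < V(G).ncard :=
  hM.isPreFramework.nrk_lt_of_balanced hV ⟨x, hx⟩ hS fun C hC hCS =>
    (hM.mem_balanced_iff hC).1 (hbal C hC hCS)

lemma nrk_add_one_lt_of_balanced (hM : T.IsMatroid M) (hV : V(G).Finite)
    (hS : S ⊆ E(G)) (hbal : ∀ C, IsCycle G C → C ⊆ S → C ∈ T.balanced)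
    (hx : x ∈ V(G)) (hy : y ∈ V(G)) (hxy : ¬ Reach G S x y) : nrk M S + 1 < V(G).ncard := by
  obtain ⟨W, hW⟩ := exists_isTransversal hV S ∅
  have h1 := hM.nrk_balanced hV hS hbal hW
  have key : ∀ z ∈ V(G), ∃ w ∈ W, Reach G S w z := fun z hz =>
    (hW.cov z hz).resolve_left (by simp)
  obtain ⟨u, hu, hux⟩ := key x hx
  obtain ⟨v, hv, hvy⟩ := key y hy
  have huv : u ≠ v := by
    rintro rfl
    exact hxy (hux.symm.trans hvy)
  have h2 : ({u, v} : Set α).ncard ≤ W.ncard :=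
    Set.ncard_le_ncard (Set.insert_subset hu (by simpa using hv)) (hV.subset hW.subset)
  rw [Set.ncard_pair huv] at h2
  omega

lemma ncard_le_of_two (hM : T.IsMatroid M) (hV : V(G).Finite) (hS : S ⊆ E(G)) (hp : p ∈ V(G))
    (hq : q ∈ V(G)) (hcov : ∀ x ∈ V(G), Reach G S p x ∨ Reach G S q x) :
    V(G).ncard ≤ nrk M S + 2 := by
  have h1 := hM.isPreFramework.le_nrk (Q := ∅) (W := {p, q}) hV hS
    (Set.insert_subset hp (by simpa using hq)) (fun x hx => by
      rcases hcov x hx with h | h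
      exacts [⟨p, by simp, h⟩, ⟨q, by simp, h⟩]) (by simp) (by simp)
  have h2 : ({p, q} : Set α).ncard ≤ 2 := (Set.ncard_insert_le p {q}).trans (by simp)
  have h3 : nrk M ∅ = 0 := by simp [nrk]
  omega

lemma ncard_le_of_three (hM : T.IsMatroid M) (hV : V(G).Finite) (hS : S ⊆ E(G)) (hp : p ∈ V(G))
    (hq : q ∈ V(G)) (ha : a ∈ V(G))
    (hcov : ∀ x ∈ V(G), Reach G S p x ∨ Reach G S q x ∨ Reach G S a x) :
    V(G).ncard ≤ nrk M S + 3 := by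
  have h1 := hM.isPreFramework.le_nrk (Q := ∅) (W := {p, q, a}) hV hS
    (Set.insert_subset hp (Set.insert_subset hq (by simpa using ha))) (fun x hx => by
      rcases hcov x hx with h | h | h
      exacts [⟨p, by simp, h⟩, ⟨q, by simp, h⟩, ⟨a, by simp, h⟩]) (by simp) (by simp)
  have h2 : ({p, q, a} : Set α).ncard ≤ 3 := by
    have h2 := Set.ncard_insert_le p {q, a}
    have h3 := Set.ncard_insert_le q {a}
    have h4 := Set.ncard_singleton a
    omega
  have h3 : nrk M ∅ = 0 := by simp [nrk]
  omega

lemma ncard_le_of_cycle (hM : T.IsMatroid M) (hV : V(G).Finite) (hS : S ⊆ E(G))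
    (hC : IsCycle G C) (hCb : C ∉ T.balanced) (hCS : C ⊆ S) (hp : p ∈ V(G)) (hq : q ∈ V(G))
    (hcov : ∀ x ∈ V(G), (∃ w ∈ ends G C, Reach G S w x) ∨ Reach G S p x ∨ Reach G S q x) :
    V(G).ncard ≤ nrk M S + 2 := by
  have h1 := hM.isPreFramework.le_nrk (Q := C) (W := insert p (insert q (ends G C))) hV hS
    (Set.insert_subset hp (Set.insert_subset hq (ends_subset_vertexSet _))) (fun x hx => by
      rcases hcov x hx with ⟨w, hw, h⟩ | h | h
      exacts [⟨w, by simp [hw], h⟩, ⟨p, by simp, h⟩, ⟨q, by simp, h⟩]) hCS (by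
      intro e he
      obtain ⟨c, d, hl, hc, hd⟩ := subset_edgeSet_induce_ends hC.subset_edgeSet he
      exact ⟨c, d, hl, .inr (.inr hc), .inr (.inr hd)⟩)
  have h2 := Set.ncard_insert_le p (insert q (ends G C))
  have h3 := Set.ncard_insert_le q (ends G C)
  rw [hM.nrk_cycle hV hC hCb] at h1
  omega

lemma nrk_ground_eq (hM : T.IsMatroid M) (hV : V(G).Finite)
    (hG : ∀ x ∈ V(G), ∀ y ∈ V(G), Reach G E(G) x y) (hC : IsCycle G C) (hCb : C ∉ T.balanced) :
    nrk M M.E = V(G).ncard := by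
  refine le_antisymm (hM.nrk_ground_le hV hG) ?_
  rw [hM.1]
  obtain ⟨w, hw⟩ := hC.ends_nonempty
  exact hM.ncard_le_nrk hV subset_rfl hC hCb hC.subset_edgeSet fun x hx =>
    ⟨w, hw, hG w (ends_subset_vertexSet _ hw) x hx⟩

end ProperTripartition.IsMatroid

lemma mem_tripartition (h : IsTripartition G V₁ V₂ V₃) (hx : x ∈ V(G)) :
    x ∈ V₁ ∨ x ∈ V₂ ∨ x ∈ V₃ := by
  rw [← h.1] at hx
  rcases hx with (h | h) | h
  exacts [.inl h, .inr (.inl h), .inr (.inr h)]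

lemma closed_of_induce_union (h12 : Disjoint V₁ V₂) (hS : S ⊆ E(G.induce V₁) ∪ E(G.induce V₂)) :
    ∀ e ∈ S, ∀ a b, G.IsLink e a b → a ∈ V₂ → b ∈ V₂ := by
  intro e he a b hl ha
  rcases hS he with h | h
  · exact absurd ha (Set.disjoint_left.1 h12 ((mem_edgeSet_induce hl).1 h).1)
  · exact ((mem_edgeSet_induce hl).1 h).2

lemma edgeSet_induce_mono {V₁ V₂ : Set α} (h : V₁ ⊆ V₂) : E(G.induce V₁) ⊆ E(G.induce V₂) := by
  rintro e ⟨a, b, hl, ha, hb⟩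
  exact ⟨a, b, hl, h ha, h hb⟩

/-- Without edges between `V₁` and `V₂`, every edge lies in `V₁ ∪ V₃` or in `V₂ ∪ V₃`. -/
lemma mem_induce_or_of_edgesBetween_eq_empty (h : IsTripartition G V₁ V₂ V₃)
    (h12 : edgesBetween G V₁ V₂ = ∅) (he : e ∈ E(G)) :
    e ∈ E(G.induce (V₁ ∪ V₃)) ∨ e ∈ E(G.induce (V₂ ∪ V₃)) := by
  obtain ⟨a, b, hl⟩ := Graph.exists_isLink_of_mem_edgeSet he
  have hno : ∀ a b, G.IsLink e a b → a ∈ V₁ → b ∈ V₂ → False := by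
    intro a b hl ha hb
    have : e ∈ edgesBetween G V₁ V₂ := ⟨a, ha, b, hb, hl⟩
    simp [h12] at this
  rw [mem_edgeSet_induce hl, mem_edgeSet_induce hl]
  rcases mem_tripartition h hl.left_mem with ha | ha | ha <;>
    rcases mem_tripartition h hl.right_mem with hb | hb | hb
  · exact .inl ⟨.inl ha, .inl hb⟩
  · exact (hno a b hl ha hb).elim
  · exact .inl ⟨.inl ha, .inr hb⟩
  · exact (hno b a hl.symm hb ha).elim
  · exact .inr ⟨.inl ha, .inl hb⟩
  · exact .inr ⟨.inl ha, .inr hb⟩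
  · exact .inl ⟨.inr ha, .inl hb⟩
  · exact .inr ⟨.inr ha, .inl hb⟩
  · exact .inl ⟨.inr ha, .inr hb⟩

/-- In a connected graph without edges between `V₁` and `V₂`, the part `V₂ ∪ V₃` induces a
connected subgraph. -/
lemma reach_union (h : IsTripartition G V₁ V₂ V₃) (hG : ∀ x ∈ V(G), ∀ y ∈ V(G), Reach G E(G) x y)
    (h12 : edgesBetween G V₁ V₂ = ∅) (h2 : IsConnected (G.induce V₂))
    (h3 : IsConnected (G.induce V₃)) :
    ∀ x ∈ V₂ ∪ V₃, ∀ y ∈ V₂ ∪ V₃, Reach G E(G.induce (V₂ ∪ V₃)) x y := by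
  rw [isConnected_induce_iff] at h2 h3
  obtain ⟨x₂, hx₂⟩ := h2.1
  obtain ⟨x₃, hx₃⟩ := h3.1
  have hV2 : V₂ ⊆ V(G) := fun z hz => h.1 ▸ .inl (.inr hz)
  have hV3 : V₃ ⊆ V(G) := fun z hz => h.1 ▸ .inr hz
  obtain ⟨e, he, a, b, hl, ha, hb⟩ := exists_link_of_reach (hG x₂ (hV2 hx₂) x₃ (hV3 hx₃)) hx₂
    (fun h' => Set.disjoint_left.1 h.2.2.2 h' hx₃)
  have hb3 : b ∈ V₃ := by
    rcases mem_tripartition h hl.right_mem with h' | h' | h'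
    · have : e ∈ edgesBetween G V₁ V₂ := ⟨b, h', a, ha, hl.symm⟩
      simp [h12] at this
    · exact absurd h' hb
    · exact h'
  have key : ∀ x ∈ V₂ ∪ V₃, Reach G E(G.induce (V₂ ∪ V₃)) x b := by
    rintro x (hx | hx)
    · exact ((h2.2 x hx a ha).mono (edgeSet_induce_mono Set.subset_union_left)).trans
        (.of_link ((mem_edgeSet_induce hl).2 ⟨.inl ha, .inr hb3⟩) hl)
    · exact (h3.2 x hx b hb3).mono (edgeSet_induce_mono Set.subset_union_right)
  exact fun x hx y hy => (key x hx).trans (key y hy).symm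

section Backward

variable [M.Finite]

/-- The two sets consist of the edges inside `V₁ ∪ V₃` and `V₂`, and inside `V₂ ∪ V₃` and `V₁`. -/
lemma OutcomeOne.not_unbreakable (h : OutcomeOne T) (hM : T.IsMatroid M) (hV : V(G).Finite)
    (hG : ∀ x ∈ V(G), ∀ y ∈ V(G), Reach G E(G) x y) : ¬ Unbreakable M := by
  obtain ⟨V₁, V₂, V₃, hp, c1, c2, c3, h12, hcase⟩ := h
  rw [isConnected_induce_iff] at c1 c2 c3
  obtain ⟨x₁, hx₁⟩ := c1.1
  obtain ⟨x₂, hx₂⟩ := c2.1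
  obtain ⟨x₃, hx₃⟩ := c3.1
  have s1 : x₁ ∈ V(G) := hp.1 ▸ .inl (.inl hx₁)
  have s2 : x₂ ∈ V(G) := hp.1 ▸ .inl (.inr hx₂)
  have s3 : x₃ ∈ V(G) := hp.1 ▸ .inr hx₃
  set H₁ := E(G.induce (V₁ ∪ V₃)) ∪ E(G.induce V₂) with hH₁
  set H₂ := E(G.induce (V₂ ∪ V₃)) ∪ E(G.induce V₁) with hH₂
  have e1 : H₁ ⊆ E(G) := Set.union_subset edgeSet_induce_subset edgeSet_induce_subset
  have e2 : H₂ ⊆ E(G) := Set.union_subset edgeSet_induce_subset edgeSet_induce_subset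
  have hun : H₁ ∪ H₂ = M.E := by
    rw [hM.1]
    refine (Set.union_subset e1 e2).antisymm fun e he => ?_
    rcases mem_induce_or_of_edgesBetween_eq_empty hp h12 he with h | h
    exacts [.inl (.inl h), .inr (.inl h)]
  have n1 : ¬ Reach G H₁ x₂ x₁ := not_reach_of_closed hx₂ (fun h => Set.disjoint_left.1 hp.2.1 hx₁ h)
    (closed_of_induce_union (Set.disjoint_union_left.2 ⟨hp.2.1, hp.2.2.2.symm⟩) subset_rfl)
  have n2 : ¬ Reach G H₂ x₁ x₂ := not_reach_of_closed hx₁ (fun h => Set.disjoint_left.1 hp.2.1 h hx₂)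
    (closed_of_induce_union (Set.disjoint_union_left.2 ⟨hp.2.1.symm, hp.2.2.1.symm⟩) subset_rfl)
  have i1 : E(G.induce V₁) ⊆ H₁ ∩ H₂ := fun e he =>
    ⟨.inl (edgeSet_induce_mono Set.subset_union_left he), .inr he⟩
  have i2 : E(G.induce V₂) ⊆ H₁ ∩ H₂ := fun e he =>
    ⟨.inr he, .inl (edgeSet_induce_mono Set.subset_union_left he)⟩
  have i3 : E(G.induce V₃) ⊆ H₁ ∩ H₂ := fun e he =>
    ⟨.inl (edgeSet_induce_mono Set.subset_union_right he),
      .inl (edgeSet_induce_mono Set.subset_union_right he)⟩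
  have r1 : ∀ u ∈ V₁, ∀ x ∈ V₁, Reach G (H₁ ∩ H₂) u x := fun u hu x hx => (c1.2 u hu x hx).mono i1
  have r2 : ∀ u ∈ V₂, ∀ x ∈ V₂, Reach G (H₁ ∩ H₂) u x := fun u hu x hx => (c2.2 u hu x hx).mono i2
  have r3 : ∀ u ∈ V₃, ∀ x ∈ V₃, Reach G (H₁ ∩ H₂) u x := fun u hu x hx => (c3.2 u hu x hx).mono i3
  have hIE : H₁ ∩ H₂ ⊆ E(G) := Set.inter_subset_left.trans e1
  rcases hcase with hcase | hbal
  · obtain ⟨C, hC, hCI, p, q, hpV, hqV, hcov⟩ : ∃ C ∈ T.lift, C ⊆ H₁ ∩ H₂ ∧ ∃ p q, p ∈ V(G) ∧ q ∈ V(G) ∧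
        ∀ x ∈ V(G), (∃ w ∈ ends G C, Reach G (H₁ ∩ H₂) w x) ∨ Reach G (H₁ ∩ H₂) p x ∨
          Reach G (H₁ ∩ H₂) q x := by
      rcases hcase with ⟨C, hC, hCs⟩ | ⟨C, hC, hCs⟩ | ⟨C, hC, hCs⟩
      · obtain ⟨w, hw⟩ := (T.isCycle_lift hC).ends_nonempty
        have hw' := mem_left_of_mem_ends hCs hw
        refine ⟨C, hC, hCs.trans i1, x₂, x₃, s2, s3, fun x hx => ?_⟩
        rcases mem_tripartition hp hx with h | h | h
        exacts [.inl ⟨w, hw, r1 w hw' x h⟩, .inr (.inl (r2 _ hx₂ x h)), .inr (.inr (r3 _ hx₃ x h))]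
      · obtain ⟨w, hw⟩ := (T.isCycle_lift hC).ends_nonempty
        have hw' := mem_left_of_mem_ends hCs hw
        refine ⟨C, hC, hCs.trans i2, x₁, x₃, s1, s3, fun x hx => ?_⟩
        rcases mem_tripartition hp hx with h | h | h
        exacts [.inr (.inl (r1 _ hx₁ x h)), .inl ⟨w, hw, r2 w hw' x h⟩, .inr (.inr (r3 _ hx₃ x h))]
      · obtain ⟨w, hw⟩ := (T.isCycle_lift hC).ends_nonempty
        have hw' := mem_left_of_mem_ends hCs hw
        refine ⟨C, hC, hCs.trans i3, x₁, x₂, s1, s2, fun x hx => ?_⟩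
        rcases mem_tripartition hp hx with h | h | h
        exacts [.inr (.inl (r1 _ hx₁ x h)), .inr (.inr (r2 _ hx₂ x h)), .inl ⟨w, hw, r3 w hw' x h⟩]
    have cC := T.isCycle_lift hC
    have hCb := T.notMem_balanced_of_lift hC
    have hCf : C ∉ T.frame := Set.disjoint_left.1 T.disjoint_lift_frame hC
    have hr := hM.nrk_ground_eq hV hG cC hCb
    have k1 := hM.nrk_lt_of_not_reach hV e1 cC hCb (hCI.trans Set.inter_subset_left)
      (fun h => absurd h hCf) s2 s1 n1
    have k2 := hM.nrk_lt_of_not_reach hV e2 cC hCb (hCI.trans Set.inter_subset_right)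
      (fun h => absurd h hCf) s1 s2 n2
    have k3 := hM.ncard_le_of_cycle hV hIE cC hCb hCI hpV hqV hcov
    exact not_unbreakable_of_cover hun (by omega) (by omega) (by omega)
  · have hr := hM.nrk_lt_of_balanced hV s1 subset_rfl (fun C hC _ => hbal C hC)
    have hr' : V(G).ncard ≤ nrk M E(G) + 1 := by
      have := hM.isPreFramework.le_nrk (Q := ∅) (W := {x₁}) hV subset_rfl (by simpa using s1)
        (fun x hx => ⟨x₁, rfl, hG x₁ s1 x hx⟩) (by simp) (by simp)
      rw [Set.ncard_singleton] at this
      simpa [nrk] using this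
    have k1 := hM.nrk_add_one_lt_of_balanced hV e1 (fun C hC _ => hbal C hC) s2 s1 n1
    have k2 := hM.nrk_add_one_lt_of_balanced hV e2 (fun C hC _ => hbal C hC) s1 s2 n2
    have k3 := hM.ncard_le_of_three hV hIE s1 s2 s3 fun x hx => by
      rcases mem_tripartition hp hx with h | h | h
      exacts [.inl (r1 _ hx₁ x h), .inr (.inl (r2 _ hx₂ x h)), .inr (.inr (r3 _ hx₃ x h))]
    rw [← hM.1] at hr hr'
    exact not_unbreakable_of_cover hun (by omega) (by omega) (by omega)

/-- The two sets are the complements of the two balancing sets. -/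
lemma OutcomeTwo.not_unbreakable (h : OutcomeTwo T) (hM : T.IsMatroid M) (hV : V(G).Finite)
    (hG : ∀ x ∈ V(G), ∀ y ∈ V(G), Reach G E(G) x y) : ¬ Unbreakable M := by
  obtain ⟨V₁, V₂, hp, c1, c2, X, Y, hXY, hd, hX, hY⟩ := h
  rw [isConnected_induce_iff] at c1 c2
  obtain ⟨x₁, hx₁⟩ := c1.1
  obtain ⟨x₂, hx₂⟩ := c2.1
  have s1 : x₁ ∈ V(G) := hp.1 ▸ .inl hx₁
  have s2 : x₂ ∈ V(G) := hp.1 ▸ .inr hx₂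
  obtain ⟨C, hC, hCb⟩ := hX.2.1
  have hr := hM.nrk_ground_eq hV hG hC hCb
  have hnot : ∀ e, (e ∈ E(G.induce V₁) ∨ e ∈ E(G.induce V₂)) → e ∉ X ∪ Y := by
    intro e he hXe
    rw [hXY] at hXe
    obtain ⟨a, ha, b, hb, hl⟩ := hXe
    rw [mem_edgeSet_induce hl, mem_edgeSet_induce hl] at he
    rcases he with he | he
    · exact Set.disjoint_left.1 hp.2 he.2 hb
    · exact Set.disjoint_left.1 hp.2 ha he.1
  have hi : ∀ e, (e ∈ E(G.induce V₁) ∨ e ∈ E(G.induce V₂)) → e ∈ (E(G) \ X) ∩ (E(G) \ Y) := by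
    intro e he
    have heE : e ∈ E(G) := by rcases he with he | he <;> exact edgeSet_induce_subset he
    exact ⟨⟨heE, fun h => hnot e he (.inl h)⟩, ⟨heE, fun h => hnot e he (.inr h)⟩⟩
  refine not_unbreakable_of_cover (H₁ := E(G) \ X) (H₂ := E(G) \ Y) ?_ ?_ ?_ ?_
  · rw [hM.1]
    refine (Set.union_subset Set.sdiff_subset Set.sdiff_subset).antisymm fun e he => ?_
    by_cases heX : e ∈ X
    · exact .inr ⟨he, Set.disjoint_left.1 hd heX⟩
    · exact .inl ⟨he, heX⟩
  · rw [hr]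
    exact hM.nrk_lt_of_balanced hV s1 Set.sdiff_subset fun D hD hDX => hX.mem_of_subset hD hDX
  · rw [hr]
    exact hM.nrk_lt_of_balanced hV s1 Set.sdiff_subset fun D hD hDY => hY.mem_of_subset hD hDY
  · rw [hr]
    refine hM.ncard_le_of_two hV (Set.inter_subset_left.trans Set.sdiff_subset) s1 s2 fun x hx => ?_
    rw [← hp.1] at hx
    rcases hx with hx | hx
    · exact .inl ((c1.2 _ hx₁ x hx).mono fun e he => hi e (.inl he))
    · exact .inr ((c2.2 _ hx₂ x hx).mono fun e he => hi e (.inr he))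

/-- The two sets are the complement of `X` and the set of edges inside `V₁` or inside `V₂`. Every
unbalanced cycle meets `V₁`, so the second set has no two frame-type cycles in different
components. -/
lemma OutcomeThree.not_unbreakable (h : OutcomeThree T) (hM : T.IsMatroid M) (hV : V(G).Finite)
    (hG : ∀ x ∈ V(G), ∀ y ∈ V(G), Reach G E(G) x y) : ¬ Unbreakable M := by
  obtain ⟨V₁, V₂, X, hp, hX, hXV, c1, c2⟩ := h
  rw [isConnected_induce_deleteEdges_iff] at c1
  rw [isConnected_induce_iff] at c2
  obtain ⟨x₁, hx₁⟩ := c1.1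
  obtain ⟨x₂, hx₂⟩ := c2.1
  have s1 : x₁ ∈ V(G) := hp.1 ▸ .inl hx₁
  have s2 : x₂ ∈ V(G) := hp.1 ▸ .inr hx₂
  obtain ⟨C, hC, hCb⟩ := hX.2.1
  have hr := hM.nrk_ground_eq hV hG hC hCb
  set H := E(G.induce V₁) ∪ E(G.induce V₂) with hH
  have hHE : H ⊆ E(G) := Set.union_subset edgeSet_induce_subset edgeSet_induce_subset
  have hcl := closed_of_induce_union (G := G) (S := H) hp.2 subset_rfl
  have meet : ∀ D, IsCycle G D → D ∉ T.balanced → ∃ x ∈ ends G D, x ∈ V₁ := by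
    intro D hD hDb
    obtain ⟨e, heD, heX⟩ := Set.not_disjoint_iff.1 fun h => hDb (hX.mem_of_disjoint hD h)
    obtain ⟨a, b, hl, ha, hb⟩ := hXV heX
    exact ⟨a, ⟨e, heD, hl.inc_left⟩, ha⟩
  refine not_unbreakable_of_cover (H₁ := E(G) \ X) (H₂ := H) ?_ ?_ ?_ ?_
  · rw [hM.1]
    refine (Set.union_subset Set.sdiff_subset hHE).antisymm fun e he => ?_
    by_cases heX : e ∈ X
    · exact .inr (.inl (hXV heX))
    · exact .inl ⟨he, heX⟩
  · rw [hr]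
    exact hM.nrk_lt_of_balanced hV s1 Set.sdiff_subset fun D hD hDX => hX.mem_of_subset hD hDX
  · rw [hr]
    by_cases hbal : ∀ D, IsCycle G D → D ⊆ H → D ∈ T.balanced
    · exact hM.nrk_lt_of_balanced hV s1 hHE hbal
    push Not at hbal
    obtain ⟨D, hD, hDH, hDb⟩ := hbal
    refine hM.nrk_lt_of_not_reach hV hHE hD hDb hDH (fun _ D' hD' _ => ?_) s2 s1
      (not_reach_of_closed hx₂ (fun h => Set.disjoint_left.1 hp.2 hx₁ h) hcl)
    obtain ⟨x, hx, hxV⟩ := meet D hD hDb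
    obtain ⟨y, hy, hyV⟩ := meet D' (T.isCycle_frame hD') (T.notMem_balanced_of_frame hD')
    exact ⟨x, hx, y, hy, (c1.2 x hxV y hyV).mono (Set.sdiff_subset.trans Set.subset_union_left)⟩
  · rw [hr]
    refine hM.ncard_le_of_two hV (Set.inter_subset_right.trans hHE) s1 s2 fun x hx => ?_
    rw [← hp.1] at hx
    rcases hx with hx | hx
    · exact .inl ((c1.2 _ hx₁ x hx).mono fun e he =>
        ⟨⟨edgeSet_induce_subset he.1, he.2⟩, .inl he.1⟩)
    · refine .inr ((c2.2 _ hx₂ x hx).mono fun e he => ⟨⟨edgeSet_induce_subset he, fun heX => ?_⟩, .inr he⟩)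
      obtain ⟨a, b, hl, ha, hb⟩ := hXV heX
      exact Set.disjoint_left.1 hp.2 ha ((mem_edgeSet_induce hl).1 he).1

/-- If some edge outside `X` joins `V₁` to `V₃`, merging these parts gives `OutcomeThree`. Otherwise
the two sets consist of the edges inside `V₁ ∪ V₃` and `V₂`, and of those outside `X` or inside
`V₃`. -/
lemma OutcomeThreePrime.not_unbreakable (h : OutcomeThreePrime T) (hM : T.IsMatroid M)
    (hV : V(G).Finite) (hG : ∀ x ∈ V(G), ∀ y ∈ V(G), Reach G E(G) x y) : ¬ Unbreakable M := by
  obtain ⟨V₁, V₂, V₃, X, hp, hX, hXV, c1, c2, c3, ⟨C, hC, hCV⟩, h23⟩ := h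
  have c2' := c2
  rw [isConnected_induce_deleteEdges_iff] at c1 c3
  rw [isConnected_induce_iff] at c2
  obtain ⟨x₁, hx₁⟩ := c1.1
  obtain ⟨x₂, hx₂⟩ := c2.1
  obtain ⟨x₃, hx₃⟩ := c3.1
  have s1 : x₁ ∈ V(G) := hp.1 ▸ .inl (.inl hx₁)
  have s2 : x₂ ∈ V(G) := hp.1 ▸ .inl (.inr hx₂)
  have s3 : x₃ ∈ V(G) := hp.1 ▸ .inr hx₃
  by_cases hcon : ∃ e ∈ E(G) \ X, ∃ a ∈ V₁, ∃ b ∈ V₃, G.IsLink e a b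
  · -- merging `V₁` and `V₃` gives the previous outcome
    obtain ⟨e, he, a, ha, b, hb, hl⟩ := hcon
    refine OutcomeThree.not_unbreakable (T := T) ⟨V₁ ∪ V₃, V₂, X, ⟨?_, ?_⟩, hX, hXV, ?_, c2'⟩ hM hV hG
    · rw [← hp.1, Set.union_right_comm]
    · exact Set.disjoint_union_left.2 ⟨hp.2.1, hp.2.2.2.symm⟩
    · rw [isConnected_induce_deleteEdges_iff]
      have key : ∀ x ∈ V₁ ∪ V₃, Reach G (E(G.induce (V₁ ∪ V₃)) \ X) x b := by
        rintro x (hx | hx)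
        · refine ((c1.2 x hx a ha).mono ?_).trans
            (.of_link ⟨(mem_edgeSet_induce hl).2 ⟨.inl ha, .inr hb⟩, he.2⟩ hl)
          exact Set.sdiff_subset_sdiff_left (edgeSet_induce_mono Set.subset_union_left)
        · exact (c3.2 x hx b hb).mono
            (Set.sdiff_subset_sdiff_left (edgeSet_induce_mono Set.subset_union_right))
      exact ⟨⟨x₁, .inl hx₁⟩, fun x hx y hy => (key x hx).trans (key y hy).symm⟩
  push Not at hcon
  have cC := T.isCycle_frame hC
  have hCb := T.notMem_balanced_of_frame hC
  have hr := hM.nrk_ground_eq hV hG cC hCb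
  obtain ⟨w, hw⟩ := cC.ends_nonempty
  have hwV : w ∈ V₃ := mem_left_of_mem_ends hCV hw
  have hp' : IsTripartition G V₂ V₃ V₁ := by
    refine ⟨?_, hp.2.2.2, hp.2.1.symm, hp.2.2.1.symm⟩
    rw [← hp.1]; ext; simp only [Set.mem_union]; tauto
  have no23 : ∀ e a b, G.IsLink e a b → a ∈ V₂ → b ∈ V₃ → False := by
    intro e a b hl ha hb
    have : e ∈ edgesBetween G V₂ V₃ := ⟨a, ha, b, hb, hl⟩
    simp [h23] at this
  have conn13 := reach_union hp' hG h23
    (isConnected_induce_iff.2 ⟨c3.1, fun x hx y hy => (c3.2 x hx y hy).mono Set.sdiff_subset⟩)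
    (isConnected_induce_iff.2 ⟨c1.1, fun x hx y hy => (c1.2 x hx y hy).mono Set.sdiff_subset⟩)
  rw [Set.union_comm V₃ V₁] at conn13
  set H₁ := E(G.induce (V₁ ∪ V₃)) ∪ E(G.induce V₂) with hH₁
  set H₂ := (E(G) \ X) ∪ E(G.induce V₃) with hH₂
  have e1 : H₁ ⊆ E(G) := Set.union_subset edgeSet_induce_subset edgeSet_induce_subset
  have e2 : H₂ ⊆ E(G) := Set.union_subset Set.sdiff_subset edgeSet_induce_subset
  have hX2 : ∀ e ∈ E(G.induce V₂), e ∉ X := by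
    intro e he heX
    obtain ⟨a, b, hl, ha, hb⟩ := he
    rcases ((mem_edgeSet_induce hl).1 (hXV heX)).1 with h | h
    · exact Set.disjoint_left.1 hp.2.1 h ha
    · exact Set.disjoint_left.1 hp.2.2.2 ha h
  have hC3 : C ⊆ H₁ ∩ H₂ := fun e he =>
    ⟨.inl (edgeSet_induce_mono Set.subset_union_right (hCV he)), .inr (hCV he)⟩
  refine not_unbreakable_of_cover (H₁ := H₁) (H₂ := H₂) ?_ ?_ ?_ ?_
  · rw [hM.1]
    refine (Set.union_subset e1 e2).antisymm fun e he => ?_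
    by_cases heX : e ∈ X
    · exact .inl (.inl (hXV heX))
    · exact .inr (.inl ⟨he, heX⟩)
  · rw [hr]
    refine hM.nrk_lt_of_not_reach hV e1 cC hCb (hC3.trans Set.inter_subset_left)
      (fun _ D hD _ => ?_) s2 s1
      (not_reach_of_closed hx₂ (fun h => Set.disjoint_left.1 hp.2.1 hx₁ h)
        (closed_of_induce_union (Set.disjoint_union_left.2 ⟨hp.2.1, hp.2.2.2.symm⟩) subset_rfl))
    obtain ⟨e, heD, heX⟩ := Set.not_disjoint_iff.1 fun h =>
      T.notMem_balanced_of_frame hD (hX.mem_of_disjoint (T.isCycle_frame hD) h)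
    obtain ⟨a, b, hl, ha, hb⟩ := hXV heX
    exact ⟨w, hw, a, ⟨e, heD, hl.inc_left⟩,
      (conn13 w (.inr hwV) a ha).mono Set.subset_union_left⟩
  · rw [hr]
    refine hM.nrk_lt_of_not_reach hV e2 cC hCb (hC3.trans Set.inter_subset_right)
      (fun _ D hD hDH => ?_) s3 s1
      (not_reach_of_closed hx₃ (fun h => Set.disjoint_left.1 hp.2.2.1 hx₁ h) ?_)
    · obtain ⟨e, heD, heX⟩ := Set.not_disjoint_iff.1 fun h =>
        T.notMem_balanced_of_frame hD (hX.mem_of_disjoint (T.isCycle_frame hD) h)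
      obtain ⟨a, b, hl, ha, hb⟩ := (hDH heD).resolve_left fun h => h.2 heX
      exact ⟨w, hw, a, ⟨e, heD, hl.inc_left⟩,
        (c3.2 w hwV a ha).mono (Set.sdiff_subset.trans Set.subset_union_right)⟩
    · rintro e (he | he) a b hl ha
      · rcases mem_tripartition hp hl.right_mem with h | h | h
        · exact absurd hl.symm (hcon e he b h a ha)
        · exact (no23 e b a hl.symm h ha).elim
        · exact h
      · exact ((mem_edgeSet_induce hl).1 he).2
  · rw [hr]
    refine hM.ncard_le_of_cycle hV (Set.inter_subset_left.trans e1) cC hCb hC3 s1 s2 fun x hx => ?_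
    rcases mem_tripartition hp hx with h | h | h
    · exact .inr (.inl ((c1.2 _ hx₁ x h).mono fun e he =>
        ⟨.inl (edgeSet_induce_mono Set.subset_union_left he.1),
          .inl ⟨edgeSet_induce_subset he.1, he.2⟩⟩))
    · exact .inr (.inr ((c2.2 _ hx₂ x h).mono fun e he =>
        ⟨.inr he, .inl ⟨edgeSet_induce_subset he, hX2 e he⟩⟩))
    · exact .inl ⟨w, hw, (c3.2 w hwV x h).mono fun e he =>
        ⟨.inl (edgeSet_induce_mono Set.subset_union_right he.1), .inr he.1⟩⟩

/-- The two sets are the complement of `X` and the set of edges inside `V₁` or inside `V₂`. -/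
lemma OutcomeFour.not_unbreakable (h : OutcomeFour T) (hM : T.IsMatroid M) (hV : V(G).Finite)
    (hG : ∀ x ∈ V(G), ∀ y ∈ V(G), Reach G E(G) x y) : ¬ Unbreakable M := by
  obtain ⟨V₁, V₂, X, hp, hX, hXV, c1, c2, ⟨C, hC, hCV⟩, -⟩ := h
  rw [isConnected_induce_deleteEdges_iff] at c1 c2
  obtain ⟨x₁, hx₁⟩ := c1.1
  obtain ⟨x₂, hx₂⟩ := c2.1
  have s1 : x₁ ∈ V(G) := hp.1 ▸ .inl hx₁
  have s2 : x₂ ∈ V(G) := hp.1 ▸ .inr hx₂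
  have cC := T.isCycle_lift hC
  have hCb := T.notMem_balanced_of_lift hC
  have hr := hM.nrk_ground_eq hV hG cC hCb
  have hHE : E(G.induce V₁) ∪ E(G.induce V₂) ⊆ E(G) :=
    Set.union_subset edgeSet_induce_subset edgeSet_induce_subset
  refine not_unbreakable_of_cover (H₁ := E(G) \ X) (H₂ := E(G.induce V₁) ∪ E(G.induce V₂)) ?_ ?_ ?_ ?_
  · rw [hM.1]
    refine (Set.union_subset Set.sdiff_subset hHE).antisymm fun e he => ?_
    by_cases heX : e ∈ X
    · exact .inr (hXV heX)
    · exact .inl ⟨he, heX⟩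
  · rw [hr]
    exact hM.nrk_lt_of_balanced hV s1 Set.sdiff_subset fun D hD hDX => hX.mem_of_subset hD hDX
  · rw [hr]
    exact hM.nrk_lt_of_not_reach hV hHE cC hCb (hCV.trans Set.subset_union_left)
      (fun h => absurd h (Set.disjoint_left.1 T.disjoint_lift_frame hC)) s2 s1
      (not_reach_of_closed hx₂ (fun h => Set.disjoint_left.1 hp.2 hx₁ h)
        (closed_of_induce_union hp.2 subset_rfl))
  · rw [hr]
    refine hM.ncard_le_of_two hV (Set.inter_subset_right.trans hHE) s1 s2 fun x hx => ?_
    rw [← hp.1] at hx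
    rcases hx with hx | hx
    · exact .inl ((c1.2 _ hx₁ x hx).mono fun e he =>
        ⟨⟨edgeSet_induce_subset he.1, he.2⟩, .inl he.1⟩)
    · exact .inr ((c2.2 _ hx₂ x hx).mono fun e he =>
        ⟨⟨edgeSet_induce_subset he.1, he.2⟩, .inr he.1⟩)

/-- The two sets consist of the edges inside `V₂ ∪ V₃` and a spanning forest of `V₁`, and of those
inside `V₁ ∪ V₃` and a spanning forest of `V₂`; the forests keep all frame-type cycles in the
component of `V₃`. -/
lemma OutcomeFive.not_unbreakable (h : OutcomeFive T) (hM : T.IsMatroid M) (hV : V(G).Finite)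
    (hG : ∀ x ∈ V(G), ∀ y ∈ V(G), Reach G E(G) x y) : ¬ Unbreakable M := by
  obtain ⟨V₁, V₂, V₃, hp, c1, c2, c3, h12, C, hC, hCV⟩ := h
  have hp' : IsTripartition G V₂ V₁ V₃ :=
    ⟨by rw [← hp.1, Set.union_comm V₂ V₁], hp.2.1.symm, hp.2.2.2, hp.2.2.1⟩
  have h21 : edgesBetween G V₂ V₁ = ∅ := by
    rw [Set.eq_empty_iff_forall_notMem] at h12 ⊢
    rintro e ⟨a, ha, b, hb, hl⟩
    exact h12 e ⟨b, hb, a, ha, hl.symm⟩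
  have conn23 := reach_union hp hG h12 c2 c3
  have conn13 := reach_union hp' hG h21 c1 c3
  rw [isConnected_induce_iff] at c1 c2 c3
  obtain ⟨x₁, hx₁⟩ := c1.1
  obtain ⟨x₂, hx₂⟩ := c2.1
  have s1 : x₁ ∈ V(G) := hp.1 ▸ .inl (.inl hx₁)
  have s2 : x₂ ∈ V(G) := hp.1 ▸ .inl (.inr hx₂)
  have cC := T.isCycle_frame hC
  have hCb := T.notMem_balanced_of_frame hC
  have hr := hM.nrk_ground_eq hV hG cC hCb
  obtain ⟨w, hw⟩ := cC.ends_nonempty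
  have hwV : w ∈ V₃ := mem_left_of_mem_ends hCV hw
  have fin : ∀ V' : Set α, E(G.induce V').Finite := fun V' =>
    (hM.1 ▸ M.ground_finite).subset edgeSet_induce_subset
  obtain ⟨F₁, hF₁, hF₁r, hF₁c⟩ := exists_forest G (fin V₁)
  obtain ⟨F₂, hF₂, hF₂r, hF₂c⟩ := exists_forest G (fin V₂)
  -- a hyperplane that contains all edges except some of those that meet the part `A`
  have hyp : ∀ (A B : Set α) (F : Set β), Disjoint B A → V₃ ⊆ B → F ⊆ E(G.induce A) →
      (∀ C, IsCycle G C → ¬ C ⊆ F) → (∀ x ∈ B, ∀ y ∈ B, Reach G E(G.induce B) x y) →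
      (∃ x ∈ A, x ∈ V(G)) → w ∈ B → nrk M (E(G.induce B) ∪ F) < V(G).ncard := by
    rintro A B F hBA hVB hF hFc hB ⟨x, hxA, hxV⟩ hwB
    refine hM.nrk_lt_of_not_reach hV
      (Set.union_subset edgeSet_induce_subset (hF.trans edgeSet_induce_subset)) cC hCb
      ((hCV.trans (edgeSet_induce_mono hVB)).trans Set.subset_union_left) (fun _ D hD hDs => ?_)
      hxV (ends_subset_vertexSet _ hw) (not_reach_of_closed hxA
        (fun h => Set.disjoint_left.1 hBA hwB h)
        (closed_of_induce_union hBA (Set.union_subset_union_right _ hF)))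
    obtain ⟨e, heD, heF⟩ : ∃ e ∈ D, e ∉ F := by
      by_contra! hcon
      exact hFc D (T.isCycle_frame hD) hcon
    obtain ⟨a, b, hl, ha, hb⟩ := (hDs heD).resolve_right heF
    exact ⟨w, hw, a, ⟨e, heD, hl.inc_left⟩, (hB w hwB a ha).mono Set.subset_union_left⟩
  refine not_unbreakable_of_cover (H₁ := E(G.induce (V₂ ∪ V₃)) ∪ F₁)
    (H₂ := E(G.induce (V₁ ∪ V₃)) ∪ F₂) ?_ ?_ ?_ ?_
  · rw [hM.1]
    refine (Set.union_subset
      (Set.union_subset edgeSet_induce_subset (hF₁.trans edgeSet_induce_subset))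
      (Set.union_subset edgeSet_induce_subset (hF₂.trans edgeSet_induce_subset))).antisymm
      fun e he => ?_
    rcases mem_induce_or_of_edgesBetween_eq_empty hp h12 he with h | h
    exacts [.inr (.inl h), .inl (.inl h)]
  · rw [hr]
    exact hyp V₁ _ F₁ (Set.disjoint_union_left.2 ⟨hp.2.1.symm, hp.2.2.1.symm⟩)
      Set.subset_union_right hF₁ hF₁c conn23 ⟨x₁, hx₁, s1⟩ (.inr hwV)
  · rw [hr]
    exact hyp V₂ _ F₂ (Set.disjoint_union_left.2 ⟨hp.2.1, hp.2.2.2.symm⟩)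
      Set.subset_union_right hF₂ hF₂c conn13 ⟨x₂, hx₂, s2⟩ (.inr hwV)
  · rw [hr]
    have i3 : E(G.induce V₃) ⊆
        (E(G.induce (V₂ ∪ V₃)) ∪ F₁) ∩ (E(G.induce (V₁ ∪ V₃)) ∪ F₂) := fun e he =>
      ⟨.inl (edgeSet_induce_mono Set.subset_union_right he),
        .inl (edgeSet_induce_mono Set.subset_union_right he)⟩
    refine hM.ncard_le_of_cycle hV (Set.inter_subset_left.trans
      (Set.union_subset edgeSet_induce_subset (hF₁.trans edgeSet_induce_subset))) cC hCb
      (hCV.trans i3) s1 s2 fun x hx => ?_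
    rcases mem_tripartition hp hx with h | h | h
    · exact .inr (.inl ((hF₁r _ _ (c1.2 _ hx₁ x h)).mono fun e he =>
        ⟨.inr he, .inl (edgeSet_induce_mono Set.subset_union_left (hF₁ he))⟩))
    · exact .inr (.inr ((hF₂r _ _ (c2.2 _ hx₂ x h)).mono fun e he =>
        ⟨.inl (edgeSet_induce_mono Set.subset_union_left (hF₂ he)), .inr he⟩))
    · exact .inl ⟨w, hw, (c3.2 w hwV x h).mono i3⟩

end Backward

end Outcomes

/-! ### From a pair of hyperplanes to an outcome -/

section Forward

variable {α β : Type*} {G : Graph α β} {T : ProperTripartition G} {M : Matroid β}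
  {C C' D S R F H H₁ H₂ X : Set β} {A B W V₁ V₂ V₃ : Set α} {x y z a b : α} {e f : β}

/-- `A` is the vertex set of a component of the spanning subgraph of `G` with edge set `F`. -/
structure IsPart (G : Graph α β) (F : Set β) (A : Set α) : Prop where
  subset : A ⊆ V(G)
  nonempty : A.Nonempty
  closed : ∀ e ∈ F, ∀ a b, G.IsLink e a b → a ∈ A → b ∈ A
  reach : ∀ x ∈ A, ∀ y ∈ A, Reach G F x y

lemma isPart_setOf_reach (hx : x ∈ V(G)) : IsPart G F {y | Reach G F x y} :=
  ⟨fun _ h => h.mem_vertexSet hx, ⟨x, .refl _⟩, fun _ he _ _ hl h => h.trans (.of_link he hl),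
    fun _ hy _ hz => hy.symm.trans hz⟩

namespace IsPart

lemma reach_induce (h : IsPart G F A) (hx : x ∈ A) (hy : y ∈ A) :
    Reach G (F ∩ E(G.induce A)) x y := by
  have key : ∀ z, Reach G F x z → z ∈ A ∧ Reach G (F ∩ E(G.induce A)) x z := by
    intro z hz
    induction hz with
    | refl => exact ⟨hx, .refl _⟩
    | tail _ hl ih =>
      obtain ⟨e, he, hl⟩ := hl
      have := h.closed e he _ _ hl ih.1
      exact ⟨this, ih.2.trans (.of_link ⟨he, (mem_edgeSet_induce hl).2 ⟨ih.1, this⟩⟩ hl)⟩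
  exact (key y (h.reach x hx y hy)).2

lemma isConnected_deleteEdges (h : IsPart G F A) (hX : Disjoint (F ∩ E(G.induce A)) X) :
    IsConnected ((G.induce A).deleteEdges X) :=
  isConnected_induce_deleteEdges_iff.2 ⟨h.nonempty, fun _ hx _ hy =>
    (h.reach_induce hx hy).mono fun _ he => ⟨he.2, Set.disjoint_left.1 hX he⟩⟩

lemma isConnected (h : IsPart G F A) : IsConnected (G.induce A) :=
  isConnected_induce_iff.2 ⟨h.nonempty, fun _ hx _ hy =>
    (h.reach_induce hx hy).mono Set.inter_subset_right⟩

lemma cycle_subset (h : IsPart G F A) (hC : IsCycle G C) (hCF : C ⊆ F) (hx : x ∈ ends G C)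
    (hxA : x ∈ A) : C ⊆ E(G.induce A) := by
  intro e he
  obtain ⟨a, b, hl⟩ := Graph.exists_isLink_of_mem_edgeSet (hC.subset_edgeSet he)
  have ha : a ∈ A := ((hC.reach hx ⟨e, he, hl.inc_left⟩).mono hCF).mem_of_closed hxA h.closed
  exact (mem_edgeSet_induce hl).2 ⟨ha, h.closed e (hCF he) a b hl ha⟩

/-- Two components of `F` that are joined by an edge of `H ⊇ F` lie in one component of `H`. -/
lemma reach_of_edgesBetween (hA : IsPart G F A) (hB : IsPart G F B) (hFH : F ⊆ H)
    (h : (H ∩ edgesBetween G A B).Nonempty) : ∀ x ∈ A, ∀ y ∈ B, Reach G H x y := by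
  obtain ⟨e, heH, a, ha, b, hb, hl⟩ := h
  exact fun x hx y hy => (((hA.reach x hx a ha).mono hFH).trans (.of_link heH hl)).trans
    ((hB.reach b hb y hy).mono hFH)

/-- An edge that joins two vertices of a component of a flat `F`, but is not in `F`, lies in an
unbalanced cycle of that component: a balanced cycle would put the edge into the closure of `F`. -/
lemma exists_cycle (hA : IsPart G F A) (hM : T.IsMatroid M) (hF : M.IsFlat F)
    (he : e ∈ E(G.induce A)) (heF : e ∉ F) :
    ∃ D, IsCycle G D ∧ D ∉ T.balanced ∧ D ⊆ insert e F ∧ D ⊆ E(G.induce A) := by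
  obtain ⟨a, b, hl, ha, hb⟩ := id he
  obtain ⟨D, hD, heD, hDs, -⟩ :=
    exists_cycle_of_reach hl (fun h => heF h.1) (hA.reach_induce ha hb)
  refine ⟨D, hD, fun hDb => heF ?_, hDs.trans (Set.insert_subset_insert Set.inter_subset_left),
    hDs.trans (Set.insert_subset he Set.inter_subset_right)⟩
  have := ((hM.mem_balanced_iff hD).1 hDb).mem_closure_sdiff_singleton_of_mem heD
  rw [← hF.closure]
  exact M.closure_subset_closure (fun g hg => ((hDs hg.1).resolve_left hg.2).1) this

end IsPart

lemma edgesBetween_comm (G : Graph α β) (A B : Set α) :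
    edgesBetween G A B = edgesBetween G B A := by
  ext e
  constructor <;> rintro ⟨a, ha, b, hb, hl⟩ <;> exact ⟨b, hb, a, ha, hl.symm⟩

lemma IsTripartition.swap (h : IsTripartition G V₁ V₂ V₃) : IsTripartition G V₂ V₁ V₃ :=
  ⟨by rw [← h.1, Set.union_comm V₂], h.2.1.symm, h.2.2.2, h.2.2.1⟩

lemma IsTripartition.rotate (h : IsTripartition G V₁ V₂ V₃) : IsTripartition G V₂ V₃ V₁ :=
  ⟨by rw [← h.1, Set.union_comm, Set.union_assoc], h.2.2.2, h.2.1.symm, h.2.2.1.symm⟩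

lemma isTripartition_of_reach (hx : x ∈ V(G)) (hy : y ∈ V(G)) (hz : z ∈ V(G))
    (hxy : ¬ Reach G F x y) (hxz : ¬ Reach G F x z) (hyz : ¬ Reach G F y z)
    (hcov : ∀ v ∈ V(G), Reach G F x v ∨ Reach G F y v ∨ Reach G F z v) :
    IsTripartition G {v | Reach G F x v} {v | Reach G F y v} {v | Reach G F z v} := by
  have disj : ∀ u v, ¬ Reach G F u v → Disjoint {w | Reach G F u w} {w | Reach G F v w} :=
    fun u v h => Set.disjoint_left.2 fun w hu hv => h (hu.trans hv.symm)
  refine ⟨Set.Subset.antisymm ?_ fun v hv => ?_, disj _ _ hxy, disj _ _ hxz, disj _ _ hyz⟩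
  · exact Set.union_subset (Set.union_subset (isPart_setOf_reach hx).subset
      (isPart_setOf_reach hy).subset) (isPart_setOf_reach hz).subset
  · rcases hcov v hv with h | h | h
    exacts [.inl (.inl h), .inl (.inr h), .inr h]

/-- If `H` contains an edge between `V₁` and `V₂` and one between `V₂` and `V₃`, it joins all
vertices. -/
lemma IsTripartition.reach (h : IsTripartition G V₁ V₂ V₃) (h1 : IsPart G F V₁)
    (h2 : IsPart G F V₂) (h3 : IsPart G F V₃) (hFH : F ⊆ H)
    (h12 : (H ∩ edgesBetween G V₁ V₂).Nonempty) (h23 : (H ∩ edgesBetween G V₂ V₃).Nonempty) :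
    ∀ x ∈ V(G), ∀ y ∈ V(G), Reach G H x y := by
  obtain ⟨v, hv⟩ := h2.nonempty
  have key : ∀ x ∈ V(G), Reach G H x v := by
    intro x hx
    rcases mem_tripartition h hx with hx | hx | hx
    · exact h1.reach_of_edgesBetween h2 hFH h12 x hx v hv
    · exact (h2.reach x hx v hv).mono hFH
    · exact (h2.reach_of_edgesBetween h3 hFH h23 v hv x hx).symm
  exact fun x hx y hy => (key x hx).trans (key y hy).symm

/-- If two sets that cover `E(G)` both fail to join all vertices, then some two of the three
common components have no edge between them: otherwise one of the two sets contains edges between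
two of the three pairs. -/
lemma IsTripartition.edgesBetween_eq_empty (h : IsTripartition G V₁ V₂ V₃)
    (hun : E(G) ⊆ H₁ ∪ H₂) (h1 : IsPart G (H₁ ∩ H₂) V₁) (h2 : IsPart G (H₁ ∩ H₂) V₂)
    (h3 : IsPart G (H₁ ∩ H₂) V₃) (n1 : ¬ ∀ x ∈ V(G), ∀ y ∈ V(G), Reach G H₁ x y)
    (n2 : ¬ ∀ x ∈ V(G), ∀ y ∈ V(G), Reach G H₂ x y) :
    edgesBetween G V₁ V₂ = ∅ ∨ edgesBetween G V₂ V₃ = ∅ ∨ edgesBetween G V₃ V₁ = ∅ := by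
  by_contra! hcon
  obtain ⟨⟨e, he⟩, ⟨f, hf⟩, ⟨g, hg⟩⟩ := hcon
  have mem : ∀ {A B : Set α} {e}, e ∈ edgesBetween G A B → e ∈ H₁ ∨ e ∈ H₂ := by
    rintro A B e ⟨_, _, _, _, hl⟩
    exact hun hl.edge_mem
  have i1 : H₁ ∩ H₂ ⊆ H₁ := Set.inter_subset_left
  have i2 : H₁ ∩ H₂ ⊆ H₂ := Set.inter_subset_right
  rcases mem he with he' | he' <;> rcases mem hf with hf' | hf'
  · exact n1 (h.reach h1 h2 h3 i1 ⟨e, he', he⟩ ⟨f, hf', hf⟩)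
  · rcases mem hg with hg' | hg'
    · exact n1 (h.rotate.rotate.reach h3 h1 h2 i1 ⟨g, hg', hg⟩ ⟨e, he', he⟩)
    · exact n2 (h.rotate.reach h2 h3 h1 i2 ⟨f, hf', hf⟩ ⟨g, hg', hg⟩)
  · rcases mem hg with hg' | hg'
    · exact n1 (h.rotate.reach h2 h3 h1 i1 ⟨f, hf', hf⟩ ⟨g, hg', hg⟩)
    · exact n2 (h.rotate.rotate.reach h3 h1 h2 i2 ⟨g, hg', hg⟩ ⟨e, he', he⟩)
  · exact n2 (h.reach h1 h2 h3 i2 ⟨e, he', he⟩ ⟨f, hf', hf⟩)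

lemma IsTripartition.outcomeOne (h : IsTripartition G V₁ V₂ V₃)
    (h1 : IsPart G F V₁) (h2 : IsPart G F V₂) (h3 : IsPart G F V₃)
    (hempty : edgesBetween G V₁ V₂ = ∅ ∨ edgesBetween G V₂ V₃ = ∅ ∨ edgesBetween G V₃ V₁ = ∅)
    (hc : ContainsCycleIn G V₃ T.lift ∨ ∀ C, IsCycle G C → C ∈ T.balanced) : OutcomeOne T := by
  rcases hempty with h' | h' | h'
  · exact ⟨_, _, _, h, h1.isConnected, h2.isConnected, h3.isConnected, h',
      hc.imp_left fun h => .inr (.inr h)⟩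
  · exact ⟨_, _, _, h.rotate, h2.isConnected, h3.isConnected, h1.isConnected, h',
      hc.imp_left fun h => .inr (.inl h)⟩
  · exact ⟨_, _, _, h.rotate.rotate, h3.isConnected, h1.isConnected, h2.isConnected, h',
      hc.imp_left .inl⟩

/-- An edge that joins two vertex-disjoint frame-type cycles in a flat completes a loose handcuff,
so it belongs to the flat. -/
lemma ProperTripartition.IsMatroid.not_adj_of_frame (hM : T.IsMatroid M) (hF : M.IsFlat F)
    (hC : C ∈ T.frame) (hC' : C' ∈ T.frame) (hCF : C ⊆ F) (hCF' : C' ⊆ F)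
    (hno : ∀ x ∈ ends G C, ∀ y ∈ ends G C', ¬ Reach G F x y) (hx : x ∈ ends G C)
    (hy : y ∈ ends G C') : ¬ G.Adj x y := by
  rintro ⟨f, hl⟩
  have hdisj : Disjoint (ends G C) (ends G C') :=
    Set.disjoint_left.2 fun z hz hz' => hno z hz z hz' (.refl _)
  have hxy : x ≠ y := fun h => Set.disjoint_left.1 hdisj hx (h ▸ hy)
  have hpath : IsPath G x y {x, y} {f} := by
    rw [isPath_iff]
    simpa using PathIn.cons hl (.nil y) (by simpa using hxy)
  have hxU : ({x, y} : Set α) ∩ ends G C = {x} := by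
    ext z
    simp only [Set.mem_inter_iff, Set.mem_insert_iff, Set.mem_singleton_iff]
    constructor
    · rintro ⟨rfl | rfl, hz⟩
      exacts [rfl, absurd hy (Set.disjoint_left.1 hdisj hz)]
    · rintro rfl
      exact ⟨.inl rfl, hx⟩
  have hyU : ({x, y} : Set α) ∩ ends G C' = {y} := by
    ext z
    simp only [Set.mem_inter_iff, Set.mem_insert_iff, Set.mem_singleton_iff]
    constructor
    · rintro ⟨rfl | rfl, hz⟩
      exacts [absurd hz (Set.disjoint_left.1 hdisj hx), rfl]
    · rintro rfl
      exact ⟨.inr rfl, hy⟩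
  have hK := (hM.2 _).2
    (ProperTripartition.IsCircuitSet.loose_handcuff C C' {f} _ x y hC hC' hdisj hpath hxU hyU)
  have hf := hK.mem_closure_sdiff_singleton_of_mem (e := f) (.inr rfl)
  have hfF : f ∈ F := by
    rw [← hF.closure]
    refine M.closure_subset_closure ?_ hf
    rintro g ⟨(h | h) | h, hg⟩
    exacts [hCF h, hCF' h, absurd h hg]
  exact hno x hx y hy (.of_link hfF hl)

namespace HyperplanePair

lemma subset_left (p : HyperplanePair M H₁ H₂) (hM : T.IsMatroid M) : H₁ ⊆ E(G) :=
  hM.1 ▸ p.flat_left.subset_ground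

lemma isFlat_inter (p : HyperplanePair M H₁ H₂) : M.IsFlat (H₁ ∩ H₂) :=
  QuasiGraphic.isFlat_inter p.flat_left p.flat_right

lemma mem_or_mem (p : HyperplanePair M H₁ H₂) (hM : T.IsMatroid M) (he : e ∈ E(G)) :
    e ∈ H₁ ∨ e ∈ H₂ := by
  have : e ∈ H₁ ∪ H₂ := by rw [p.union_eq, hM.1]; exact he
  exact this

variable [M.Finite]

/-- A hyperplane that joins all vertices contains no unbalanced cycle. -/
lemma balanced_of_reach (p : HyperplanePair M H₁ H₂) (hM : T.IsMatroid M) (hV : V(G).Finite)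
    (hr : nrk M M.E = V(G).ncard) (h : ∀ x ∈ V(G), ∀ y ∈ V(G), Reach G H₁ x y)
    (hC : IsCycle G C) (hCH : C ⊆ H₁) : C ∈ T.balanced := by
  by_contra hCb
  obtain ⟨w, hw⟩ := hC.ends_nonempty
  have := hM.ncard_le_nrk hV (p.subset_left hM) hC hCb hCH fun x hx =>
    ⟨w, hw, h w (ends_subset_vertexSet _ hw) x hx⟩
  have := p.nrk_left
  omega

/-- If every vertex lay in the component of one of two disjoint frame-type cycles of `H₁`, the
hyperplane `H₁` would have full rank. -/
lemma not_cover (p : HyperplanePair M H₁ H₂) (hM : T.IsMatroid M) (hV : V(G).Finite)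
    (hr : nrk M M.E = V(G).ncard) (hC : C ∈ T.frame) (hC' : C' ∈ T.frame) (hCH : C ⊆ H₁)
    (hCH' : C' ⊆ H₁) (hdisj : Disjoint (ends G C) (ends G C')) :
    ¬ ∀ x ∈ V(G), ∃ w ∈ ends G C ∪ ends G C', Reach G H₁ w x := by
  intro h
  have := hM.ncard_le_nrk_of_two_frame hV (p.subset_left hM) hC hC' hCH hCH' hdisj h
  have := p.nrk_left
  omega

/-- If every cycle of `G` is balanced, then `r(M) = |V(G)| - 1` and `H₁ ∩ H₂` has three components. -/
lemma outcomeOne_of_balanced (p : HyperplanePair M H₁ H₂) (hM : T.IsMatroid M)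
    (hV : V(G).Finite) (hne : V(G).Nonempty) (hG : ∀ x ∈ V(G), ∀ y ∈ V(G), Reach G E(G) x y)
    (hbal : ∀ C, IsCycle G C → C ∈ T.balanced) : OutcomeOne T := by
  obtain ⟨v, hv⟩ := hne
  have hr := hM.nrk_lt_of_balanced hV hv subset_rfl fun C hC _ => hbal C hC
  have span : ∀ S ⊆ E(G), (∀ x ∈ V(G), ∀ y ∈ V(G), Reach G S x y) →
      V(G).ncard ≤ nrk M S + 1 := by
    intro S hS h
    have := hM.isPreFramework.le_nrk (Q := ∅) (W := {v}) hV hS (by simpa using hv)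
      (fun x hx => ⟨v, rfl, h v hv x hx⟩) (by simp) (by simp)
    rw [Set.ncard_singleton] at this
    simpa [nrk] using this
  have hr' := span _ subset_rfl hG
  have h1 := p.nrk_left
  have h2 := p.nrk_right
  have h3 := p.nrk_inter
  rw [hM.1] at h1 h2 h3
  obtain ⟨W, hW⟩ := exists_isTransversal hV (H₁ ∩ H₂) ∅
  have hWn := hM.nrk_balanced hV (Set.inter_subset_left.trans (p.subset_left hM))
    (fun C hC _ => hbal C hC) hW
  obtain ⟨x, y, z, hxy, hxz, hyz, rfl⟩ := Set.ncard_eq_three.1 (show W.ncard = 3 by omega)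
  have hx : x ∈ V(G) := hW.subset (by simp)
  have hy : y ∈ V(G) := hW.subset (by simp)
  have hz : z ∈ V(G) := hW.subset (by simp)
  have hp : IsTripartition G _ _ _ := isTripartition_of_reach (F := H₁ ∩ H₂) hx hy hz
    (fun h => hxy (hW.inj x (by simp) y (by simp) h))
    (fun h => hxz (hW.inj x (by simp) z (by simp) h))
    (fun h => hyz (hW.inj y (by simp) z (by simp) h)) (fun v hv => by
      obtain ⟨w, hw, h⟩ := (hW.cov v hv).resolve_left (by simp)
      rcases hw with rfl | rfl | rfl
      exacts [.inl h, .inr (.inl h), .inr (.inr h)])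
  refine hp.outcomeOne (isPart_setOf_reach hx) (isPart_setOf_reach hy) (isPart_setOf_reach hz)
    (hp.edgesBetween_eq_empty (fun e he => p.mem_or_mem hM he) (isPart_setOf_reach hx)
      (isPart_setOf_reach hy) (isPart_setOf_reach hz) (fun h => ?_) fun h => ?_) (.inr hbal)
  · have := span H₁ (p.subset_left hM) h
    omega
  · have := span H₂ (p.symm.subset_left hM) h
    omega

/-- Suppose that `H₁` contains only balanced cycles and `H₂` has no edge between the two components
`V₁`, `V₂` of `H₁ ∩ H₂`. Then `X = E(G) ∖ H₁` is a balancing set inside the two components. If it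
meets both, each of them contains an unbalanced cycle of `H₂`, and these two cycles are of lift type
since otherwise `H₂` would have full rank. -/
lemma outcome_of_cross (p : HyperplanePair M H₁ H₂) (hM : T.IsMatroid M) (hV : V(G).Finite)
    (hr : nrk M M.E = V(G).ncard) (hunb : ∃ C, IsCycle G C ∧ C ∉ T.balanced)
    (hp : IsBipartition G V₁ V₂) (h1 : IsPart G (H₁ ∩ H₂) V₁) (h2 : IsPart G (H₁ ∩ H₂) V₂)
    (hbal : ∀ C, IsCycle G C → C ⊆ H₁ → C ∈ T.balanced)
    (hno : ¬ (H₂ ∩ edgesBetween G V₁ V₂).Nonempty) : OutcomeThree T ∨ OutcomeFour T := by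
  have hX : IsBalancingSet G T.balanced (E(G) \ H₁) := by
    refine ⟨Set.sdiff_subset, hunb, fun C hC => ?_⟩
    obtain ⟨hC, hd⟩ := isCycle_deleteEdges_iff.1 hC
    refine hbal C hC fun e he => ?_
    by_contra heH
    exact Set.disjoint_left.1 hd he ⟨hC.subset_edgeSet he, heH⟩
  have hXH : ∀ e ∈ E(G) \ H₁, e ∈ H₂ := fun e he => (p.mem_or_mem hM he.1).resolve_left he.2
  have hXV : E(G) \ H₁ ⊆ E(G.induce V₁) ∪ E(G.induce V₂) := by
    intro e he
    have heH := hXH e he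
    obtain ⟨a, b, hl⟩ := Graph.exists_isLink_of_mem_edgeSet he.1
    have ha : a ∈ V₁ ∪ V₂ := hp.1 ▸ hl.left_mem
    have hb : b ∈ V₁ ∪ V₂ := hp.1 ▸ hl.right_mem
    rcases ha with ha | ha <;> rcases hb with hb | hb
    · exact .inl ((mem_edgeSet_induce hl).2 ⟨ha, hb⟩)
    · exact absurd ⟨e, heH, a, ha, b, hb, hl⟩ hno
    · exact absurd ⟨e, heH, b, hb, a, ha, hl.symm⟩ hno
    · exact .inr ((mem_edgeSet_induce hl).2 ⟨ha, hb⟩)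
  have hd : ∀ A : Set α, Disjoint (H₁ ∩ H₂ ∩ E(G.induce A)) (E(G) \ H₁) := fun A =>
    Set.disjoint_left.2 fun e he he' => he'.2 he.1.1
  by_cases hX1 : E(G) \ H₁ ⊆ E(G.induce V₁)
  · exact .inl ⟨V₁, V₂, _, hp, hX, hX1, h1.isConnected_deleteEdges (hd _), h2.isConnected⟩
  by_cases hX2 : E(G) \ H₁ ⊆ E(G.induce V₂)
  · exact .inl ⟨V₂, V₁, _, ⟨by rw [Set.union_comm]; exact hp.1, hp.2.symm⟩, hX, hX2,
      h2.isConnected_deleteEdges (hd _), h1.isConnected⟩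
  obtain ⟨e₂, he₂, hn₂⟩ := Set.not_subset.1 hX1
  obtain ⟨e₁, he₁, hn₁⟩ := Set.not_subset.1 hX2
  obtain ⟨D₁, cD₁, hb₁, hs₁, hi₁⟩ :=
    h1.exists_cycle hM p.isFlat_inter ((hXV he₁).resolve_right hn₁) fun h => he₁.2 h.1
  obtain ⟨D₂, cD₂, hb₂, hs₂, hi₂⟩ :=
    h2.exists_cycle hM p.isFlat_inter ((hXV he₂).resolve_left hn₂) fun h => he₂.2 h.1
  have hdisj : Disjoint (ends G D₁) (ends G D₂) := Set.disjoint_left.2 fun v hv hv' =>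
    Set.disjoint_left.1 hp.2 (mem_left_of_mem_ends hi₁ hv) (mem_left_of_mem_ends hi₂ hv')
  rcases T.lift_or_frame cD₁ hb₁ with hl | hf
  · exact .inr ⟨V₁, V₂, _, hp, hX, hXV, h1.isConnected_deleteEdges (hd _),
      h2.isConnected_deleteEdges (hd _), ⟨D₁, hl, hi₁⟩,
      ⟨D₂, T.lift_of_disjoint hl cD₂ hb₂ hdisj, hi₂⟩⟩
  · exfalso
    obtain ⟨w₁, hw₁⟩ := cD₁.ends_nonempty
    obtain ⟨w₂, hw₂⟩ := cD₂.ends_nonempty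
    refine p.symm.not_cover hM hV hr hf (T.frame_of_disjoint hf cD₂ hb₂ hdisj)
      (hs₁.trans (Set.insert_subset (hXH _ he₁) Set.inter_subset_right))
      (hs₂.trans (Set.insert_subset (hXH _ he₂) Set.inter_subset_right)) hdisj fun x hx => ?_
    rw [← hp.1] at hx
    rcases hx with hx | hx
    · exact ⟨w₁, .inl hw₁,
        (h1.reach _ (mem_left_of_mem_ends hi₁ hw₁) x hx).mono Set.inter_subset_right⟩
    · exact ⟨w₂, .inr hw₂,
        (h2.reach _ (mem_left_of_mem_ends hi₂ hw₂) x hx).mono Set.inter_subset_right⟩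

/-- If every cycle of `H₁ ∩ H₂` is balanced, this flat has two components. If both hyperplanes have an
edge between these, their complements are balancing sets that partition the edges between them; if
only one has, `outcome_of_cross` applies. -/
lemma outcome_of_balanced_inter (p : HyperplanePair M H₁ H₂) (hM : T.IsMatroid M)
    (hV : V(G).Finite) (hG : ∀ x ∈ V(G), ∀ y ∈ V(G), Reach G E(G) x y)
    (hr : nrk M M.E = V(G).ncard) (hunb : ∃ C, IsCycle G C ∧ C ∉ T.balanced)
    (hbal : ∀ C, IsCycle G C → C ⊆ H₁ ∩ H₂ → C ∈ T.balanced) :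
    OutcomeTwo T ∨ OutcomeThree T ∨ OutcomeFour T := by
  obtain ⟨W, hW⟩ := exists_isTransversal hV (H₁ ∩ H₂) ∅
  have hWn := hM.nrk_balanced hV (Set.inter_subset_left.trans (p.subset_left hM)) hbal hW
  have hFn := p.nrk_inter
  obtain ⟨x, y, hxy, rfl⟩ := Set.ncard_eq_two.1 (show W.ncard = 2 by omega)
  have hx : x ∈ V(G) := hW.subset (by simp)
  have hy : y ∈ V(G) := hW.subset (by simp)
  have h1 : IsPart G (H₁ ∩ H₂) _ := isPart_setOf_reach hx
  have h2 : IsPart G (H₁ ∩ H₂) _ := isPart_setOf_reach hy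
  have hp : IsBipartition G {v | Reach G (H₁ ∩ H₂) x v} {v | Reach G (H₁ ∩ H₂) y v} := by
    refine ⟨(Set.union_subset h1.subset h2.subset).antisymm fun v hv => ?_,
      Set.disjoint_left.2 fun v hv hv' =>
        hxy (hW.inj x (by simp) y (by simp) (hv.trans hv'.symm))⟩
    obtain ⟨w, hw, h⟩ := (hW.cov v hv).resolve_left (by simp)
    rcases hw with rfl | rfl
    exacts [.inl h, .inr h]
  generalize {v | Reach G (H₁ ∩ H₂) x v} = V₁ at h1 hp
  generalize {v | Reach G (H₁ ∩ H₂) y v} = V₂ at h2 hp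
  -- a hyperplane with an edge between the two components joins all vertices
  have cross : ∀ {K K'}, HyperplanePair M K K' → K ∩ K' = H₁ ∩ H₂ →
      (K ∩ edgesBetween G V₁ V₂).Nonempty → ∀ C, IsCycle G C → C ⊆ K → C ∈ T.balanced := by
    intro K K' q hK hne C hC hCK
    have hFK : H₁ ∩ H₂ ⊆ K := hK ▸ Set.inter_subset_left
    have r := h1.reach_of_edgesBetween h2 hFK hne
    refine q.balanced_of_reach hM hV hr (fun u hu v hv => ?_) hC hCK
    rw [← hp.1] at hu hv
    rcases hu with hu | hu <;> rcases hv with hv | hv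
    exacts [(h1.reach u hu v hv).mono hFK, r u hu v hv, (r v hv u hu).symm,
      (h2.reach u hu v hv).mono hFK]
  have hcomm := Set.inter_comm H₂ H₁
  by_cases c1 : (H₁ ∩ edgesBetween G V₁ V₂).Nonempty
  · by_cases c2 : (H₂ ∩ edgesBetween G V₁ V₂).Nonempty
    · have b1 := cross p rfl c1
      have b2 := cross p.symm hcomm c2
      have inF : ∀ A, IsPart G (H₁ ∩ H₂) A → ∀ e ∈ E(G.induce A), e ∈ H₁ ∩ H₂ := by
        intro A hA e he
        by_contra heF
        obtain ⟨D, cD, hDb, hDs, -⟩ := hA.exists_cycle hM p.isFlat_inter he heF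
        rcases p.mem_or_mem hM (edgeSet_induce_subset he) with h | h
        · exact hDb (b1 D cD (hDs.trans (Set.insert_subset h Set.inter_subset_left)))
        · exact hDb (b2 D cD (hDs.trans (Set.insert_subset h Set.inter_subset_right)))
      have bal : ∀ K, (∀ C, IsCycle G C → C ⊆ K → C ∈ T.balanced) →
          IsBalancingSet G T.balanced (E(G) \ K) := by
        refine fun K hK => ⟨Set.sdiff_subset, hunb, fun C hC => ?_⟩
        obtain ⟨hC, hd⟩ := isCycle_deleteEdges_iff.1 hC
        refine hK C hC fun e he => ?_
        by_contra heH
        exact Set.disjoint_left.1 hd he ⟨hC.subset_edgeSet he, heH⟩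
      refine .inl ⟨V₁, V₂, hp, h1.isConnected, h2.isConnected, E(G) \ H₁, E(G) \ H₂, ?_,
        Set.disjoint_left.2 fun e he he' => (p.mem_or_mem hM he.1).elim he.2 he'.2,
        bal _ b1, bal _ b2⟩
      rw [← Set.sdiff_inter]
      refine Set.Subset.antisymm ?_ ?_
      · rintro e ⟨he, heF⟩
        obtain ⟨a, b, hl⟩ := Graph.exists_isLink_of_mem_edgeSet he
        have ha : a ∈ V₁ ∪ V₂ := hp.1 ▸ hl.left_mem
        have hb : b ∈ V₁ ∪ V₂ := hp.1 ▸ hl.right_mem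
        rcases ha with ha | ha <;> rcases hb with hb | hb
        · exact absurd (inF _ h1 e ((mem_edgeSet_induce hl).2 ⟨ha, hb⟩)) heF
        · exact ⟨a, ha, b, hb, hl⟩
        · exact ⟨b, hb, a, ha, hl.symm⟩
        · exact absurd (inF _ h2 e ((mem_edgeSet_induce hl).2 ⟨ha, hb⟩)) heF
      · rintro e ⟨a, ha, b, hb, hl⟩
        exact ⟨hl.edge_mem, fun heF =>
          Set.disjoint_left.1 hp.2 (h1.closed e heF a b hl ha) hb⟩
    · exact .inr (p.outcome_of_cross hM hV hr hunb hp h1 h2 (cross p rfl c1) c2)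
  · obtain ⟨u, hu⟩ := h1.nonempty
    obtain ⟨v, hv⟩ := h2.nonempty
    obtain ⟨e, he, a, b, hl, ha, hb⟩ := exists_link_of_reach (hG u (h1.subset hu) v (h2.subset hv))
      hu fun h => Set.disjoint_left.1 hp.2 h hv
    have heB : e ∈ edgesBetween G V₁ V₂ :=
      ⟨a, ha, b, (hp.1.symm.subset hl.right_mem).resolve_left hb, hl⟩
    have heH : e ∈ H₂ := (p.mem_or_mem hM he).resolve_left fun h => c1 ⟨e, h, heB⟩
    exact .inr (p.symm.outcome_of_cross hM hV hr hunb hp (hcomm.symm ▸ h1) (hcomm.symm ▸ h2)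
      (cross p.symm hcomm ⟨e, heH, heB⟩) c1)

/-- In a nearly complete graph, any two frame-type cycles in `H₁ ∩ H₂` lie in the same component.
Otherwise all edges between the two components are missing, since such an edge would complete a
loose handcuff and hence belong to the flat `H₁ ∩ H₂`. So there is no third component with a
frame-type cycle, there are exactly two other components, and three edges join these two and one
of the first two pairwise. Two of the three edges lie in the same hyperplane, which then has full
rank. -/
lemma exists_reach_of_frame (p : HyperplanePair M H₁ H₂) (hM : T.IsMatroid M)
    (hV : V(G).Finite) (hG : IsNearlyComplete G) (hr : nrk M M.E = V(G).ncard)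
    (hC : C ∈ T.frame) (hC' : C' ∈ T.frame) (hCF : C ⊆ H₁ ∩ H₂) (hCF' : C' ⊆ H₁ ∩ H₂) :
    ∃ x ∈ ends G C, ∃ y ∈ ends G C', Reach G (H₁ ∩ H₂) x y := by
  by_contra! hno
  obtain ⟨m, a, b, hm, hadj⟩ := hG.exists_center
  have nonadj : ∀ {C C'}, C ∈ T.frame → C' ∈ T.frame → C ⊆ H₁ ∩ H₂ → C' ⊆ H₁ ∩ H₂ →
      (∀ x ∈ ends G C, ∀ y ∈ ends G C', ¬ Reach G (H₁ ∩ H₂) x y) →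
      ∀ x ∈ ends G C, ∀ y ∈ ends G C', x = m ∨ y = m := by
    intro C C' hC hC' hCF hCF' hno x hx y hy
    have hA := hM.not_adj_of_frame p.isFlat_inter hC hC' hCF hCF' hno hx hy
    have hxy : x ≠ y := fun h => hno x hx y hy (h ▸ .refl _)
    rcases hadj x (ends_subset_vertexSet _ hx) y (ends_subset_vertexSet _ hy) hxy hA with h | h
    exacts [.inl h.1, .inr h.1]
  obtain ⟨u, hu⟩ := (T.isCycle_frame hC).ends_nonempty
  obtain ⟨u', hu'⟩ := (T.isCycle_frame hC').ends_nonempty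
  have huu := nonadj hC hC' hCF hCF' hno u hu u' hu'
  obtain ⟨W, hW⟩ := exists_isTransversal hV (H₁ ∩ H₂) (ends G C ∪ ends G C')
  have hWn := hM.nrk_two_frame hV (Set.inter_subset_left.trans (p.subset_left hM)) hC hC' hCF hCF'
    hno (fun D hD hDF => by
      by_contra! hcon
      obtain ⟨v, hv⟩ := (T.isCycle_frame hD).ends_nonempty
      have h1 := nonadj hC hD hCF hDF hcon.1 u hu v hv
      have h2 := nonadj hC' hD hCF' hDF hcon.2 u' hu' v hv
      have n1 : u ≠ u' := fun h => hno u hu u' hu' (h ▸ .refl _)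
      have n2 : u ≠ v := fun h => hcon.1 u hu v hv (h ▸ .refl _)
      have n3 : u' ≠ v := fun h => hcon.2 u' hu' v hv (h ▸ .refl _)
      rcases huu with rfl | rfl
      · exact h2.elim (fun h => n1 h.symm) fun h => n2 h.symm
      · exact h1.elim n1 fun h => n3 h.symm) hW
  have hFn := p.nrk_inter
  obtain ⟨x, y, hxy, rfl⟩ := Set.ncard_eq_two.1 (show W.ncard = 2 by omega)
  have hx : x ∈ V(G) := hW.subset (by simp)
  have hy : y ∈ V(G) := hW.subset (by simp)
  have hne : ∀ z ∈ ends G C ∪ ends G C', z ≠ x ∧ z ≠ y := fun z hz =>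
    ⟨fun h => hW.not_reach z hz x (by simp) (h ▸ .refl _),
      fun h => hW.not_reach z hz y (by simp) (h ▸ .refl _)⟩
  -- the vertex `v` lies on one of the two cycles and is adjacent to `x` and `y`
  obtain ⟨v, hv, hvm⟩ : ∃ v ∈ ends G C ∪ ends G C', v ≠ m := by
    have n1 : u ≠ u' := fun h => hno u hu u' hu' (h ▸ .refl _)
    rcases huu with h | h
    · exact ⟨u', .inr hu', fun h' => n1 (h.trans h'.symm)⟩
    · exact ⟨u, .inl hu, fun h' => n1 (h'.trans h.symm)⟩
  have hmZ : m ∈ ends G C ∪ ends G C' := by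
    rcases huu with rfl | rfl
    exacts [.inl hu, .inr hu']
  have hvV : v ∈ V(G) := hv.elim (fun h => ends_subset_vertexSet _ h)
    fun h => ends_subset_vertexSet _ h
  have adj : ∀ s ∈ V(G), ∀ t ∈ V(G), s ≠ t → s ≠ m → t ≠ m → G.Adj s t := by
    intro s hs t ht hst hsm htm
    by_contra h
    rcases hadj s hs t ht hst h with h | h
    exacts [hsm h.1, htm h.1]
  obtain ⟨e, he⟩ := adj x hx y hy hxy (hne m hmZ).1.symm (hne m hmZ).2.symm
  obtain ⟨f, hf⟩ := adj v hvV x hx (hne v hv).1 hvm (hne m hmZ).1.symm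
  obtain ⟨g, hg⟩ := adj v hvV y hy (hne v hv).2 hvm (hne m hmZ).2.symm
  have key : ∀ {K K'}, HyperplanePair M K K' → K ∩ K' = H₁ ∩ H₂ → Reach G K v x → Reach G K v y →
      False := by
    intro K K' q hK rx ry
    have hFK : H₁ ∩ H₂ ⊆ K := hK ▸ Set.inter_subset_left
    refine q.not_cover hM hV hr hC hC' (hCF.trans hFK) (hCF'.trans hFK)
      (Set.disjoint_left.2 fun z hz hz' => hno z hz z hz' (.refl _)) fun z hz => ?_
    rcases hW.cov z hz with ⟨w, hw, h⟩ | ⟨w, rfl | rfl, h⟩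
    exacts [⟨w, hw, h.mono hFK⟩, ⟨v, hv, rx.trans (h.mono hFK)⟩, ⟨v, hv, ry.trans (h.mono hFK)⟩]
  have k : ∀ {K K'}, HyperplanePair M K K' → K ∩ K' = H₁ ∩ H₂ →
      ¬ (e ∈ K ∧ f ∈ K) ∧ ¬ (e ∈ K ∧ g ∈ K) ∧ ¬ (f ∈ K ∧ g ∈ K) := fun q hK =>
    ⟨fun h => key q hK (.of_link h.2 hf) (.trans (.of_link h.2 hf) (.of_link h.1 he)),
      fun h => key q hK (.trans (.of_link h.2 hg) (.of_link h.1 he.symm)) (.of_link h.2 hg),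
      fun h => key q hK (.of_link h.1 hf) (.of_link h.2 hg)⟩
  have k1 := k p rfl
  have k2 := k p.symm (Set.inter_comm _ _)
  have me := p.mem_or_mem hM he.edge_mem
  have mf := p.mem_or_mem hM hf.edge_mem
  have mg := p.mem_or_mem hM hg.edge_mem
  rcases me with me | me <;> rcases mf with mf | mf
  · exact k1.1 ⟨me, mf⟩
  · rcases mg with mg | mg
    exacts [k1.2.1 ⟨me, mg⟩, k2.2.2 ⟨mf, mg⟩]
  · rcases mg with mg | mg
    exacts [k1.2.2 ⟨mf, mg⟩, k2.2.1 ⟨me, mg⟩]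
  · exact k2.1 ⟨me, mf⟩

end HyperplanePair

end Forward

/-! ### Components with a frame-type cycle -/

section FrameComponent

variable {α β : Type*} {G : Graph α β} {T : ProperTripartition G} {M : Matroid β}
  {C H₁ H₂ : Set β} {V₁ V₂ V₃ : Set α}

namespace HyperplanePair

variable [M.Finite]

/-- Let `V₃` be the component of `H₁ ∩ H₂` with a frame-type cycle `C`, with no edges between `V₂`
and `V₃`, and let `H₁` contain an edge between `V₁` and `V₂`. Since neither hyperplane joins all
vertices, the edges between `V₁` and `V₂` are those of `H₁` and the edges between `V₁` and `V₃` are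
those of `H₂`. An unbalanced cycle of `H₁` in `V₁ ∪ V₂`, or of `H₁` or `H₂` in `V₂`, would be of
frame type like `C`, and the hyperplane would have full rank. Hence the edges of `H₁` in `V₁ ∪ V₂`,
together with a spanning forest of `V₃`, contain no unbalanced cycle, and their complement is a
balancing set. -/
lemma outcomeThreePrime_of_cross (p : HyperplanePair M H₁ H₂) (hM : T.IsMatroid M)
    (hV : V(G).Finite) (hG : ∀ x ∈ V(G), ∀ y ∈ V(G), Reach G E(G) x y)
    (hr : nrk M M.E = V(G).ncard) (hp : IsTripartition G V₁ V₂ V₃)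
    (h1 : IsPart G (H₁ ∩ H₂) V₁) (h2 : IsPart G (H₁ ∩ H₂) V₂) (h3 : IsPart G (H₁ ∩ H₂) V₃)
    (hC : C ∈ T.frame) (hCF : C ⊆ H₁ ∩ H₂) (hC3 : C ⊆ E(G.induce V₃))
    (h23 : edgesBetween G V₂ V₃ = ∅) (h12 : (H₁ ∩ edgesBetween G V₁ V₂).Nonempty) :
    OutcomeThreePrime T := by
  have cC := T.isCycle_frame hC
  have hCb := T.notMem_balanced_of_frame hC
  have i1 : H₁ ∩ H₂ ⊆ H₁ := Set.inter_subset_left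
  have i2 : H₁ ∩ H₂ ⊆ H₂ := Set.inter_subset_right
  have h21 : (H₁ ∩ edgesBetween G V₂ V₁).Nonempty := by rwa [edgesBetween_comm]
  obtain ⟨w, hw⟩ := cC.ends_nonempty
  have hw3 := mem_left_of_mem_ends hC3 hw
  have n13 : ∀ e ∈ edgesBetween G V₁ V₃, e ∉ H₁ := fun e he heH => hCb
    (p.balanced_of_reach hM hV hr (hp.swap.reach h2 h1 h3 i1 h21 ⟨e, heH, he⟩) cC (hCF.trans i1))
  have e13 : (H₂ ∩ edgesBetween G V₃ V₁).Nonempty := by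
    obtain ⟨u, hu⟩ := h1.nonempty
    obtain ⟨e, he, a, b, hl, ha, hb⟩ := exists_link_of_reach
      (hG w (h3.subset hw3) u (h1.subset hu)) hw3 fun h => Set.disjoint_left.1 hp.2.2.1 hu h
    have heB : e ∈ edgesBetween G V₁ V₃ := by
      rcases mem_tripartition hp hl.right_mem with h | h | h
      · exact ⟨b, h, a, ha, hl.symm⟩
      · have : e ∈ edgesBetween G V₂ V₃ := ⟨b, h, a, ha, hl.symm⟩
        simp [h23] at this
      · exact absurd h hb
    exact ⟨e, (p.mem_or_mem hM he).resolve_left (n13 e heB), edgesBetween_comm G V₁ V₃ ▸ heB⟩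
  have n12 : ∀ e ∈ edgesBetween G V₁ V₂, e ∉ H₂ := fun e he heH => hCb
    (p.symm.balanced_of_reach hM hV hr (hp.rotate.rotate.reach h3 h1 h2 i2 e13 ⟨e, heH, he⟩) cC
      (hCF.trans i2))
  have disj : ∀ D : Set β, ∀ A : Set α, D ⊆ E(G.induce A) → Disjoint A V₃ →
      Disjoint (ends G C) (ends G D) := fun D A hD hA => Set.disjoint_left.2 fun v hv hv' =>
    Set.disjoint_left.1 hA (mem_left_of_mem_ends hD hv') (mem_left_of_mem_ends hC3 hv)
  have d12 : Disjoint (V₁ ∪ V₂) V₃ := Set.disjoint_union_left.2 ⟨hp.2.2.1, hp.2.2.2⟩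
  have r12 := h1.reach_of_edgesBetween h2 i1 h12
  have bal : ∀ D, IsCycle G D → D ⊆ H₁ → D ⊆ E(G.induce (V₁ ∪ V₂)) → D ∈ T.balanced := by
    intro D cD hDH hDV
    by_contra hDb
    have hd := disj D _ hDV d12
    obtain ⟨v, hv⟩ := cD.ends_nonempty
    have hv' := mem_left_of_mem_ends hDV hv
    refine p.not_cover hM hV hr hC (T.frame_of_disjoint hC cD hDb hd) (hCF.trans i1) hDH hd
      fun x hx => ?_
    rcases mem_tripartition hp hx with h | h | h
    · exact ⟨v, .inr hv, hv'.elim (fun h' => (h1.reach v h' x h).mono i1)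
        fun h' => (r12 x h v h').symm⟩
    · exact ⟨v, .inr hv, hv'.elim (fun h' => r12 v h' x h)
        fun h' => (h2.reach v h' x h).mono i1⟩
    · exact ⟨w, .inl hw, (h3.reach w hw3 x h).mono i1⟩
  have in2 : ∀ e ∈ E(G.induce V₂), e ∈ H₁ ∩ H₂ := by
    intro e he
    by_contra heF
    obtain ⟨D, cD, hDb, hDs, hDV⟩ := h2.exists_cycle hM p.isFlat_inter he heF
    rcases p.mem_or_mem hM (edgeSet_induce_subset he) with h | h
    · exact hDb (bal D cD (hDs.trans (Set.insert_subset h i1))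
        (hDV.trans (edgeSet_induce_mono Set.subset_union_right)))
    · have hd := disj D _ hDV hp.2.2.2
      obtain ⟨v, hv⟩ := cD.ends_nonempty
      have hv' := mem_left_of_mem_ends hDV hv
      refine p.symm.not_cover hM hV hr hC (T.frame_of_disjoint hC cD hDb hd) (hCF.trans i2)
        (hDs.trans (Set.insert_subset h i2)) hd fun x hx => ?_
      rcases mem_tripartition hp hx with h | h | h
      · exact ⟨w, .inl hw, h3.reach_of_edgesBetween h1 i2 e13 w hw3 x h⟩
      · exact ⟨v, .inr hv, (h2.reach v hv' x h).mono i2⟩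
      · exact ⟨w, .inl hw, (h3.reach w hw3 x h).mono i2⟩
  have hfin : (H₁ ∩ H₂ ∩ E(G.induce V₃)).Finite :=
    (hM.1 ▸ M.ground_finite : E(G).Finite).subset
      (Set.inter_subset_right.trans edgeSet_induce_subset)
  obtain ⟨F₃, hF₃, hF₃r, hF₃c⟩ := exists_forest G hfin
  have hF₃V : F₃ ⊆ E(G.induce V₃) := hF₃.trans Set.inter_subset_right
  set Y := H₁ ∩ E(G.induce (V₁ ∪ V₂)) ∪ F₃ with hY
  have hYV : Y ⊆ E(G.induce (V₁ ∪ V₂)) ∪ E(G.induce V₃) :=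
    Set.union_subset_union Set.inter_subset_right hF₃V
  refine ⟨V₁, V₂, V₃, E(G) \ Y, hp, ⟨Set.sdiff_subset, ⟨C, cC, hCb⟩, fun D hD => ?_⟩,
    fun e he => ?_, h1.isConnected_deleteEdges ?_, h2.isConnected, ?_, ⟨C, hC, hC3⟩, h23⟩
  · obtain ⟨cD, hd⟩ := isCycle_deleteEdges_iff.1 hD
    have hDY : D ⊆ Y := fun e he => by
      by_contra heY
      exact Set.disjoint_left.1 hd he ⟨cD.subset_edgeSet he, heY⟩
    by_cases hDF : D ⊆ H₁ ∩ E(G.induce (V₁ ∪ V₂))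
    · exact bal D cD (hDF.trans Set.inter_subset_left) (hDF.trans Set.inter_subset_right)
    -- a cycle with an edge in the forest stays inside `V₃`, hence inside the forest
    refine absurd (fun e he => ?_) (hF₃c D cD)
    obtain ⟨f, hfD, hf⟩ := Set.not_subset.1 hDF
    obtain ⟨c, d, hcd, hc, -⟩ := hF₃V ((hDY hfD).resolve_left hf)
    obtain ⟨a, b, hl⟩ := Graph.exists_isLink_of_mem_edgeSet (cD.subset_edgeSet he)
    have ha : a ∈ V₃ := ((cD.reach ⟨f, hfD, hcd.inc_left⟩ ⟨e, he, hl.inc_left⟩).mono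
      hDY).mem_of_closed hc (closed_of_induce_union d12 hYV)
    exact (hDY he).resolve_left fun h =>
      Set.disjoint_left.1 d12 ((mem_edgeSet_induce hl).1 h.2).1 ha
  · have h32 : edgesBetween G V₃ V₂ = ∅ := by rwa [edgesBetween_comm]
    rcases mem_induce_or_of_edgesBetween_eq_empty hp.rotate.swap h32 he.1 with h | h
    · rwa [Set.union_comm]
    · rw [Set.union_comm] at h
      have heH : e ∉ H₁ := fun h' => he.2 (.inl ⟨h', h⟩)
      have heH₂ : e ∈ H₂ := (p.mem_or_mem hM he.1).resolve_left heH
      obtain ⟨a, b, hl, ha, hb⟩ := h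
      rcases ha with ha | ha <;> rcases hb with hb | hb
      · exact (mem_edgeSet_induce hl).2 ⟨.inl ha, .inl hb⟩
      · exact absurd heH₂ (n12 e ⟨a, ha, b, hb, hl⟩)
      · exact absurd heH₂ (n12 e ⟨b, hb, a, ha, hl.symm⟩)
      · exact absurd (in2 e ((mem_edgeSet_induce hl).2 ⟨ha, hb⟩)).1 heH
  · exact Set.disjoint_left.2 fun e he he' =>
      he'.2 (.inl ⟨he.1.1, edgeSet_induce_mono Set.subset_union_left he.2⟩)
  · exact isConnected_induce_deleteEdges_iff.2 ⟨h3.nonempty, fun x hx y hy =>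
      (hF₃r _ _ (h3.reach_induce hx hy)).mono fun e he => ⟨hF₃V he, fun h => h.2 (.inr he)⟩⟩

/-- The preceding lemma applies to whichever hyperplane contains an edge between `V₁` and `V₂`; such
an edge exists as `G` is connected. -/
lemma outcomeThreePrime (p : HyperplanePair M H₁ H₂) (hM : T.IsMatroid M)
    (hV : V(G).Finite) (hG : ∀ x ∈ V(G), ∀ y ∈ V(G), Reach G E(G) x y)
    (hr : nrk M M.E = V(G).ncard) (hp : IsTripartition G V₁ V₂ V₃)
    (h1 : IsPart G (H₁ ∩ H₂) V₁) (h2 : IsPart G (H₁ ∩ H₂) V₂) (h3 : IsPart G (H₁ ∩ H₂) V₃)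
    (hC : C ∈ T.frame) (hCF : C ⊆ H₁ ∩ H₂) (hC3 : C ⊆ E(G.induce V₃))
    (h23 : edgesBetween G V₂ V₃ = ∅) : OutcomeThreePrime T := by
  obtain ⟨u, hu⟩ := h2.nonempty
  obtain ⟨v, hv⟩ := h1.nonempty
  obtain ⟨e, he, a, b, hl, ha, hb⟩ := exists_link_of_reach (hG u (h2.subset hu) v (h1.subset hv)) hu
    fun h => Set.disjoint_left.1 hp.2.1 hv h
  have heB : e ∈ edgesBetween G V₁ V₂ := by
    rcases mem_tripartition hp hl.right_mem with h | h | h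
    · exact ⟨b, h, a, ha, hl.symm⟩
    · exact absurd h hb
    · have : e ∈ edgesBetween G V₂ V₃ := ⟨a, ha, b, h, hl⟩
      simp [h23] at this
  rcases p.mem_or_mem hM he with h | h
  · exact p.outcomeThreePrime_of_cross hM hV hG hr hp h1 h2 h3 hC hCF hC3 h23 ⟨e, h, heB⟩
  · rw [Set.inter_comm] at h1 h2 h3 hCF
    exact p.symm.outcomeThreePrime_of_cross hM hV hG hr hp h1 h2 h3 hC hCF hC3 h23 ⟨e, h, heB⟩

/-- If `H₁ ∩ H₂` contains an unbalanced cycle `C`, this flat has three components, one of which contains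
`C`, and two of them have no edge between them. -/
lemma outcome_of_unbalanced_inter (p : HyperplanePair M H₁ H₂) (hM : T.IsMatroid M)
    (hV : V(G).Finite) (hNC : IsNearlyComplete G) (hG : ∀ x ∈ V(G), ∀ y ∈ V(G), Reach G E(G) x y)
    (hC : IsCycle G C) (hCb : C ∉ T.balanced) (hCF : C ⊆ H₁ ∩ H₂) :
    OutcomeOne T ∨ OutcomeThreePrime T ∨ OutcomeFive T := by
  have hr := hM.nrk_ground_eq hV hG hC hCb
  obtain ⟨W, hW⟩ := exists_isTransversal hV (H₁ ∩ H₂) (ends G C)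
  have hWn := hM.nrk_unbalanced hV (Set.inter_subset_left.trans (p.subset_left hM)) hC hCb hCF
    (fun hf D hD hDF => p.exists_reach_of_frame hM hV hNC hr hf hD hCF hDF) hW
  have hFn := p.nrk_inter
  obtain ⟨x, y, hxy, rfl⟩ := Set.ncard_eq_two.1 (show W.ncard = 2 by omega)
  obtain ⟨w, hw⟩ := hC.ends_nonempty
  have hx : x ∈ V(G) := hW.subset (by simp)
  have hy : y ∈ V(G) := hW.subset (by simp)
  have hwV : w ∈ V(G) := ends_subset_vertexSet _ hw
  have hp : IsTripartition G {v | Reach G (H₁ ∩ H₂) x v} {v | Reach G (H₁ ∩ H₂) y v}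
      {v | Reach G (H₁ ∩ H₂) w v} := isTripartition_of_reach hx hy hwV
    (fun h => hxy (hW.inj x (by simp) y (by simp) h))
    (fun h => hW.not_reach w hw x (by simp) h.symm)
    (fun h => hW.not_reach w hw y (by simp) h.symm) (fun v hv => by
      rcases hW.cov v hv with ⟨z, hz, h⟩ | ⟨z, rfl | rfl, h⟩
      exacts [.inr (.inr (((hC.reach hw hz).mono hCF).trans h)), .inl h, .inr (.inl h)])
  have h1 : IsPart G (H₁ ∩ H₂) _ := isPart_setOf_reach hx
  have h2 : IsPart G (H₁ ∩ H₂) _ := isPart_setOf_reach hy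
  have h3 : IsPart G (H₁ ∩ H₂) _ := isPart_setOf_reach hwV
  have hC3 := h3.cycle_subset hC hCF hw (.refl w)
  have hempty := hp.edgesBetween_eq_empty (fun e he => p.mem_or_mem hM he) h1 h2 h3
    (fun h => hCb (p.balanced_of_reach hM hV hr h hC (hCF.trans Set.inter_subset_left)))
    (fun h => hCb (p.symm.balanced_of_reach hM hV hr h hC (hCF.trans Set.inter_subset_right)))
  rcases T.lift_or_frame hC hCb with hl | hf
  · exact .inl (hp.outcomeOne h1 h2 h3 hempty (.inl ⟨C, hl, hC3⟩))
  · rcases hempty with h | h | h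
    · exact .inr (.inr ⟨_, _, _, hp, h1.isConnected, h2.isConnected, h3.isConnected, h, C, hf, hC3⟩)
    · exact .inr (.inl (p.outcomeThreePrime hM hV hG hr hp h1 h2 h3 hf hCF hC3 h))
    · rw [edgesBetween_comm] at h
      exact .inr (.inl (p.outcomeThreePrime hM hV hG hr hp.swap h2 h1 h3 hf hCF hC3 h))

lemma outcome (p : HyperplanePair M H₁ H₂) (hM : T.IsMatroid M) (hV : V(G).Finite)
    (hG : IsNearlyComplete G) (hn : 3 < V(G).ncard) :
    OutcomeOne T ∨ OutcomeTwo T ∨ OutcomeThree T ∨ OutcomeThreePrime T ∨ OutcomeFour T ∨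
      OutcomeFive T := by
  have hconn := hG.reach hn
  by_cases hunb : ∃ C, IsCycle G C ∧ C ∉ T.balanced
  · by_cases hF : ∃ C, IsCycle G C ∧ C ∉ T.balanced ∧ C ⊆ H₁ ∩ H₂
    · obtain ⟨C, hC, hCb, hCF⟩ := hF
      have := p.outcome_of_unbalanced_inter hM hV hG hconn hC hCb hCF
      tauto
    · obtain ⟨C, hC, hCb⟩ := hunb
      have := p.outcome_of_balanced_inter hM hV hconn (hM.nrk_ground_eq hV hconn hC hCb)
        ⟨C, hC, hCb⟩ fun D hD hDF => by
          by_contra hDb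
          exact hF ⟨D, hD, hDb, hDF⟩
      tauto
  · push Not at hunb
    exact .inl (p.outcomeOne_of_balanced hM hV ((Set.ncard_pos hV).1 (by omega)) hconn hunb)

end HyperplanePair

end FrameComponent

end QuasiGraphic

theorem theorem1p6 {α β : Type*} (G : Graph α β) (hV : V(G).Finite) (hE : E(G).Finite)
    (hG : IsNearlyComplete G) :
    -- 3-connectivity, for a matroid with framework `G`
    (6 < V(G).ncard → ∀ M : Matroid β, IsFramework M G →
      (ThreeConnected M ↔
        MatroidSimple M ∧ ¬ ∃ X, IsBalancingSet G (circuitCycles M G) X ∧ M.eRk X ≤ 2)) ∧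
    -- 3-connectivity, for the matroid of a proper tripartition
    (6 < V(G).ncard → ∀ (T : ProperTripartition G) (M : Matroid β), T.IsMatroid M →
      (ThreeConnected M ↔
        MatroidSimple M ∧ ¬ ∃ X, IsBalancingSet G T.balanced X ∧ M.eRk X ≤ 2)) ∧
    -- unbreakability
    (3 < V(G).ncard → ∀ (T : ProperTripartition G) (M : Matroid β), T.IsMatroid M →
      MatroidConnected M →
      (¬ Unbreakable M ↔
        OutcomeOne T ∨ OutcomeTwo T ∨ OutcomeThree T ∨ OutcomeThreePrime T ∨ OutcomeFour T ∨
          OutcomeFive T)) := by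
  refine ⟨fun hn M hM => ?_, fun hn T M hM => ?_, fun hn T M hM hc => ⟨fun h => ?_, fun h => ?_⟩⟩
  · have : M.Finite := ⟨hM.ground_eq ▸ hE⟩
    exact hM.threeConnected_iff hV hG hn
  all_goals have : M.Finite := ⟨hM.1 ▸ hE⟩
  · exact hM.threeConnected_iff hV hG hn
  · obtain ⟨H₁, H₂, p⟩ := exists_hyperplanePair hc h
    exact p.outcome hM hV hG hn
  · have hconn := hG.reach hn
    rcases h with h | h | h | h | h | h
    exacts [h.not_unbreakable hM hV hconn, h.not_unbreakable hM hV hconn,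
      h.not_unbreakable hM hV hconn, h.not_unbreakable hM hV hconn,
      h.not_unbreakable hM hV hconn, h.not_unbreakable hM hV hconn]
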